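/- All of the following notions concern ordinals $\kappa$ and sets $S, C$ of ordinals, and are defined by simultaneous recursion on the ordinal $\gamma$; stationarity is only considered at nonzero limit ordinals $\kappa$. $S$ is $0$-stationary in $\kappa$ if $S$ is unbounded in $\kappa$. $C\subseteq\kappa$ is $\gamma$-club in $\kappa$ if $C$ is $\gamma$-stationary in $\kappa$ and $\alpha\in C$ for every $\alpha<\kappa$ such that $C$ is $\gamma$-stationary in $\alpha$. $\kappa$ is $\gamma$-reflecting if for all $A,B\subseteq\kappa$ that are $\gamma$-stationary in $\kappa$ there is $\alpha<\kappa$ such that $A$ and $B$ are both $\gamma$-stationary in $\alpha$. For $\gamma>0$, $S$ is $\gamma$-stationary in $\kappa$ if for all $\eta<\gamma$, $\kappa$ is $\eta$-reflecting and $S\cap C\neq\emptyset$ for every $C$ that is $\eta$-club in $\kappa$. Let $\mathcal C^\gamma(\kappa)$ be the family of subsets of $\kappa$ that contain a $\gamma$-club of $\kappa$; it is $\kappa$-complete if it is closed under intersections of fewer than $\kappa$ (and at least one) of its members. An uncountable cardinal $\kappa$ is weakly compact if every $f:[\kappa]^2\to 2$ has a homogeneous set of cardinality $\kappa$. For an ordinal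 $\alpha$, a set $A\subseteq V_\alpha$ and a first-order formula $\varphi(\vec X,\vec Y,A)$ over $\langle V_\alpha,\in\rangle$ with predicates for $A$ and for two finite sequences $\vec X,\vec Y$ of subsets of $V_\alpha$, the game $G_\gamma(\alpha,\varphi,A)$ is played as follows by players $\Sigma$ and $\Pi$, with $\gamma_0=\gamma$ (an ordinal is odd if it is a limit ordinal or $0$ plus an odd natural number, and even otherwise). If $\gamma$ is even, then in round $n\ge 1$ player $\Sigma$ plays an odd ordinal $\gamma_n<\gamma_{n-1}$ and $X_n\subseteq V_\alpha$, and then $\Pi$ plays $Y_n\subseteq V_\alpha$ such that $\varphi(\langle X_1,\dots,X_n\rangle,\langle Y_1,\dots,Y_n\rangle,A)$ holds over $V_\alpha$. If $\gamma$ is odd, then in round $n\ge1$ player $\Sigma$ plays $Y_n\subseteq V_\alpha$ such that $\varphi(\langle X_1,\dots,X_{n-1}\rangle,\langle Y_1,\dots,Y_n\rangle,A)$ holds over $V_\alpha$, and then $\Pi$ plays an odd ordinal $\gamma_n<\gamma_{n-1}$ and $X_n\subseteq V_\alpha$. The first player who is unable to move loses; a player wins the game if that player has a winning strategy. A cardinal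 $\kappa$ is $\Pi^1_\gamma$-indescribable if for all $\varphi$ and all $A\subseteq V_\kappa$ such that $\Pi$ wins $G_\gamma(\kappa,\varphi,A)$ there is $\alpha<\kappa$ such that $\Pi$ wins $G_\gamma(\alpha,\varphi,A\cap V_\alpha)$. **Theorem.** Let $\kappa$ be a cardinal. (1) Let $\gamma$ be an ordinal. If $\kappa$ is weakly compact and $\mathcal C^{\gamma}(\kappa)$ is $\kappa$-complete, then every $S\subseteq\kappa$ that is $(\gamma+1)$-stationary in $\kappa$ is the union of $\kappa$ many pairwise disjoint sets that are $(\gamma+1)$-stationary in $\kappa$. (2) Let $\gamma\ge1$ be an ordinal. If $\kappa$ is $\Pi^1_\gamma$-indescribable, then every $S\subseteq\kappa$ that is $(\gamma+1)$-stationary in $\kappa$ is the union of $\kappa$ many pairwise disjoint sets that are $(\gamma+1)$-stationary in $\kappa$. (3) Let $n\ge 1$ be a natural number. If $\kappa$ is $\Pi^1_n$-indescribable in the usual sense ($\kappa$ is uncountable, and for every $R\subseteq V_\kappa$, every $\Pi^1_n$ sentence true in $\langle V_\kappa,\in,R\rangle$ is true in $\langle V_\alpha,\in,R\cap V_\alpha\rangle$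 for some $\alpha<\kappa$), then every $S\subseteq\kappa$ that is $(n+1)$-stationary in $\kappa$ is the union of $\kappa$ many pairwise disjoint sets that are $(n+1)$-stationary in $\kappa$. -/

import Mathlib

universe u

open Set

namespace HigherStat

/-! ### Generalised clubs and stationary sets -/

/-- `S` is unbounded in `κ`. -/
def UnboundedIn (κ : Ordinal.{u}) (S : Set Ordinal.{u}) : Prop :=
  ∀ β < κ, ∃ s ∈ S, β < s ∧ s < κ

/-- For a notion `P κ S` of "`S` is large in `κ`": any two large subsets of `κ` are simultaneously
large in some `α < κ`. -/
def ReflectsFor (P : Ordinal.{u} → Set Ordinal.{u} → Prop) (κ : Ordinal.{u}) : Prop :=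
  ∀ A ⊆ Iio κ, ∀ B ⊆ Iio κ, P κ A → P κ B → ∃ α < κ, P α A ∧ P α B

/-- For a notion `P κ S` of "`S` is large in `κ`": the set `C ⊆ κ` is large in `κ` and contains
every `α < κ` in which it is large. -/
def ClubFor (P : Ordinal.{u} → Set Ordinal.{u} → Prop) (κ : Ordinal.{u})
    (C : Set Ordinal.{u}) : Prop :=
  C ⊆ Iio κ ∧ P κ C ∧ ∀ α < κ, P α C → α ∈ C

/-- `IsStationary γ κ S`: the set of ordinals `S` is `γ`-stationary in `κ`.
A set is `0`-stationary in `κ` if it is unbounded in `κ`; for `γ > 0` it is `γ`-stationary in `κ`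
if for all `η < γ` the ordinal `κ` is `η`-reflecting and `S` meets every `η`-club of `κ`.
As usual these notions are only considered at (nonzero) limit ordinals `κ`, so that the ordinals in
which a set is `0`-stationary are its limit points. -/
def IsStationary (γ : Ordinal.{u}) : Ordinal.{u} → Set Ordinal.{u} → Prop :=
  fun κ S =>
    Order.IsSuccLimit κ ∧ (γ = 0 → UnboundedIn κ S) ∧
      ∀ η, ∀ _h : η < γ, ReflectsFor (IsStationary η) κ ∧
        ∀ C, ClubFor (IsStationary η) κ C → (S ∩ C).Nonempty
termination_by γ

/-- `C` is `γ`-club in `κ`. -/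
def IsGClub (γ κ : Ordinal.{u}) (C : Set Ordinal.{u}) : Prop :=
  ClubFor (IsStationary γ) κ C

/-- `κ` is `γ`-reflecting. -/
def IsReflecting (γ κ : Ordinal.{u}) : Prop :=
  ReflectsFor (IsStationary γ) κ

/-- `𝒞^γ(κ)`: the subsets of `κ` that contain a `γ`-club of `κ` (a filter on `κ` if `κ` is
`γ`-reflecting; any `κ` with a `(γ+1)`-stationary subset is). -/
def clubFilter (γ κ : Ordinal.{u}) : Set (Set Ordinal.{u}) :=
  {X | X ⊆ Iio κ ∧ ∃ C, IsGClub γ κ C ∧ C ⊆ X}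

/-- A family of sets is `κ`-complete: it is closed under (nonempty) intersections of fewer than `κ`
of its members. -/
def IsComplete (κ : Cardinal.{u}) (F : Set (Set Ordinal.{u})) : Prop :=
  ∀ (ι : Type u) [Nonempty ι] (X : ι → Set Ordinal.{u}),
    Cardinal.mk ι < κ → (∀ i, X i ∈ F) → (⋂ i, X i) ∈ F

/-- `S` is the union of `κ` many pairwise disjoint sets that are `γ`-stationary in `κ`. -/
def Splits (γ : Ordinal.{u}) (κ : Cardinal.{u}) (S : Set Ordinal.{u}) : Prop :=
  ∃ P : Iio κ.ord → Set Ordinal.{u},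
    (∀ i, IsStationary γ κ.ord (P i)) ∧ (∀ i j, i ≠ j → Disjoint (P i) (P j)) ∧ ⋃ i, P i = S

/-- `κ` is weakly compact: it is uncountable and every colouring of the pairs from `κ` with two
colours has a homogeneous set of cardinality `κ`. -/
def IsWeaklyCompact (κ : Cardinal.{u}) : Prop :=
  Cardinal.aleph0 < κ ∧
    ∀ f : Ordinal.{u} → Ordinal.{u} → Fin 2, ∃ X ⊆ Iio κ.ord,
      Cardinal.mk X = Cardinal.lift.{u + 1} κ ∧
        ∃ c, ∀ a ∈ X, ∀ b ∈ X, a < b → f a b = c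

/-! ### Indescribability -/

/-- The domain of `V_α`. -/
abbrev VDom (α : Ordinal.{u}) : Type (u + 1) :=
  {x : ZFSet.{u} // x ∈ ZFSet.vonNeumann α}

/-- `A ∩ V_α` as a subset of `V_α`. -/
def restrict (A : Set ZFSet.{u}) (α : Ordinal.{u}) : Set (VDom α) :=
  {x | x.1 ∈ A}

/-- Relation symbols: membership, a unary predicate `R`, and unary predicates `X₀, X₁, …`. -/
inductive SecondOrderRel : ℕ → Type
  | mem : SecondOrderRel 2
  | par : SecondOrderRel 1
  | var (k : ℕ) : SecondOrderRel 1

/-- The language of set theory with predicates `R, X₀, X₁, …`. -/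
def secondOrderLang : FirstOrder.Language.{0, 0} :=
  ⟨fun _ => Empty, SecondOrderRel⟩

/-- The structure `⟨V_α, ∈, R, X₀, …, Xₘ₋₁⟩` (with `X_k = ∅` for `k ≥ m`). -/
@[reducible] def secondOrderStructure (α : Ordinal.{u}) (R : Set (VDom α)) (X : List (Set (VDom α))) :
    secondOrderLang.Structure (VDom α) where
  funMap := fun f => f.elim
  RelMap := fun r v =>
    match r, v with
    | .mem, v => (v 0).1 ∈ (v 1).1
    | .par, v => v 0 ∈ R
    | .var k, v => v 0 ∈ X.getD k ∅

/-- `⟨V_α, ∈, R, X⟩ ⊨ Q X_m … Q X_{m+n-1} ψ`, where `m` is the length of `X`, there are `n`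
alternating second order quantifiers, the first of which is universal if `b = true` and existential
if `b = false`, and `ψ` is first order. -/
def AltHolds (α : Ordinal.{u}) (ψ : secondOrderLang.Sentence) (R : Set (VDom α)) :
    ℕ → Bool → List (Set (VDom α)) → Prop
  | 0, _, X => @FirstOrder.Language.Sentence.Realize secondOrderLang (VDom α)
      (secondOrderStructure α R X) ψ
  | n + 1, true, X => ∀ Z, AltHolds α ψ R n false (X ++ [Z])
  | n + 1, false, X => ∃ Z, AltHolds α ψ R n true (X ++ [Z])

/-- `κ` is `Π¹ₙ`-indescribable for a natural number `n`: every `Π¹ₙ` sentence with a predicate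
`R ⊆ V_κ` that holds in `⟨V_κ, ∈, R⟩` holds in `⟨V_α, ∈, R ∩ V_α⟩` for some `α < κ`. -/
def IsFinIndescribable (n : ℕ) (κ : Cardinal.{u}) : Prop :=
  Cardinal.aleph0 < κ ∧
    ∀ (ψ : secondOrderLang.Sentence) (R : Set ZFSet.{u}),
      (∀ x ∈ R, x ∈ ZFSet.vonNeumann κ.ord) →
      AltHolds κ.ord ψ (restrict R κ.ord) n true [] →
      ∃ α < κ.ord, AltHolds α ψ (restrict R α) n true []

/-- An ordinal is odd if it is of the form `l + n` with `l` zero or a limit ordinal and `n` an odd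
natural number. -/
def IsOddOrdinal (α : Ordinal.{u}) : Prop :=
  ∃ (l : Ordinal.{u}) (n : ℕ), Order.IsSuccPrelimit l ∧ Odd n ∧ α = l + n

/-- Relation symbols for the matrix `φ(X⃗, Y⃗, A)` of a game: membership, the predicate `A`, and, for
the finite sequences `X⃗`, `Y⃗` of sets, the predicates "`i` is in the domain of the sequence" and
"`x` is an element of the `i`-th entry of the sequence". -/
inductive GameRel : ℕ → Type
  | mem : GameRel 2
  | par : GameRel 1
  | domX : GameRel 1
  | entryX : GameRel 2
  | domY : GameRel 1
  | entryY : GameRel 2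

/-- The language of the matrices of games. -/
def gameLang : FirstOrder.Language.{0, 0} :=
  ⟨fun _ => Empty, GameRel⟩

/-- The structure `⟨V_α, ∈, X⃗, Y⃗, A⟩`; the entries of a sequence of length `m` are indexed by the
von Neumann numerals `0, …, m - 1`. -/
@[reducible] def gameStructure (α : Ordinal.{u}) (X Y : List (Set (VDom α))) (A : Set (VDom α)) :
    gameLang.Structure (VDom α) where
  funMap := fun f => f.elim
  RelMap := fun r v =>
    match r, v with
    | .mem, v => (v 0).1 ∈ (v 1).1
    | .par, v => v 0 ∈ A
    | .domX, v => ∃ k < X.length, (v 0).1 = Ordinal.toZFSet (k : Ordinal.{u})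
    | .entryX, v => ∃ k < X.length, (v 0).1 = Ordinal.toZFSet (k : Ordinal.{u}) ∧ v 1 ∈ X.getD k ∅
    | .domY, v => ∃ k < Y.length, (v 0).1 = Ordinal.toZFSet (k : Ordinal.{u})
    | .entryY, v => ∃ k < Y.length, (v 0).1 = Ordinal.toZFSet (k : Ordinal.{u}) ∧ v 1 ∈ Y.getD k ∅

/-- `φ(X⃗, Y⃗, A)` holds over `V_α`, for a first order `φ`. -/
def MatrixHolds (α : Ordinal.{u}) (φ : gameLang.Sentence) (A : Set (VDom α))
    (X Y : List (Set (VDom α))) : Prop :=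
  @FirstOrder.Language.Sentence.Realize gameLang (VDom α) (gameStructure α X Y A) φ

/-- Player `Π` has a winning strategy in the even game over `V_α` from the position in which the
sets `X⃗`, `Y⃗` have been played, the last ordinal played is `δ`, and `Σ` is to move: `Σ` plays an odd
ordinal `ε < δ` and a set `Z`, then `Π` plays a set `W` such that `φ(X⃗⌢Z, Y⃗⌢W, A)` holds; the first
player who is unable to move loses. -/
def PiWinsEven (α : Ordinal.{u}) (φ : gameLang.Sentence) (A : Set (VDom α)) (δ : Ordinal.{u}) :
    List (Set (VDom α)) → List (Set (VDom α)) → Prop :=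
  fun X Y =>
    ∀ ε, ∀ _h : ε < δ, IsOddOrdinal ε → ∀ Z : Set (VDom α), ∃ W : Set (VDom α),
      MatrixHolds α φ A (X ++ [Z]) (Y ++ [W]) ∧ PiWinsEven α φ A ε (X ++ [Z]) (Y ++ [W])
termination_by δ

/-- Player `Π` has a winning strategy in the odd game over `V_α` from the position in which the
sets `X⃗`, `Y⃗` have been played, the last ordinal played is `δ`, and `Σ` is to move: `Σ` plays a set
`W` such that `φ(X⃗, Y⃗⌢W, A)` holds, then `Π` plays an odd ordinal `ε < δ` and a set `Z`; the first
player who is unable to move loses. -/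
def PiWinsOdd (α : Ordinal.{u}) (φ : gameLang.Sentence) (A : Set (VDom α)) (δ : Ordinal.{u}) :
    List (Set (VDom α)) → List (Set (VDom α)) → Prop :=
  fun X Y =>
    ∀ W : Set (VDom α), MatrixHolds α φ A X (Y ++ [W]) →
      ∃ ε, ∃ _h : ε < δ, IsOddOrdinal ε ∧ ∃ Z : Set (VDom α),
        PiWinsOdd α φ A ε (X ++ [Z]) (Y ++ [W])
termination_by δ

/-- Player `Π` wins the game `G_γ(α, φ, A)`. -/
def PiWins (γ α : Ordinal.{u}) (φ : gameLang.Sentence) (A : Set (VDom α)) : Prop :=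
  (IsOddOrdinal γ → PiWinsOdd α φ A γ [] []) ∧ (¬ IsOddOrdinal γ → PiWinsEven α φ A γ [] [])

/-- `κ` is `Π¹_γ`-indescribable for an ordinal `γ`: whenever `Π` wins `G_γ(κ, φ, A)` with
`A ⊆ V_κ`, then `Π` wins `G_γ(α, φ, A ∩ V_α)` for some `α < κ`. -/
def IsIndescribable (γ : Ordinal.{u}) (κ : Cardinal.{u}) : Prop :=
  ∀ (φ : gameLang.Sentence) (A : Set ZFSet.{u}),
    (∀ x ∈ A, x ∈ ZFSet.vonNeumann κ.ord) →
    PiWins γ κ.ord φ (restrict A κ.ord) →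
    ∃ α < κ.ord, PiWins γ α φ (restrict A α)

end HigherStat

/-!
A `(γ + 1)`-stationary subset `S` of `κ` splits into two `(γ + 1)`-stationary pieces. Otherwise the
`γ`-club filter would induce a `κ`-complete ultrafilter on it, which could be replaced by a normal
one, and `S` would be `(γ + 1)`-stationary at almost all points of `S`; but the points of `S` at
which it is not form a `(γ + 1)`-stationary set. Iterating the halving gives a binary tree of
disjoint decompositions. The branch property of a weakly compact cardinal provides a branch of
length `κ` through this tree, and the pieces split off along the branch are the disjoint stationary
sets.

An indescribable cardinal has the branch property, and its `γ`-club filter is `κ`-complete, because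
the failure of either can be expressed by a game whose moves are definable conditions on subsets of
`V_α`: a counterexample to the branch property is expressed by a single move, and non-stationarity
by a game in which the players descend through the ordinals below `γ`, the rank of the game
absorbing the level of indescribability.
-/

namespace HigherStat

/-! ### Basic properties of higher stationarity -/

section Stationary

variable {γ η κ β : Ordinal.{u}} {S T C D : Set Ordinal.{u}}

theorem isStationary_iff :
    IsStationary γ κ S ↔ Order.IsSuccLimit κ ∧ (γ = 0 → UnboundedIn κ S) ∧
      ∀ η < γ, IsReflecting η κ ∧ ∀ C, IsGClub η κ C → (S ∩ C).Nonempty := by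
  rw [IsStationary]
  rfl

theorem IsStationary.isSuccLimit (h : IsStationary γ κ S) : Order.IsSuccLimit κ :=
  (isStationary_iff.1 h).1

theorem IsStationary.isReflecting (h : IsStationary γ κ S) (hη : η < γ) : IsReflecting η κ :=
  ((isStationary_iff.1 h).2.2 η hη).1

theorem IsStationary.inter_nonempty (h : IsStationary γ κ S) (hη : η < γ) (hC : IsGClub η κ C) :
    (S ∩ C).Nonempty :=
  ((isStationary_iff.1 h).2.2 η hη).2 C hC

theorem isStationary_zero :
    IsStationary 0 κ S ↔ Order.IsSuccLimit κ ∧ UnboundedIn κ S := by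
  rw [isStationary_iff]
  simp

theorem isStationary_iff_of_pos (hγ : 0 < γ) :
    IsStationary γ κ S ↔ Order.IsSuccLimit κ ∧
      ∀ η < γ, IsReflecting η κ ∧ ∀ C, IsGClub η κ C → (S ∩ C).Nonempty := by
  simp [isStationary_iff, hγ.ne']

theorem IsStationary.of_inter_Iio_subset (h : IsStationary γ κ S) (hST : S ∩ Iio κ ⊆ T) :
    IsStationary γ κ T := by
  rw [isStationary_iff] at h ⊢
  refine ⟨h.1, fun hη β hβ => ?_, fun η hη => ⟨(h.2.2 η hη).1, fun C hC => ?_⟩⟩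
  · obtain ⟨s, hs, hβs, hsκ⟩ := h.2.1 hη β hβ
    exact ⟨s, hST ⟨hs, hsκ⟩, hβs, hsκ⟩
  · obtain ⟨x, hx, hxC⟩ := (h.2.2 η hη).2 C hC
    exact ⟨x, hST ⟨hx, hC.1 hxC⟩, hxC⟩

theorem IsStationary.superset (h : IsStationary γ κ S) (hST : S ⊆ T) : IsStationary γ κ T :=
  h.of_inter_Iio_subset (inter_subset_left.trans hST)

theorem IsStationary.inter_Iio (h : IsStationary γ κ S) : IsStationary γ κ (S ∩ Iio κ) :=
  h.of_inter_Iio_subset subset_rfl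

theorem IsReflecting.exists_isStationary (hr : IsReflecting γ κ) (hS : IsStationary γ κ S)
    (hT : IsStationary γ κ T) : ∃ α < κ, IsStationary γ α S ∧ IsStationary γ α T := by
  obtain ⟨α, hα, hSα, hTα⟩ := hr _ inter_subset_right _ inter_subset_right hS.inter_Iio hT.inter_Iio
  exact ⟨α, hα, IsStationary.superset hSα inter_subset_left,
    IsStationary.superset hTα inter_subset_left⟩

theorem isGClub_zero_Ioo (hκ : Order.IsSuccLimit κ) (hβ : β < κ) : IsGClub 0 κ (Ioo β κ) := by
  refine ⟨fun x hx => hx.2, isStationary_zero.2 ⟨hκ, fun δ hδ => ?_⟩, fun α hα h => ?_⟩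
  · have hsucc : Order.succ (max β δ) < κ := hκ.succ_lt (max_lt hβ hδ)
    exact ⟨Order.succ (max β δ), ⟨Order.lt_succ_of_le (le_max_left _ _), hsucc⟩,
      Order.lt_succ_of_le (le_max_right _ _), hsucc⟩
  · obtain ⟨s, hs, -, hsα⟩ := (isStationary_zero.1 h).2 0 h.isSuccLimit.bot_lt
    exact ⟨hs.1.trans hsα, hα⟩

theorem IsStationary.unboundedIn (h : IsStationary γ κ S) : UnboundedIn κ S := by
  rcases eq_or_ne γ 0 with rfl | hγ
  · exact (isStationary_zero.1 h).2
  · intro β hβ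
    obtain ⟨x, hx, hx'⟩ := h.inter_nonempty (pos_iff_ne_zero.2 hγ)
      (isGClub_zero_Ioo h.isSuccLimit hβ)
    exact ⟨x, hx, hx'.1, hx'.2⟩

theorem IsStationary.exists_mem_lt (h : IsStationary γ κ S) : ∃ x ∈ S, x < κ := by
  obtain ⟨s, hs, -, hsκ⟩ := h.unboundedIn 0 h.isSuccLimit.bot_lt
  exact ⟨s, hs, hsκ⟩

theorem IsStationary.mono (h : IsStationary γ κ S) (hη : η ≤ γ) : IsStationary η κ S :=
  isStationary_iff.2 ⟨h.isSuccLimit, fun _ => h.unboundedIn, fun _ hη' =>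
    ⟨h.isReflecting (hη'.trans_le hη), fun _ hC => h.inter_nonempty (hη'.trans_le hη) hC⟩⟩

theorem isStationary_of_forall_lt (hγ : Order.IsSuccLimit γ)
    (h : ∀ η < γ, IsStationary η κ S) : IsStationary γ κ S := by
  have hsucc (η : Ordinal.{u}) (hη : η < γ) := h _ (hγ.succ_lt hη)
  exact (isStationary_iff_of_pos hγ.bot_lt).2 ⟨(h 0 hγ.bot_lt).isSuccLimit, fun η hη =>
    ⟨(hsucc η hη).isReflecting (Order.lt_succ η),
      fun C hC => (hsucc η hη).inter_nonempty (Order.lt_succ η) hC⟩⟩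

theorem IsStationary.inter_Ioo_of_zero (hS : IsStationary 0 κ S) (hβ : β < κ) :
    IsStationary 0 κ (S ∩ Ioo β κ) := by
  refine isStationary_zero.2 ⟨hS.isSuccLimit, fun δ hδ => ?_⟩
  obtain ⟨s, hs, hlt, hsκ⟩ := hS.unboundedIn _ (max_lt hβ hδ)
  exact ⟨s, ⟨hs, (le_max_left _ _).trans_lt hlt, hsκ⟩, (le_max_right _ _).trans_lt hlt, hsκ⟩

theorem IsGClub.mem_of_isStationary_inter (hC : IsGClub η κ C) (hβ : β < κ)
    (h : IsStationary γ β (S ∩ C)) (hη : η ≤ γ) : β ∈ C :=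
  hC.2.2 β hβ ((h.superset inter_subset_right).mono hη)

theorem IsGClub.restrict (hC : IsGClub η κ C) (hβ : β ≤ κ) (h : IsStationary η β C) :
    IsGClub η β (C ∩ Iio β) :=
  ⟨inter_subset_right, h.inter_Iio, fun α hα hs =>
    ⟨hC.2.2 α (hα.trans_le hβ) (hs.superset inter_subset_left), hα⟩⟩

/-- In this lemma and the next two, `hinter` is the induction hypothesis of `IsGClub.inter`. -/
theorem IsGClub.mono_of_forall_inter (hr : ∀ η < γ, IsReflecting η κ)
    (hinter : ∀ η < γ, ∀ C D, IsGClub η κ C → IsGClub η κ D → IsGClub η κ (C ∩ D))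
    (hη : η ≤ γ) (hC : IsGClub η κ C) : IsGClub γ κ C := by
  induction γ using WellFoundedLT.induction generalizing η C with
  | ind γ ih =>
  rcases hη.eq_or_lt with rfl | hη
  · exact hC
  refine ⟨hC.1, (isStationary_iff_of_pos (pos_of_gt hη)).2 ⟨hC.2.1.isSuccLimit,
    fun ζ hζ => ⟨hr ζ hζ, fun D hD => ?_⟩⟩, fun α hα h => hC.2.2 α hα (h.mono hη.le)⟩
  have hmax : max η ζ < γ := max_lt hη hζ
  have lift {ξ : Ordinal.{u}} {E : Set Ordinal.{u}} (hξ : ξ ≤ max η ζ) (hE : IsGClub ξ κ E) :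
      IsGClub (max η ζ) κ E :=
    ih _ hmax (fun _ h => hr _ (h.trans hmax)) (fun _ h => hinter _ (h.trans hmax)) hξ hE
  obtain ⟨x, hx, -⟩ := (hinter _ hmax C D (lift (le_max_left _ _) hC)
    (lift (le_max_right _ _) hD)).2.1.exists_mem_lt
  exact ⟨x, hx⟩

theorem IsStationary.inter_isGClub_of_forall_inter
    (hinter : ∀ η < γ, ∀ C D, IsGClub η κ C → IsGClub η κ D → IsGClub η κ (C ∩ D))
    (hS : IsStationary γ κ S) (hη : η < γ) (hC : IsGClub η κ C) : IsStationary γ κ (S ∩ C) := by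
  refine (isStationary_iff_of_pos (pos_of_gt hη)).2 ⟨hS.isSuccLimit,
    fun ζ hζ => ⟨hS.isReflecting hζ, fun D hD => ?_⟩⟩
  have hmax : max η ζ < γ := max_lt hη hζ
  have lift {ξ : Ordinal.{u}} {E : Set Ordinal.{u}} (hξ : ξ ≤ max η ζ) (hE : IsGClub ξ κ E) :
      IsGClub (max η ζ) κ E :=
    hE.mono_of_forall_inter (fun _ h => hS.isReflecting (h.trans hmax))
      (fun _ h => hinter _ (h.trans hmax)) hξ
  rw [inter_assoc]
  exact hS.inter_nonempty hmax
    (hinter _ hmax C D (lift (le_max_left _ _) hC) (lift (le_max_right _ _) hD))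

theorem IsStationary.inter_of_forall_inter
    (hinter : ∀ η < γ, ∀ C D, IsGClub η κ C → IsGClub η κ D → IsGClub η κ (C ∩ D))
    (hr : IsReflecting γ κ) (hC : IsGClub γ κ C) (hD : IsGClub γ κ D) :
    IsStationary γ κ (C ∩ D) := by
  rcases eq_zero_or_pos γ with rfl | hγ
  · refine isStationary_zero.2 ⟨hC.2.1.isSuccLimit, fun β hβ => ?_⟩
    obtain ⟨α, hα, hCα, hDα⟩ :=
      hr.exists_isStationary (hC.2.1.inter_Ioo_of_zero hβ) hD.2.1
    obtain ⟨x, hx, hxα⟩ := hCα.exists_mem_lt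
    exact ⟨α, ⟨hC.2.2 α hα (hCα.superset inter_subset_left), hD.2.2 α hα hDα⟩,
      hx.2.1.trans hxα, hα⟩
  · refine (isStationary_iff_of_pos hγ).2 ⟨hC.2.1.isSuccLimit,
      fun η hη => ⟨hC.2.1.isReflecting hη, fun E hE => ?_⟩⟩
    obtain ⟨α, hα, hCα, hDα⟩ :=
      hr.exists_isStationary (hC.2.1.inter_isGClub_of_forall_inter hinter hη hE) hD.2.1
    exact ⟨α, ⟨hC.2.2 α hα (hCα.superset inter_subset_left), hD.2.2 α hα hDα⟩,
      hE.mem_of_isStationary_inter hα hCα hη.le⟩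

theorem IsGClub.inter (hr : IsReflecting γ κ) (hC : IsGClub γ κ C) (hD : IsGClub γ κ D) :
    IsGClub γ κ (C ∩ D) := by
  induction γ using WellFoundedLT.induction generalizing C D with
  | ind γ ih =>
  exact ⟨inter_subset_left.trans hC.1,
    IsStationary.inter_of_forall_inter
      (fun η hη _ _ hC' hD' => ih η hη (hC.2.1.isReflecting hη) hC' hD') hr hC hD,
    fun α hα h => ⟨hC.2.2 α hα (h.superset inter_subset_left),
      hD.2.2 α hα (h.superset inter_subset_right)⟩⟩

theorem IsGClub.mono (hr : ∀ η < γ, IsReflecting η κ) (hη : η ≤ γ) (hC : IsGClub η κ C) :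
    IsGClub γ κ C :=
  hC.mono_of_forall_inter hr (fun η hη _ _ => IsGClub.inter (hr η hη)) hη

theorem IsStationary.inter_isGClub (hS : IsStationary γ κ S) (hη : η < γ) (hC : IsGClub η κ C) :
    IsStationary γ κ (S ∩ C) :=
  hS.inter_isGClub_of_forall_inter (fun _ hη _ _ => IsGClub.inter (hS.isReflecting hη)) hη hC

theorem IsStationary.inter_Ioo (hS : IsStationary γ κ S) (hβ : β < κ) :
    IsStationary γ κ (S ∩ Ioo β κ) := by
  rcases eq_zero_or_pos γ with rfl | hγ
  · exact hS.inter_Ioo_of_zero hβ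
  · exact hS.inter_isGClub hγ (isGClub_zero_Ioo hS.isSuccLimit hβ)

theorem isGClub_Ioo (hκ : Order.IsSuccLimit κ) (hr : ∀ η < γ, IsReflecting η κ) (hβ : β < κ) :
    IsGClub γ κ (Ioo β κ) :=
  (isGClub_zero_Ioo hκ hβ).mono hr zero_le

theorem isStationary_add_one_iff :
    IsStationary (γ + 1) κ S ↔ Order.IsSuccLimit κ ∧ (∀ η ≤ γ, IsReflecting η κ) ∧
      ∀ C, IsGClub γ κ C → (S ∩ C).Nonempty := by
  rw [isStationary_iff_of_pos (pos_of_gt (Order.lt_add_one_iff.2 le_rfl))]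
  simp only [Order.lt_add_one_iff]
  refine and_congr_right fun _ => ⟨fun h => ⟨fun η hη => (h η hη).1, (h γ le_rfl).2⟩,
    fun ⟨hr, h⟩ η hη => ⟨hr η hη, fun C hC => h C (hC.mono (fun ζ hζ => hr ζ hζ.le) hη)⟩⟩

theorem IsStationary.setOf_isStationary (hS : IsStationary γ κ S) (hr : IsReflecting γ κ) :
    IsStationary γ κ {α | α < κ ∧ IsStationary γ α S} := by
  rcases eq_zero_or_pos γ with rfl | hγ
  · refine isStationary_zero.2 ⟨hS.isSuccLimit, fun β hβ => ?_⟩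
    have hβS := hS.inter_Ioo_of_zero hβ
    obtain ⟨α, hα, hSα, -⟩ := hr.exists_isStationary hβS hβS
    obtain ⟨x, hx, hxα⟩ := hSα.exists_mem_lt
    exact ⟨α, ⟨hα, hSα.superset inter_subset_left⟩, hx.2.1.trans hxα, hα⟩
  · refine (isStationary_iff_of_pos hγ).2 ⟨hS.isSuccLimit,
      fun η hη => ⟨hS.isReflecting hη, fun C hC => ?_⟩⟩
    have hSC := hS.inter_isGClub hη hC
    obtain ⟨α, hα, hSα, -⟩ := hr.exists_isStationary hSC hSC
    exact ⟨α, ⟨hα, hSα.superset inter_subset_left⟩, hC.mem_of_isStationary_inter hα hSα hη.le⟩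

theorem IsGClub.setOf_isStationary (hC : IsGClub γ κ C) (hr : IsReflecting γ κ) :
    IsGClub γ κ {α | α < κ ∧ IsStationary γ α C} :=
  ⟨fun _ hx => hx.1, hC.2.1.setOf_isStationary hr, fun _ hα h => ⟨hα, h.superset fun x hx =>
    hC.2.2 x hx.1 hx.2⟩⟩

/-- The first point of `S` at which `C` is `γ`-stationary is a point of `C` at which `S` does not
reflect. -/
theorem IsStationary.setOf_not_isStationary (hS : IsStationary (γ + 1) κ S) :
    IsStationary (γ + 1) κ {α | α ∈ S ∧ ¬ IsStationary (γ + 1) α S} := by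
  obtain ⟨hκ, hr, hmeet⟩ := isStationary_add_one_iff.1 hS
  refine isStationary_add_one_iff.2 ⟨hκ, hr, fun C hC => ?_⟩
  obtain ⟨α, ⟨hαS, hακ, hα⟩, hmin⟩ := (wellFounded_lt (α := Ordinal.{u})).has_min _
    (hmeet _ (hC.setOf_isStationary (hr γ le_rfl)))
  refine ⟨α, ⟨hαS, fun h => ?_⟩, hC.2.2 α hακ hα⟩
  obtain ⟨-, hrα, hmeetα⟩ := isStationary_add_one_iff.1 h
  obtain ⟨β, hβS, hβα, hβ⟩ :=
    hmeetα _ ((hC.restrict hακ.le hα).setOf_isStationary (hrα γ le_rfl))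
  exact hmin β ⟨hβS, hβα.trans hακ, hβ.superset inter_subset_left⟩ hβα

end Stationary

section OrderOfStationarity

variable {κ : Cardinal.{u}} {γ : Ordinal.{u}} {S : Set Ordinal.{u}}

theorem exists_forall_le_of_isRegular (hκ : κ.IsRegular) {α : Ordinal.{u}} (hα : α.card < κ)
    (f : Iio α → Ordinal.{u}) (hf : ∀ i, f i < κ.ord) : ∃ η < κ.ord, ∀ i, f i ≤ η := by
  refine ⟨⨆ i, f i, Ordinal.lift_iSup_lt_of_lt_cof ?_ hf,
    fun i => le_ciSup Ordinal.bddAbove_of_small i⟩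
  rw [← Ordinal.lift_cof, hκ.cof_ord]
  simpa only [Cardinal.mk_Iio_ordinal, Cardinal.lift_lift, Cardinal.lift_lt] using hα

theorem not_isStationary_ord_succ_card (α : Ordinal.{u}) (S : Set Ordinal.{u}) :
    ¬ IsStationary (Order.succ α.card).ord α S := by
  induction α using WellFoundedLT.induction with
  | ind α ih =>
  intro h
  have hinf : Cardinal.aleph0 ≤ α.card :=
    Ordinal.aleph0_le_card.2 (Ordinal.omega0_le_of_isSuccLimit h.isSuccLimit)
  have hreg : (Order.succ α.card).IsRegular := Cardinal.isRegular_succ hinf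
  have hlim := Cardinal.isSuccLimit_ord hreg.aleph0_le
  have bound (β : Iio α) : ∃ η < (Order.succ α.card).ord, ¬ IsStationary η β S := by
    by_contra! hβ
    exact ih β β.2 ((isStationary_of_forall_lt hlim hβ).mono
      (Cardinal.ord_le_ord.2 (Order.succ_le_succ (Ordinal.card_le_card (le_of_lt β.2)))))
  choose f hf hfS using bound
  obtain ⟨η, hη, hfη⟩ := exists_forall_le_of_isRegular hreg (Order.lt_succ _) f hf
  obtain ⟨β, hβ, hSβ, -⟩ := (h.isReflecting hη).exists_isStationary (h.mono hη.le) (h.mono hη.le)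
  exact hfS ⟨β, hβ⟩ (hSβ.mono (hfη ⟨β, hβ⟩))

theorem IsStationary.exists_reflection {κ : Ordinal.{u}} (h : IsStationary (γ + 1) κ S) :
    ∃ β < κ, IsStationary γ β S := by
  have hS : IsStationary γ κ S := h.mono le_self_add
  obtain ⟨β, hβ, hSβ, -⟩ :=
    (h.isReflecting (Order.lt_add_one_iff.2 le_rfl)).exists_isStationary hS hS
  exact ⟨β, hβ, hSβ⟩

theorem IsStationary.lt_ord (h : IsStationary (γ + 1) κ.ord S) : γ < κ.ord := by
  obtain ⟨β, hβ, hSβ⟩ := h.exists_reflection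
  by_contra! hγ
  refine not_isStationary_ord_succ_card β S (hSβ.mono (le_trans ?_ hγ))
  exact Cardinal.ord_le_ord.2 (Order.succ_le_of_lt (Cardinal.lt_ord.1 hβ))

theorem IsStationary.aleph0_lt (h : IsStationary (γ + 1) κ.ord S) : Cardinal.aleph0 < κ := by
  obtain ⟨β, hβ, hSβ⟩ := h.exists_reflection
  have hω := (Ordinal.omega0_le_of_isSuccLimit hSβ.isSuccLimit).trans_lt hβ
  rwa [Cardinal.lt_ord, Ordinal.card_omega0] at hω

end OrderOfStationarity

/-! ### Weak compactness and branches -/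

section Branches

variable {κ : Cardinal.{u}} {H s t : Set Ordinal.{u}} {β δ : Ordinal.{u}}
  {f : Ordinal.{u} → Set Ordinal.{u}}

/-- The branch property of `κ`: every `κ`-sequence of subsets of `κ` has a cofinal branch, a set all
of whose proper initial segments are initial segments of arbitrarily late terms of the sequence. -/
def BranchProperty (κ : Cardinal.{u}) : Prop :=
  ∀ t : Ordinal.{u} → Set Ordinal.{u}, ∃ b : Set Ordinal.{u}, ∀ β < κ.ord,
    ∃ α < κ.ord, β ≤ α ∧ t α ∩ Iio β = b ∩ Iio β

theorem exists_mem_ge_of_mk_eq (hH : Cardinal.mk H = Cardinal.lift.{u + 1} κ) (hβ : β < κ.ord) :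
    ∃ h ∈ H, β ≤ h := by
  by_contra! hHβ
  have hle : Cardinal.mk H ≤ Cardinal.mk (Iio β) := Cardinal.mk_le_mk_of_subset hHβ
  rw [hH, Cardinal.mk_Iio_ordinal, Cardinal.lift_le] at hle
  exact hle.not_gt (Cardinal.lt_ord.1 hβ)

theorem exists_cofinal_map (hκ : Cardinal.aleph0 ≤ κ) :
    ∃ (s : Set (Iio κ.ord)) (g : Ordinal.{u} → Iio κ.ord),
      Cardinal.mk s = Cardinal.lift.{u + 1} κ.ord.cof ∧ ∀ a < κ.ord, g a ∈ s ∧ a ≤ g a := by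
  obtain ⟨s, hs, hcof⟩ := Order.exists_cof_eq (α := Iio κ.ord)
  rw [Ordinal.cof_Iio, ← Ordinal.lift_cof] at hcof
  have hex (a : Ordinal.{u}) : ∃ c : Iio κ.ord, a < κ.ord → c ∈ s ∧ a ≤ c := by
    by_cases ha : a < κ.ord
    · obtain ⟨c, hc, hac⟩ := hs ⟨a, ha⟩
      exact ⟨c, fun _ => ⟨hc, hac⟩⟩
    · exact ⟨⟨0, Cardinal.ord_pos.2 (Cardinal.aleph0_pos.trans_le hκ)⟩, fun h => absurd h ha⟩
  choose g hg using hex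
  exact ⟨s, g, hcof, hg⟩

/-- Colour a pair by whether a cofinal map of small range identifies its two elements: no
homogeneous set of cardinality `κ` is identified to a point, and none is mapped injectively. -/
theorem IsWeaklyCompact.isRegular (hκ : IsWeaklyCompact κ) : κ.IsRegular := by
  classical
  obtain ⟨s, g, hs, hg⟩ := exists_cofinal_map hκ.1.le
  obtain ⟨H, hH, hcard, c, hc⟩ := hκ.2 fun a b => if g a = g b then 0 else 1
  have hlim := Cardinal.isSuccLimit_ord hκ.1.le
  have hc0 : c ≠ 0 := by
    rintro rfl
    obtain ⟨a, ha, -⟩ := exists_mem_ge_of_mk_eq hcard hlim.bot_lt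
    obtain ⟨b, hb, hle⟩ := exists_mem_ge_of_mk_eq hcard (hlim.succ_lt (max_lt (hH ha) (g a).2))
    have hlt := Order.succ_le_iff.1 hle
    have hab : g a = g b := by
      simpa using hc a ha b hb ((le_max_left _ _).trans_lt hlt)
    have hbg : b ≤ g b := (hg b (hH hb)).2
    rw [← hab] at hbg
    exact hbg.not_gt ((le_max_right _ _).trans_lt hlt)
  have hinj : Function.Injective fun x : H => (⟨g x, (hg x (hH x.2)).1⟩ : s) := by
    rintro ⟨x, hx⟩ ⟨y, hy⟩ hxy
    rw [Subtype.mk.injEq] at hxy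
    rcases lt_trichotomy x y with h | rfl | h
    · exact absurd (by rw [← hc x hx y hy h, if_pos hxy]) hc0
    · rfl
    · exact absurd (by rw [← hc y hy x hx h, if_pos hxy.symm]) hc0
  have hle := Cardinal.mk_le_of_injective hinj
  rw [hcard, hs, Cardinal.lift_le] at hle
  exact ⟨hκ.1.le, hle⟩

/-- The characteristic function of a set of ordinals, in the lexicographic order of functions. -/
abbrev lexChar (s : Set Ordinal.{u}) : Lex (Ordinal.{u} → Prop) :=
  toLex (· ∈ s)

theorem lexChar_compl_le (h : lexChar s ≤ lexChar t) : lexChar tᶜ ≤ lexChar sᶜ := by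
  rcases h.eq_or_lt with heq | ⟨i, hagree, hlt⟩
  · rw [show s = t from toLex_inj.1 heq]
  · exact le_of_lt ⟨i, fun j hj => congrArg Not (hagree j hj).symm,
      fun ht hs => ht (hlt.1 hs), fun h => hlt.2 fun ht => by_contra fun hs => h hs ht⟩

theorem mem_of_lexChar_le (h : lexChar s ≤ lexChar t) (hst : ∀ x < δ, (x ∈ s ↔ x ∈ t))
    (hδ : δ ∈ s) : δ ∈ t :=
  Pi.apply_le_of_toLex h (fun x hx => propext (hst x hx)) hδ

/-- Once the terms agree below `δ`, membership of `δ` is monotone in the lexicographic order, hence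
eventually constant. -/
theorem eventually_const_mem_of_monotoneOn_lexChar (hH : H ⊆ Iio κ.ord)
    (hf : MonotoneOn (fun a => lexChar (f a)) H) (hβ : β < κ.ord)
    (hagree : ∀ a ∈ H, ∀ b ∈ H, β ≤ a → β ≤ b → ∀ x < δ, (x ∈ f a ↔ x ∈ f b)) :
    ∃ ν < κ.ord, ∀ a ∈ H, ∀ b ∈ H, ν ≤ a → ν ≤ b → (δ ∈ f a ↔ δ ∈ f b) := by
  by_cases hex : ∃ a ∈ H, β ≤ a ∧ δ ∈ f a
  · obtain ⟨a, ha, hβa, hδ⟩ := hex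
    have hup : ∀ b ∈ H, a ≤ b → δ ∈ f b := fun b hb hab =>
      mem_of_lexChar_le (hf ha hb hab) (hagree a ha b hb hβa (hβa.trans hab)) hδ
    exact ⟨a, hH ha, fun b hb c hc hab hac => iff_of_true (hup b hb hab) (hup c hc hac)⟩
  · push Not at hex
    exact ⟨β, hβ, fun b hb c hc hβb hβc => iff_of_false (hex b hb hβb) (hex c hc hβc)⟩

theorem eventually_const_of_monotoneOn_lexChar (hκ : κ.IsRegular) (hH : H ⊆ Iio κ.ord)
    (hf : MonotoneOn (fun a => lexChar (f a)) H) (hδ : δ < κ.ord) :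
    ∃ ν < κ.ord, ∀ a ∈ H, ∀ b ∈ H, ν ≤ a → ν ≤ b → ∀ x < δ, (x ∈ f a ↔ x ∈ f b) := by
  induction δ using WellFoundedLT.induction with
  | ind δ ih =>
    have hstep (x : Iio δ) : ∃ ν < κ.ord, ∀ a ∈ H, ∀ b ∈ H, ν ≤ a → ν ≤ b →
        (x.1 ∈ f a ↔ x.1 ∈ f b) := by
      obtain ⟨β, hβ, hagree⟩ := ih x x.2 (x.2.trans hδ)
      exact eventually_const_mem_of_monotoneOn_lexChar hH hf hβ hagree
    choose g hg hagree using hstep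
    obtain ⟨ν, hν, hle⟩ := exists_forall_le_of_isRegular hκ (Cardinal.lt_ord.1 hδ) g hg
    exact ⟨ν, hν, fun a ha b hb hνa hνb x hx =>
      hagree ⟨x, hx⟩ a ha b hb ((hle _).trans hνa) ((hle _).trans hνb)⟩

theorem exists_branch_of_monotoneOn_lexChar (hκ : κ.IsRegular) (hH : H ⊆ Iio κ.ord)
    (hunb : ∀ β < κ.ord, ∃ a ∈ H, β ≤ a) (hf : MonotoneOn (fun a => lexChar (f a)) H) :
    ∃ b : Set Ordinal.{u}, ∀ β < κ.ord, ∃ α < κ.ord, β ≤ α ∧ f α ∩ Iio β = b ∩ Iio β := by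
  refine ⟨{x | ∃ ν < κ.ord, ∀ a ∈ H, ν ≤ a → x ∈ f a}, fun β hβ => ?_⟩
  obtain ⟨ν, hν, hagree⟩ := eventually_const_of_monotoneOn_lexChar hκ hH hf hβ
  obtain ⟨a, ha, hle⟩ := hunb _ (max_lt hβ hν)
  obtain ⟨hβa, hνa⟩ := max_le_iff.1 hle
  refine ⟨a, hH ha, hβa, Set.ext fun x => and_congr_left fun hx => ⟨fun hxa => ?_, ?_⟩⟩
  · exact ⟨ν, hν, fun b hb hνb => (hagree a ha b hb hνa hνb x hx).1 hxa⟩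
  · rintro ⟨μ, hμ, hmem⟩
    obtain ⟨c, hc, hle⟩ := hunb _ (max_lt hν hμ)
    obtain ⟨hνc, hμc⟩ := max_le_iff.1 hle
    exact (hagree a ha c hc hνa hνc x hx).2 (hmem c hc hμc)

/-- Colour a pair by whether the two terms of the sequence are in lexicographic order. -/
theorem IsWeaklyCompact.branchProperty (hκ : IsWeaklyCompact κ) : BranchProperty κ := by
  classical
  intro f
  obtain ⟨H, hH, hcard, c, hc⟩ :=
    hκ.2 fun a b => if lexChar (f a) ≤ lexChar (f b) then 0 else 1
  have hunb : ∀ β < κ.ord, ∃ a ∈ H, β ≤ a := fun β => exists_mem_ge_of_mk_eq hcard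
  by_cases hc0 : c = 0
  · refine exists_branch_of_monotoneOn_lexChar hκ.isRegular hH hunb
      (monotoneOn_iff_forall_lt.2 fun a ha b hb hab => ?_)
    by_contra hle
    exact one_ne_zero ((if_neg hle).symm.trans ((hc a ha b hb hab).trans hc0))
  · have hanti : MonotoneOn (fun a => lexChar (f a)ᶜ) H := by
      refine monotoneOn_iff_forall_lt.2 fun a ha b hb hab => lexChar_compl_le ?_
      refine (le_total _ _).resolve_left fun hle => hc0 ?_
      rw [← hc a ha b hb hab, if_pos hle]
    obtain ⟨b, hb⟩ := exists_branch_of_monotoneOn_lexChar hκ.isRegular hH hunb hanti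
    refine ⟨bᶜ, fun β hβ => ?_⟩
    obtain ⟨α, hα, hβα, heq⟩ := hb β hβ
    refine ⟨α, hα, hβα, Set.ext fun x => and_congr_left fun hx => ?_⟩
    have hiff : x ∉ f α ↔ x ∈ b := by
      simpa [show x < β from hx] using Set.ext_iff.1 heq x
    rw [mem_compl_iff, ← hiff, not_not]

/-- If `κ ≤ 2 ^ |α|`, a sequence of distinct subsets of `α` has no cofinal branch. -/
theorem BranchProperty.two_power_card_lt (hκ : BranchProperty κ) (hinf : Cardinal.aleph0 ≤ κ)
    (hβ : β < κ.ord) : (2 : Cardinal.{u}) ^ β.card < κ := by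
  by_contra! hle
  have hmk : Cardinal.mk (Iio κ.ord) ≤ Cardinal.mk (Set (Iio β)) := by
    rwa [Cardinal.mk_set, Cardinal.mk_Iio_ordinal, Cardinal.mk_Iio_ordinal, Cardinal.card_ord,
      ← Cardinal.lift_two_power, Cardinal.lift_le]
  obtain ⟨e⟩ := hmk
  obtain ⟨b, hb⟩ := hκ fun a => {x | ∃ h : a < κ.ord, ∃ y ∈ e ⟨a, h⟩, (y : Ordinal) = x}
  have he {a ν : Ordinal} (ha : a < κ.ord) (hβν : β ≤ ν)
      (hab : {x | ∃ h : a < κ.ord, ∃ y ∈ e ⟨a, h⟩, (y : Ordinal) = x} ∩ Iio ν = b ∩ Iio ν)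
      (x : Iio β) : x ∈ e ⟨a, ha⟩ ↔ x.1 ∈ b := by
    have hx : x.1 < ν := x.2.trans_le hβν
    simpa [ha, hx, show x.1 < β from x.2] using Set.ext_iff.1 hab x
  obtain ⟨a, ha, -, hab⟩ := hb β hβ
  obtain ⟨c, hc, hle, hcb⟩ := hb _ (max_lt hβ ((Cardinal.isSuccLimit_ord hinf).succ_lt ha))
  have heq : e ⟨a, ha⟩ = e ⟨c, hc⟩ :=
    Set.ext fun x => (he ha le_rfl hab x).trans (he hc (le_max_left _ _) hcb x).symm
  have hac : a < c := Order.succ_le_iff.1 ((le_max_right _ _).trans hle)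
  exact hac.ne (congrArg Subtype.val (e.injective heq))

end Branches

/-! ### Normal measures -/

section Measure

open Filter

variable {κ : Cardinal.{u}} {U W : Ultrafilter Ordinal.{u}} {γ η : Ordinal.{u}}
  {A C : Ordinal.{u} → Set Ordinal.{u}} {B : Set Ordinal.{u}}

/-- A `κ`-complete nonprincipal ultrafilter on `κ`, as an ultrafilter of ordinals that concentrates
on `κ`. -/
structure IsMeasure (κ : Cardinal.{u}) (U : Ultrafilter Ordinal.{u}) : Prop where
  complete : ∀ δ < κ.ord, ∀ p : Ordinal.{u} → Ordinal.{u} → Prop,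
    (∀ i < δ, ∀ᶠ x in U, p i x) → ∀ᶠ x in U, ∀ i < δ, p i x
  unbounded : ∀ β < κ.ord, ∀ᶠ x in U, β < x
  lt : ∀ᶠ x in U, x < κ.ord

/-- A measure on `κ` that is closed under diagonal intersections. -/
structure IsNormalMeasure (κ : Cardinal.{u}) (U : Ultrafilter Ordinal.{u}) : Prop
    extends IsMeasure κ U where
  normal : ∀ p : Ordinal.{u} → Ordinal.{u} → Prop,
    (∀ i < κ.ord, ∀ᶠ x in U, p i x) → ∀ᶠ x in U, ∀ i < x, p i x

theorem IsMeasure.wellFounded_eventually_lt (hU : IsMeasure κ U) (hκ : Cardinal.aleph0 < κ) :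
    WellFounded fun f g : Ordinal.{u} → Ordinal.{u} => ∀ᶠ x in U, f x < g x := by
  rw [wellFounded_iff_isEmpty_descending_chain]
  refine ⟨fun ⟨f, hf⟩ => ?_⟩
  have hω : Ordinal.omega0 < κ.ord := by rwa [Cardinal.lt_ord, Ordinal.card_omega0]
  have hdesc : ∀ᶠ x in U, ∀ i < Ordinal.omega0, ∀ n : ℕ, n = i → f (n + 1) x < f n x := by
    refine hU.complete _ hω (fun i x => ∀ n : ℕ, (n : Ordinal) = i → f (n + 1) x < f n x) ?_
    intro i hi
    obtain ⟨n, rfl⟩ := Ordinal.lt_omega0.1 hi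
    filter_upwards [hf n] with x hx m hm
    rwa [Nat.cast_inj.1 hm]
  obtain ⟨x, hx⟩ := hdesc.exists
  exact (wellFounded_iff_isEmpty_descending_chain.1 wellFounded_lt).false
    ⟨fun n => f n x, fun n => hx n (Ordinal.natCast_lt_omega0 n) n rfl⟩

theorem IsMeasure.isNormalMeasure_map (hU : IsMeasure κ U) (hκ : Order.IsSuccLimit κ.ord)
    {f : Ordinal.{u} → Ordinal.{u}} (hf : ∀ β < κ.ord, ∀ᶠ x in U, β < f x)
    (hle : ∀ᶠ x in U, f x ≤ x)
    (hmin : ∀ g : Ordinal.{u} → Ordinal.{u}, (∀ β < κ.ord, ∀ᶠ x in U, β < g x) →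
      ¬ ∀ᶠ x in U, g x < f x) : IsNormalMeasure κ (U.map f) := by
  refine ⟨⟨fun δ hδ p hp => hU.complete δ hδ (fun i x => p i (f x)) hp, hf, ?_⟩, fun p hp => ?_⟩
  · change ∀ᶠ x in U, f x < κ.ord
    filter_upwards [hle, hU.lt] with x hx hxκ using hx.trans_lt hxκ
  · change ∀ᶠ x in U, ∀ i < f x, p i (f x)
    by_contra hnot
    have hex : ∀ᶠ x in U, ∃ i, i < f x ∧ ¬ p i (f x) := by simpa using hnot
    obtain ⟨g, hg⟩ := skolem.1 hex
    have hbdd : ¬ ∀ β < κ.ord, ∀ᶠ x in U, β < g x := fun h =>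
      hmin g h (hg.mono fun x hx => hx.1)
    push Not at hbdd
    obtain ⟨β, hβ, hgβ⟩ := hbdd
    have hgβ : ∀ᶠ x in U, g x ≤ β := by simpa using hgβ
    have hp' : ∀ᶠ x in U, ∀ i < Order.succ β, p i (f x) :=
      hU.complete _ (hκ.succ_lt hβ) (fun i x => p i (f x))
        fun i hi => hp i (hi.trans (hκ.succ_lt hβ))
    obtain ⟨x, hxg, hxβ, hxp⟩ := (hg.and (hgβ.and hp')).exists
    exact hxg.2 (hxp _ (Order.lt_succ_iff.2 hxβ))

theorem IsMeasure.exists_isNormalMeasure_map (hU : IsMeasure κ U) (hκ : Cardinal.aleph0 < κ) :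
    ∃ f : Ordinal.{u} → Ordinal.{u}, IsNormalMeasure κ (U.map f) ∧ ∀ᶠ x in U, f x ≤ x := by
  obtain ⟨f, hf, hmin⟩ := (hU.wellFounded_eventually_lt hκ).has_min
    {f | ∀ β < κ.ord, ∀ᶠ x in U, β < f x} ⟨id, hU.unbounded⟩
  have hle : ∀ᶠ x in U, f x ≤ x := by simpa using hmin id hU.unbounded
  exact ⟨f, hU.isNormalMeasure_map (Cardinal.isSuccLimit_ord hκ.le) hf hle hmin, hle⟩

theorem IsNormalMeasure.eventually_isSuccLimit (hW : IsNormalMeasure κ W)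
    (hκ : Order.IsSuccLimit κ.ord) : ∀ᶠ ξ : Ordinal.{u} in W, Order.IsSuccLimit ξ := by
  have hsucc : ∀ᶠ ξ : Ordinal.{u} in W, ∀ i < ξ, Order.succ i < ξ :=
    hW.normal (fun i ξ => Order.succ i < ξ) fun i hi => hW.unbounded _ (hκ.succ_lt hi)
  filter_upwards [hsucc, hW.unbounded 0 hκ.bot_lt] with ξ hξ hpos
  exact ⟨fun hmin => hpos.ne' (by simpa using hmin), Order.isSuccPrelimit_of_succ_lt hξ⟩

/-- The limit of a family of sets along an ultrafilter. For a normal measure it glues sets `A ξ ⊆ ξ`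
to a set of which they are almost all initial segments, see `IsNormalMeasure.eventually_mem_iff`. -/
def ultralimit (W : Ultrafilter Ordinal.{u}) (A : Ordinal.{u} → Set Ordinal.{u}) :
    Set Ordinal.{u} :=
  {β | ∀ᶠ ξ in W, β ∈ A ξ}

theorem IsNormalMeasure.eventually_mem_iff (hW : IsNormalMeasure κ W)
    (A : Ordinal.{u} → Set Ordinal.{u}) :
    ∀ᶠ ξ in W, ∀ i < ξ, (i ∈ ultralimit W A ↔ i ∈ A ξ) := by
  refine hW.normal (fun i ξ => i ∈ ultralimit W A ↔ i ∈ A ξ) fun i _ => ?_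
  by_cases h : i ∈ ultralimit W A
  · exact Eventually.mono h fun ξ hξ => iff_of_true h hξ
  · exact (Ultrafilter.eventually_not.2 h).mono fun ξ hξ => iff_of_false h hξ

theorem IsNormalMeasure.isStationary_ultralimit (hW : IsNormalMeasure κ W)
    (hdown : ∀ B, (∀ᶠ ξ in W, IsStationary η ξ B) → IsStationary η κ.ord B)
    (hA : ∀ᶠ ξ in W, IsStationary η ξ (A ξ)) : IsStationary η κ.ord (ultralimit W A) := by
  refine hdown _ ?_
  filter_upwards [hA, hW.eventually_mem_iff A] with ξ hξ hiff
  exact hξ.of_inter_Iio_subset fun x hx => (hiff x hx.2).2 hx.1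

/-- Sets witnessing that almost all `ξ` fail to reflect glue to sets witnessing the same for `κ`. -/
theorem IsNormalMeasure.eventually_isReflecting (hW : IsNormalMeasure κ W)
    (hdown : ∀ B, (∀ᶠ ξ in W, IsStationary η ξ B) → IsStationary η κ.ord B)
    (hr : IsReflecting η κ.ord) : ∀ᶠ ξ in W, IsReflecting η ξ := by
  by_contra hnot
  have hex : ∀ᶠ ξ in W, ∃ A : Set Ordinal.{u} × Set Ordinal.{u},
      IsStationary η ξ A.1 ∧ IsStationary η ξ A.2 ∧
        ∀ α < ξ, IsStationary η α A.1 → ¬ IsStationary η α A.2 := by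
    filter_upwards [Ultrafilter.eventually_not.2 hnot] with ξ hξ
    rw [IsReflecting, ReflectsFor] at hξ
    push Not at hξ
    obtain ⟨A, -, D, -, hA, hD, hAD⟩ := hξ
    exact ⟨(A, D), hA, hD, hAD⟩
  obtain ⟨A, hA⟩ := skolem.1 hex
  obtain ⟨α, hα, hα₁, hα₂⟩ := hr.exists_isStationary
    (hW.isStationary_ultralimit hdown (hA.mono fun _ h => h.1))
    (hW.isStationary_ultralimit hdown (hA.mono fun _ h => h.2.1))
  obtain ⟨ξ, hξ, hiff₁, hiff₂, hαξ⟩ := (hA.and ((hW.eventually_mem_iff _).and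
    ((hW.eventually_mem_iff _).and (hW.unbounded α hα)))).exists
  exact hξ.2.2 α hαξ
    (hα₁.of_inter_Iio_subset fun x hx => (hiff₁ x (lt_trans hx.2 hαξ)).1 hx.1)
    (hα₂.of_inter_Iio_subset fun x hx => (hiff₂ x (lt_trans hx.2 hαξ)).1 hx.1)

theorem IsNormalMeasure.isGClub_ultralimit_inter (hW : IsNormalMeasure κ W)
    (hdown : ∀ B, (∀ᶠ ξ in W, IsStationary η ξ B) → IsStationary η κ.ord B)
    (hC : ∀ᶠ ξ in W, IsGClub η ξ (C ξ)) : IsGClub η κ.ord (ultralimit W C ∩ Iio κ.ord) := by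
  refine ⟨inter_subset_right, ?_, fun α hα h => ⟨?_, hα⟩⟩
  · exact (hW.isStationary_ultralimit hdown (hC.mono fun _ h => h.2.1)).inter_Iio
  · obtain ⟨ξ, hξ, hiff, hαξ⟩ := (hC.and ((hW.eventually_mem_iff C).and (hW.unbounded α hα))).exists
    exact (hiff α hαξ).2 (hξ.2.2 α hαξ
      (IsStationary.of_inter_Iio_subset h fun x hx => (hiff x (lt_trans hx.2 hαξ)).1 hx.1.1))

theorem IsNormalMeasure.eventually_inter_isGClub_nonempty (hW : IsNormalMeasure κ W)
    (hdown : ∀ B, (∀ᶠ ξ in W, IsStationary η ξ B) → IsStationary η κ.ord B)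
    (hB : ∀ C, IsGClub η κ.ord C → (B ∩ C).Nonempty) :
    ∀ᶠ ξ in W, ∀ C, IsGClub η ξ C → (B ∩ C).Nonempty := by
  by_contra hnot
  have hex : ∀ᶠ ξ in W, ∃ C, IsGClub η ξ C ∧ ¬ (B ∩ C).Nonempty := by
    simpa only [← Ultrafilter.eventually_not, not_forall, exists_prop] using hnot
  obtain ⟨C, hC⟩ := skolem.1 hex
  obtain ⟨x, hxB, hxC, hxκ⟩ :=
    hB _ (hW.isGClub_ultralimit_inter hdown (hC.mono fun _ h => h.1))
  obtain ⟨ξ, hξ, hiff, hxξ⟩ :=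
    (hC.and ((hW.eventually_mem_iff C).and (hW.unbounded x hxκ))).exists
  exact hξ.2 ⟨x, hxB, (hiff x hxξ).1 hxC⟩

theorem IsNormalMeasure.eventually_unboundedIn (hW : IsNormalMeasure κ W)
    (hB : UnboundedIn κ.ord B) : ∀ᶠ ξ in W, UnboundedIn ξ B := by
  refine hW.normal (fun i ξ => ∃ s ∈ B, i < s ∧ s < ξ) fun i hi => ?_
  obtain ⟨s, hs, his, hsκ⟩ := hB i hi
  exact (hW.unbounded s hsκ).mono fun ξ hξ => ⟨s, hs, his, hξ⟩

theorem IsNormalMeasure.isStationary_of_forall_lt (hW : IsNormalMeasure κ W)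
    (hκ : Order.IsSuccLimit κ.ord) (hr : ∀ ζ < η, IsReflecting ζ κ.ord)
    (hup : ∀ ζ < η, ∀ C, IsStationary ζ κ.ord C → ∀ᶠ ξ in W, IsStationary ζ ξ C)
    (hB : ∀ᶠ ξ in W, IsStationary η ξ B) : IsStationary η κ.ord B := by
  refine isStationary_iff.2 ⟨hκ, fun _ β hβ => ?_, fun ζ hζ => ⟨hr ζ hζ, fun C hC => ?_⟩⟩
  · obtain ⟨ξ, hξ, hβξ, hξκ⟩ := (hB.and ((hW.unbounded β hβ).and hW.lt)).exists
    obtain ⟨s, hs, hβs, hsξ⟩ := hξ.unboundedIn β hβξ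
    exact ⟨s, hs, hβs, hsξ.trans hξκ⟩
  · obtain ⟨ξ, hξ, hCξ, hξκ⟩ := (hB.and ((hup ζ hζ C hC.2.1).and hW.lt)).exists
    exact (hξ.inter_nonempty hζ (hC.restrict hξκ.le hCξ)).mono
      (inter_subset_inter_right _ inter_subset_left)

/-- A combinatorial substitute for the fact that `η`-stationarity of `B` in `κ` is computed
correctly in the ultrapower by `W`. -/
theorem IsNormalMeasure.isStationary_iff_eventually (hW : IsNormalMeasure κ W)
    (hκ : Order.IsSuccLimit κ.ord) (hη : η < κ.ord) (hr : ∀ ζ < η, IsReflecting ζ κ.ord) :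
    IsStationary η κ.ord B ↔ ∀ᶠ ξ in W, IsStationary η ξ B := by
  induction η using WellFoundedLT.induction generalizing B with
  | ind η ih =>
    have ih (ζ : Ordinal.{u}) (hζ : ζ < η) (B : Set Ordinal.{u}) :
        IsStationary ζ κ.ord B ↔ ∀ᶠ ξ in W, IsStationary ζ ξ B :=
      ih ζ hζ (hζ.trans hη) fun θ hθ => hr θ (hθ.trans hζ)
    refine ⟨fun hB => ?_, hW.isStationary_of_forall_lt hκ hr fun ζ hζ C => (ih ζ hζ C).1⟩
    have hrefl : ∀ᶠ ξ in W, ∀ ζ < η, IsReflecting ζ ξ := hW.complete η hη _ fun ζ hζ =>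
      hW.eventually_isReflecting (fun C => (ih ζ hζ C).2) (hr ζ hζ)
    have hclub : ∀ᶠ ξ in W, ∀ ζ < η, ∀ C, IsGClub ζ ξ C → (B ∩ C).Nonempty :=
      hW.complete η hη (fun ζ ξ => ∀ C, IsGClub ζ ξ C → (B ∩ C).Nonempty) fun ζ hζ =>
        hW.eventually_inter_isGClub_nonempty (fun C => (ih ζ hζ C).2)
          fun C hC => hB.inter_nonempty hζ hC
    filter_upwards [hW.eventually_isSuccLimit hκ, hW.eventually_unboundedIn hB.unboundedIn,
      hrefl, hclub] with ξ hlim hunb hreflξ hclubξ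
    exact isStationary_iff.2 ⟨hlim, fun _ => hunb, fun ζ hζ => ⟨hreflξ ζ hζ, hclubξ ζ hζ⟩⟩

theorem IsNormalMeasure.eventually_mem_of_isGClub (hW : IsNormalMeasure κ W) (hγ : γ < κ.ord)
    (hB : IsGClub γ κ.ord B) : ∀ᶠ ξ in W, ξ ∈ B := by
  have hst : ∀ᶠ ξ in W, IsStationary γ ξ B := (hW.isStationary_iff_eventually hB.2.1.isSuccLimit hγ
    fun η hη => IsStationary.isReflecting hB.2.1 hη).1 hB.2.1
  filter_upwards [hst, hW.lt] with ξ hξ hξκ using hB.2.2 ξ hξκ hξ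

theorem IsNormalMeasure.isStationary_of_eventually_mem (hW : IsNormalMeasure κ W)
    (hκ : Order.IsSuccLimit κ.ord) (hγ : γ < κ.ord) (hr : ∀ η < γ, IsReflecting η κ.ord)
    (hB : ∀ᶠ ξ in W, ξ ∈ B) : IsStationary γ κ.ord B := by
  refine isStationary_iff.2 ⟨hκ, fun _ β hβ => ?_, fun η hη => ⟨hr η hη, fun C hC => ?_⟩⟩
  · obtain ⟨ξ, hξ, hβξ, hξκ⟩ := (hB.and ((hW.unbounded β hβ).and hW.lt)).exists
    exact ⟨ξ, hξ, hβξ, hξκ⟩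
  · exact (hB.and (hW.eventually_mem_of_isGClub (hη.trans hγ) hC)).exists

theorem IsNormalMeasure.isGClub_diagonal_inter (hW : IsNormalMeasure κ W)
    (hκ : Order.IsSuccLimit κ.ord) (hγ : γ < κ.ord) (hr : ∀ η < γ, IsReflecting η κ.ord)
    (hC : ∀ i < κ.ord, IsGClub γ κ.ord (C i)) :
    IsGClub γ κ.ord {ξ | ξ < κ.ord ∧ ∀ i < ξ, ξ ∈ C i} := by
  refine ⟨fun _ h => h.1, hW.isStationary_of_eventually_mem hκ hγ hr ?_,
    fun α hα h => ⟨hα, fun i hi => (hC i (hi.trans hα)).2.2 α hα ?_⟩⟩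
  · exact hW.lt.and (hW.normal (fun i ξ => ξ ∈ C i) fun i hi =>
      hW.eventually_mem_of_isGClub hγ (hC i hi))
  · exact (IsStationary.inter_Ioo h hi).superset fun x hx => hx.1.2 i hx.2.1

end Measure

/-! ### Halving stationary sets -/

section Atom

open Filter

variable {κ : Cardinal.{u}} {γ : Ordinal.{u}} {S : Set Ordinal.{u}}

theorem IsComplete.exists_isGClub_subset (hcomp : IsComplete κ (clubFilter γ κ.ord))
    {ι : Type u} [Nonempty ι] (hι : Cardinal.mk ι < κ) {C : ι → Set Ordinal.{u}}
    (hC : ∀ i, IsGClub γ κ.ord (C i)) : ∃ D, IsGClub γ κ.ord D ∧ ∀ i, D ⊆ C i := by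
  obtain ⟨-, D, hD, hDC⟩ := hcomp ι C hι fun i => ⟨(hC i).1, C i, hC i, Subset.rfl⟩
  exact ⟨D, hD, fun i => hDC.trans (iInter_subset C i)⟩

theorem IsStationary.exists_isGClub_disjoint {κ : Ordinal.{u}} {X : Set Ordinal.{u}}
    (hS : IsStationary (γ + 1) κ S) (hX : ¬ IsStationary (γ + 1) κ X) :
    ∃ C, IsGClub γ κ C ∧ Disjoint X C := by
  obtain ⟨hκ, hr, -⟩ := isStationary_add_one_iff.1 hS
  rw [isStationary_add_one_iff] at hX
  push Not at hX
  obtain ⟨C, hC, hXC⟩ := hX hκ hr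
  exact ⟨C, hC, disjoint_iff_inter_eq_empty.2 hXC⟩

/-- The filter generated by the traces of the `γ`-clubs of `κ` on a `(γ+1)`-stationary set `S`. -/
def IsStationary.clubTrace {κ : Ordinal.{u}} (hS : IsStationary (γ + 1) κ S) :
    Filter Ordinal.{u} where
  sets := {X | ∃ C, IsGClub γ κ C ∧ S ∩ C ⊆ X}
  univ_sets := ⟨_, isGClub_Ioo hS.isSuccLimit
    (fun _ hη => hS.isReflecting (hη.trans (Order.lt_add_one_iff.2 le_rfl))) hS.isSuccLimit.bot_lt,
    subset_univ _⟩
  sets_of_superset := fun ⟨C, hC, hCX⟩ hXY => ⟨C, hC, hCX.trans hXY⟩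
  inter_sets := fun ⟨C, hC, hCX⟩ ⟨D, hD, hDY⟩ =>
    ⟨C ∩ D, hC.inter (hS.isReflecting (Order.lt_add_one_iff.2 le_rfl)) hD,
      fun _ hx => ⟨hCX ⟨hx.1, hx.2.1⟩, hDY ⟨hx.1, hx.2.2⟩⟩⟩

theorem IsStationary.eventually_clubTrace {κ : Ordinal.{u}} (hS : IsStationary (γ + 1) κ S)
    {p : Ordinal.{u} → Prop} :
    (∀ᶠ x in hS.clubTrace, p x) ↔ ∃ C, IsGClub γ κ C ∧ ∀ x ∈ S, x ∈ C → p x :=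
  exists_congr fun _ => and_congr_right fun _ =>
    ⟨fun h _ hxS hxC => h ⟨hxS, hxC⟩, fun h x hx => h x hx.1 hx.2⟩

theorem IsStationary.compl_notMem_clubTrace_iff {κ : Ordinal.{u}}
    (hS : IsStationary (γ + 1) κ S)
    (hatom : ∀ X ⊆ S, IsStationary (γ + 1) κ X → ¬ IsStationary (γ + 1) κ (S \ X))
    (X : Set Ordinal.{u}) : Xᶜ ∉ hS.clubTrace ↔ X ∈ hS.clubTrace := by
  refine ⟨fun hX => ?_, fun hX hXc => ?_⟩
  · have hSX : IsStationary (γ + 1) κ (S ∩ X) := by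
      by_contra hnot
      obtain ⟨C, hC, hdisj⟩ := hS.exists_isGClub_disjoint hnot
      exact hX ⟨C, hC, fun x hx hxX => disjoint_left.1 hdisj ⟨hx.1, hxX⟩ hx.2⟩
    have hdiff : ¬ IsStationary (γ + 1) κ (S \ X) := by
      simpa only [sdiff_self_inter] using hatom _ inter_subset_left hSX
    obtain ⟨C, hC, hdisj⟩ := hS.exists_isGClub_disjoint hdiff
    exact ⟨C, hC, fun x hx => by_contra fun hxX => disjoint_left.1 hdisj ⟨hx.1, hxX⟩ hx.2⟩
  · obtain ⟨C, hC, hempty⟩ := inter_mem hX hXc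
    obtain ⟨x, hx⟩ := hS.inter_nonempty (Order.lt_add_one_iff.2 le_rfl) hC
    exact (hempty hx).2 (hempty hx).1

theorem IsStationary.isMeasure_of_coe_eq_clubTrace (hcomp : IsComplete κ (clubFilter γ κ.ord))
    (hS : IsStationary (γ + 1) κ.ord S) {U : Ultrafilter Ordinal.{u}}
    (hU : (U : Filter Ordinal.{u}) = hS.clubTrace) : IsMeasure κ U := by
  have hr (η : Ordinal.{u}) (hη : η < γ) : IsReflecting η κ.ord :=
    hS.isReflecting (hη.trans (Order.lt_add_one_iff.2 le_rfl))
  have hev (β : Ordinal.{u}) (hβ : β < κ.ord) : ∀ᶠ x in hS.clubTrace, x ∈ Ioo β κ.ord :=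
    hS.eventually_clubTrace.2 ⟨_, isGClub_Ioo hS.isSuccLimit hr hβ, fun _ _ hx => hx⟩
  refine ⟨fun δ hδ p hp => ?_, fun β hβ => ?_, ?_⟩
  · rcases eq_or_ne δ 0 with rfl | hδ0
    · exact Eventually.of_forall fun x i hi => absurd hi not_lt_zero
    have : Nonempty δ.ToType := Ordinal.nonempty_toType_iff.2 hδ0
    simp only [hU, hS.eventually_clubTrace] at hp ⊢
    choose C hC hCp using fun i : δ.ToType =>
      hp (Ordinal.ToType.mk.symm i).1 (Ordinal.ToType.mk.symm i).2
    obtain ⟨D, hD, hDC⟩ := hcomp.exists_isGClub_subset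
      ((Cardinal.mk_toType δ).trans_lt (Cardinal.lt_ord.1 hδ)) hC
    refine ⟨D, hD, fun x hxS hxD i hi => ?_⟩
    simpa using hCp (Ordinal.ToType.mk ⟨i, hi⟩) x hxS (hDC _ hxD)
  · rw [hU]
    exact (hev β hβ).mono fun x hx => hx.1
  · rw [hU]
    exact (hev 0 hS.isSuccLimit.bot_lt).mono fun x hx => hx.2

theorem IsStationary.not_eventually_isStationary {κ : Ordinal.{u}}
    (hS : IsStationary (γ + 1) κ S) :
    ¬ ∀ᶠ x in hS.clubTrace, IsStationary (γ + 1) x S := by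
  intro h
  obtain ⟨C, hC, hmem⟩ := hS.eventually_clubTrace.1 h
  obtain ⟨x, ⟨hxS, hx⟩, hxC⟩ :=
    hS.setOf_not_isStationary.inter_nonempty (Order.lt_add_one_iff.2 le_rfl) hC
  exact hx (hmem x hxS hxC)

/-- Fodor's argument for the club filter, using the closure of the `γ`-clubs under diagonal
intersections. -/
theorem IsStationary.not_eventually_map_lt (hS : IsStationary (γ + 1) κ.ord S)
    {U : Ultrafilter Ordinal.{u}} (hU : (U : Filter Ordinal.{u}) = hS.clubTrace)
    {f : Ordinal.{u} → Ordinal.{u}} (hf : IsNormalMeasure κ (U.map f)) :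
    ¬ ∀ᶠ x in U, f x < x := by
  intro hlt
  have hex (i : Ordinal.{u}) :
      ∃ C, i < κ.ord → IsGClub γ κ.ord C ∧ ∀ x ∈ S, x ∈ C → f x ≠ i := by
    by_cases hi : i < κ.ord
    · have hif : ∀ᶠ x in U, i < f x := hf.unbounded i hi
      rw [hU, hS.eventually_clubTrace] at hif
      obtain ⟨C, hC, hCf⟩ := hif
      exact ⟨C, fun _ => ⟨hC, fun x hxS hxC => (hCf x hxS hxC).ne'⟩⟩
    · exact ⟨∅, fun h => absurd h hi⟩
  choose C hC using hex
  have hD := hf.isGClub_diagonal_inter hS.isSuccLimit hS.lt_ord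
    (fun η hη => hS.isReflecting (hη.trans (Order.lt_add_one_iff.2 le_rfl)))
    fun i hi => (hC i hi).1
  have hDU : ∀ᶠ x in U, x ∈ S ∧ x < κ.ord ∧ ∀ i < x, x ∈ C i := by
    rw [hU]
    exact hS.eventually_clubTrace.2 ⟨_, hD, fun x hxS hx => ⟨hxS, hx⟩⟩
  obtain ⟨x, hx, hxS, hxκ, hxC⟩ := (hlt.and hDU).exists
  exact (hC (f x) (hx.trans hxκ)).2 x hxS (hxC _ hx) rfl

/-- Otherwise the `γ`-clubs generate an ultrafilter on `S`, whose least nonconstant function `f`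
yields a normal measure. By Fodor `f` is the identity, so `S` reflects at almost all of its points,
contradicting `IsStationary.setOf_not_isStationary`. -/
theorem IsStationary.exists_halving (hcomp : IsComplete κ (clubFilter γ κ.ord))
    (hS : IsStationary (γ + 1) κ.ord S) :
    ∃ X ⊆ S, IsStationary (γ + 1) κ.ord X ∧ IsStationary (γ + 1) κ.ord (S \ X) := by
  by_contra! hatom
  let U := Ultrafilter.ofComplNotMemIff hS.clubTrace (hS.compl_notMem_clubTrace_iff hatom)
  have hU : (U : Filter Ordinal.{u}) = hS.clubTrace := rfl
  obtain ⟨f, hW, hle⟩ :=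
    (hS.isMeasure_of_coe_eq_clubTrace hcomp hU).exists_isNormalMeasure_map hS.aleph0_lt
  have hge : ∀ᶠ x in U, x ≤ f x := by simpa using hS.not_eventually_map_lt hU hW
  have hst : ∀ᶠ x in U, IsStationary (γ + 1) (f x) S :=
    (hW.isStationary_iff_eventually hS.isSuccLimit (hS.isSuccLimit.succ_lt hS.lt_ord)
      fun η hη => hS.isReflecting hη).1 hS
  refine hS.not_eventually_isStationary (hU ▸ ?_)
  filter_upwards [hst, hle, hge] with x hx hle hge
  rwa [le_antisymm hle hge] at hx

end Atom

/-! ### Splitting along a tree of halvings -/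

section Halving

variable {h : Set Ordinal.{u} → Set Ordinal.{u}} {S b c : Set Ordinal.{u}} {α β ξ : Ordinal.{u}}

/-- The node at height `α` determined by `b` in the tree of subsets of `S` in which every node `X`
is divided into the part inside and the part outside `h X`: at height `β` the branch enters the part
inside if `β ∈ b`. -/
def halvingNode (h : Set Ordinal.{u} → Set Ordinal.{u}) (S b : Set Ordinal.{u})
    (α : Ordinal.{u}) : Set Ordinal.{u} :=
  {ξ | ξ ∈ S ∧ ∀ β, ∀ _hβ : β < α, (ξ ∈ h (halvingNode h S b β) ↔ β ∈ b)}
termination_by α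

/-- The node at height `α` that contains `ξ`. -/
def halvingNodeAt (h : Set Ordinal.{u} → Set Ordinal.{u}) (S : Set Ordinal.{u})
    (ξ α : Ordinal.{u}) : Set Ordinal.{u} :=
  {ζ | ζ ∈ S ∧ ∀ β, ∀ _hβ : β < α, (ζ ∈ h (halvingNodeAt h S ξ β) ↔
    ξ ∈ h (halvingNodeAt h S ξ β))}
termination_by α

theorem mem_halvingNode :
    ξ ∈ halvingNode h S b α ↔ ξ ∈ S ∧ ∀ β < α, (ξ ∈ h (halvingNode h S b β) ↔ β ∈ b) := by
  rw [halvingNode]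
  rfl

theorem halvingNode_antitone (h : Set Ordinal.{u} → Set Ordinal.{u}) (S b : Set Ordinal.{u}) :
    Antitone (halvingNode h S b) := by
  intro α β hαβ ξ hξ
  rw [mem_halvingNode] at hξ ⊢
  exact ⟨hξ.1, fun δ hδ => hξ.2 δ (hδ.trans_le hαβ)⟩

theorem mem_iff_of_mem_halvingNode_add_one (hξ : ξ ∈ halvingNode h S b (α + 1)) :
    ξ ∈ h (halvingNode h S b α) ↔ α ∈ b :=
  (mem_halvingNode.1 hξ).2 α (Order.lt_add_one_iff.2 le_rfl)

theorem halvingNode_congr (hbc : ∀ β < α, (β ∈ b ↔ β ∈ c)) :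
    halvingNode h S b α = halvingNode h S c α := by
  induction α using WellFoundedLT.induction with
  | ind α ih =>
    ext ξ
    rw [mem_halvingNode, mem_halvingNode]
    refine and_congr_right fun _ => forall₂_congr fun β hβ => ?_
    rw [ih β hβ fun δ hδ => hbc δ (hδ.trans hβ), hbc β hβ]

theorem halvingNodeAt_eq (h : Set Ordinal.{u} → Set Ordinal.{u}) (S : Set Ordinal.{u})
    (ξ α : Ordinal.{u}) :
    halvingNodeAt h S ξ α = halvingNode h S {β | ξ ∈ h (halvingNodeAt h S ξ β)} α := by
  induction α using WellFoundedLT.induction with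
  | ind α ih =>
    ext ζ
    rw [mem_halvingNode, halvingNodeAt]
    refine and_congr_right fun _ => forall₂_congr fun β hβ => ?_
    rw [← ih β hβ]
    rfl

theorem exists_forall_mem_halvingNode (h : Set Ordinal.{u} → Set Ordinal.{u}) (hξ : ξ ∈ S) :
    ∃ b, ∀ α, ξ ∈ halvingNode h S b α := by
  refine ⟨{β | ξ ∈ h (halvingNodeAt h S ξ β)}, fun α => ?_⟩
  rw [← halvingNodeAt_eq, halvingNodeAt]
  exact ⟨hξ, fun _ _ => Iff.rfl⟩

end Halving

section Splitting

variable {κ : Cardinal.{u}} {γ α : Ordinal.{u}} {S : Set Ordinal.{u}}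

/-- The nodes at height `α` cover `S` and there are fewer than `κ` of them, so they cannot all miss
a `γ`-club. -/
theorem IsStationary.exists_isStationary_halvingNode (hpow : (2 : Cardinal.{u}) ^ α.card < κ)
    (hcomp : IsComplete κ (clubFilter γ κ.ord)) (hS : IsStationary (γ + 1) κ.ord S)
    (h : Set Ordinal.{u} → Set Ordinal.{u}) :
    ∃ b, IsStationary (γ + 1) κ.ord (halvingNode h S b α) := by
  by_contra! hnot
  let e : Iio α ≃ α.ToType := Ordinal.ToType.mk.toEquiv
  let B (s : Set α.ToType) : Set Ordinal.{u} := {x | ∃ hx : x < α, e ⟨x, hx⟩ ∈ s}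
  choose C hC hdisj using fun s => hS.exists_isGClub_disjoint (hnot (B s))
  have hcard : Cardinal.mk (Set α.ToType) < κ := by rwa [Cardinal.mk_set, Cardinal.mk_toType]
  obtain ⟨D, hD, hDC⟩ := hcomp.exists_isGClub_subset hcard hC
  obtain ⟨ξ, hξS, hξD⟩ := hS.inter_nonempty (Order.lt_add_one_iff.2 le_rfl) hD
  obtain ⟨b, hb⟩ := exists_forall_mem_halvingNode h hξS
  have hBb : ∀ β < α, (β ∈ b ↔ β ∈ B {i | (e.symm i).1 ∈ b}) := fun β hβ => by
    simp [B, hβ]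
  refine disjoint_left.1 (hdisj {i | (e.symm i).1 ∈ b}) ?_ (hDC _ hξD)
  rw [← halvingNode_congr hBb]
  exact hb α

theorem exists_forall_isStationary_halvingNode (hbr : BranchProperty κ)
    (hcomp : IsComplete κ (clubFilter γ κ.ord)) (hS : IsStationary (γ + 1) κ.ord S)
    (h : Set Ordinal.{u} → Set Ordinal.{u}) :
    ∃ b, ∀ α < κ.ord, IsStationary (γ + 1) κ.ord (halvingNode h S b α) := by
  have hex (α : Ordinal.{u}) :
      ∃ b, α < κ.ord → IsStationary (γ + 1) κ.ord (halvingNode h S b α) := by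
    by_cases hα : α < κ.ord
    · have hpow := hbr.two_power_card_lt hS.aleph0_lt.le hα
      obtain ⟨b, hb⟩ := hS.exists_isStationary_halvingNode hpow hcomp h
      exact ⟨b, fun _ => hb⟩
    · exact ⟨∅, fun h => absurd h hα⟩
  choose t ht using hex
  obtain ⟨b, hb⟩ := hbr t
  refine ⟨b, fun β hβ => ?_⟩
  obtain ⟨α, hα, hβα, heq⟩ := hb β hβ
  have htb : ∀ δ < β, (δ ∈ t α ↔ δ ∈ b) := fun δ hδ => by
    simpa [show δ < β from hδ] using Set.ext_iff.1 heq δ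
  rw [← halvingNode_congr htb]
  exact (ht α hα).superset (halvingNode_antitone h S _ hβα)

theorem splits_of_pairwise_disjoint (hκ : 0 < κ.ord) (P : Iio κ.ord → Set Ordinal.{u})
    (hP : ∀ i, IsStationary γ κ.ord (P i)) (hPS : ∀ i, P i ⊆ S)
    (hdisj : Pairwise fun i j => Disjoint (P i) (P j)) : Splits γ κ S := by
  let R : Set Ordinal.{u} := S \ ⋃ i, P i
  have hR {x : Ordinal.{u}} {i : Iio κ.ord} (hx : x ∈ P i) : x ∉ R :=
    fun hxR => hxR.2 (mem_iUnion.2 ⟨i, hx⟩)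
  refine ⟨fun i => P i ∪ {x | i.1 = 0 ∧ x ∈ R}, fun i => (hP i).superset subset_union_left,
    fun i j hij => disjoint_left.2 ?_, Set.ext fun x => ⟨fun hx => ?_, fun hx => ?_⟩⟩
  · rintro x (hxi | ⟨hi, hxR⟩) (hxj | ⟨hj, hxR'⟩)
    · exact disjoint_left.1 (hdisj hij) hxi hxj
    · exact hR hxi hxR'
    · exact hR hxj hxR
    · exact hij (Subtype.ext (hi.trans hj.symm))
  · obtain ⟨i, hxi | ⟨-, hxR⟩⟩ := mem_iUnion.1 hx
    exacts [hPS i hxi, hxR.1]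
  · by_cases hxP : ∃ i, x ∈ P i
    · obtain ⟨i, hxi⟩ := hxP
      exact mem_iUnion.2 ⟨i, Or.inl hxi⟩
    · exact mem_iUnion.2 ⟨⟨0, hκ⟩, Or.inr ⟨rfl, hx, fun h => hxP (mem_iUnion.1 h)⟩⟩

theorem splits_of_branchProperty (hbr : BranchProperty κ)
    (hcomp : IsComplete κ (clubFilter γ κ.ord)) (hS : IsStationary (γ + 1) κ.ord S) :
    Splits (γ + 1) κ S := by
  have hlim := hS.isSuccLimit
  have hex (X : Set Ordinal.{u}) : ∃ Y ⊆ X, IsStationary (γ + 1) κ.ord X →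
      IsStationary (γ + 1) κ.ord Y ∧ IsStationary (γ + 1) κ.ord (X \ Y) := by
    by_cases hX : IsStationary (γ + 1) κ.ord X
    · obtain ⟨Y, hY, hhalf⟩ := hX.exists_halving hcomp
      exact ⟨Y, hY, fun _ => hhalf⟩
    · exact ⟨∅, empty_subset _, fun h => absurd h hX⟩
  choose h hsub hhalf using hex
  obtain ⟨b, hb⟩ := exists_forall_isStationary_halvingNode hbr hcomp hS h
  let P (β : Iio κ.ord) : Set Ordinal.{u} :=
    halvingNode h S b β.1 \ halvingNode h S b (β.1 + 1)
  have hlt {i j : Iio κ.ord} (hij : i < j) : Disjoint (P i) (P j) := disjoint_left.2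
    fun x hxi hxj => hxi.2 (halvingNode_antitone h S b (Order.add_one_le_iff.2 hij) hxj.1)
  refine splits_of_pairwise_disjoint hlim.bot_lt P (fun β => ?_)
    (fun β x hx => (mem_halvingNode.1 hx.1).1) fun i j hij => ?_
  · obtain ⟨hin, hout⟩ := hhalf _ (hb β.1 β.2)
    by_cases hβb : β.1 ∈ b
    · exact hout.superset fun x hx =>
        ⟨hx.1, fun hx' => hx.2 ((mem_iff_of_mem_halvingNode_add_one hx').2 hβb)⟩
    · exact hin.superset fun x hx =>
        ⟨hsub _ hx, fun hx' => hβb ((mem_iff_of_mem_halvingNode_add_one hx').1 hx)⟩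
  · rcases lt_or_gt_of_ne hij with h | h
    · exact hlt h
    · exact (hlt h).symm

end Splitting

/-! ### Uniform definability -/

section Definability

open FirstOrder

/-- A family of structures on sets `V_α`, `α` a limit ordinal, for a language with a symbol for
membership. -/
structure SetModels : Type (u + 2) where
  L : FirstOrder.Language.{0, 0}
  J : Type (u + 1)
  ord : J → Ordinal.{u}
  isSuccLimit : ∀ j, Order.IsSuccLimit (ord j)
  str : ∀ j, L.Structure (VDom (ord j))
  memRel : L.Relations 2
  memRel_iff : ∀ j x y, (str j).RelMap memRel ![x, y] ↔ x.1 ∈ y.1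

namespace SetModels

/-- The domain of the structure with index `j`. -/
abbrev Dom (I : SetModels.{u}) (j : I.J) : Type (u + 1) := VDom (I.ord j)

variable {I : SetModels.{u}} {n m : ℕ}

/-- Predicates of `n` elements that one formula defines in all structures of the family. The
predicates are functions of the valuation, so that definability is proved by following the shape of
a predicate, without writing down formulas. -/
def Definable (I : SetModels.{u}) (n : ℕ) (P : ∀ j, (Fin n → I.Dom j) → Prop) : Prop :=
  ∃ φ : I.L.BoundedFormula Empty n, ∀ j v,
    @Language.BoundedFormula.Realize I.L (I.Dom j) (I.str j) Empty n φ default v ↔ P j v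

/-- A function of the valuation that is a projection to one of the variables; instance search then
keeps track of the variables through the quantifiers. -/
class IsVar (e : ∀ j, (Fin n → I.Dom j) → I.Dom j) : Prop where
  exists_eq : ∃ i, ∀ j v, e j v = v i

instance (i : Fin n) : IsVar (I := I) (n := n) (fun _ v => v i) := ⟨⟨i, fun _ _ => rfl⟩⟩

instance (s : Fin n → Fin m) (e : ∀ j, (Fin n → I.Dom j) → I.Dom j) [he : IsVar e] :
    IsVar (I := I) (n := m) (fun j w => e j (fun i => w (s i))) := by
  obtain ⟨i, hi⟩ := he.exists_eq
  exact ⟨⟨s i, fun j w => hi j _⟩⟩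

namespace Definable

section Connectives

variable {P Q : ∀ j, (Fin n → I.Dom j) → Prop}

theorem congr (hP : I.Definable n P) (hQP : ∀ j v, Q j v ↔ P j v) : I.Definable n Q := by
  obtain ⟨φ, hφ⟩ := hP
  exact ⟨φ, fun j v => (hφ j v).trans (hQP j v).symm⟩

theorem not (hP : I.Definable n P) : I.Definable n fun j v => ¬ P j v := by
  obtain ⟨φ, hφ⟩ := hP
  exact ⟨φ.not, fun j v => by
    let _ := I.str j
    rw [Language.BoundedFormula.realize_not, hφ]⟩

theorem imp (hP : I.Definable n P) (hQ : I.Definable n Q) :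
    I.Definable n fun j v => P j v → Q j v := by
  obtain ⟨φ, hφ⟩ := hP
  obtain ⟨ψ, hψ⟩ := hQ
  exact ⟨φ.imp ψ, fun j v => by
    let _ := I.str j
    rw [Language.BoundedFormula.realize_imp, hφ, hψ]⟩

theorem and (hP : I.Definable n P) (hQ : I.Definable n Q) :
    I.Definable n fun j v => P j v ∧ Q j v :=
  (hP.imp hQ.not).not.congr fun _ _ => by tauto

theorem or (hP : I.Definable n P) (hQ : I.Definable n Q) :
    I.Definable n fun j v => P j v ∨ Q j v :=
  (hP.not.imp hQ).congr fun _ _ => by tauto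

theorem iff (hP : I.Definable n P) (hQ : I.Definable n Q) :
    I.Definable n fun j v => (P j v ↔ Q j v) :=
  ((hP.imp hQ).and (hQ.imp hP)).congr fun _ _ => by tauto

theorem const (p : Prop) : I.Definable n fun _ _ => p := by
  by_cases hp : p
  · exact ⟨⊤, fun j v => by
      let _ := I.str j
      simp [hp]⟩
  · exact ⟨⊥, fun j v => by
      let _ := I.str j
      simp [hp]⟩

end Connectives

section Quantifiers

variable {P : ∀ j, (Fin n → I.Dom j) → I.Dom j → Prop}

theorem all (hP : I.Definable (n + 1) fun j w => P j (fun i => w i.castSucc) (w (Fin.last n))) :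
    I.Definable n fun j v => ∀ x, P j v x := by
  obtain ⟨φ, hφ⟩ := hP
  exact ⟨φ.all, fun j v => by
    let _ := I.str j
    rw [Language.BoundedFormula.realize_all]
    refine forall_congr' fun x => ?_
    rw [hφ]
    simp only [Fin.snoc_castSucc, Fin.snoc_last]⟩

theorem ex (hP : I.Definable (n + 1) fun j w => P j (fun i => w i.castSucc) (w (Fin.last n))) :
    I.Definable n fun j v => ∃ x, P j v x :=
  (all (P := fun j v x => ¬ P j v x) hP.not).not.congr fun _ _ => by
    simp only [not_forall, not_not]

end Quantifiers

section Atomic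

variable {e e' : ∀ j, (Fin n → I.Dom j) → I.Dom j} [he : IsVar e] [he' : IsVar e']

theorem rel₁ (r : I.L.Relations 1) : I.Definable n fun j v => (I.str j).RelMap r ![e j v] := by
  obtain ⟨i, hi⟩ := he.exists_eq
  refine ⟨r.boundedFormula₁ (Language.Term.var (Sum.inr i)), fun j v => ?_⟩
  let _ := I.str j
  rw [Language.BoundedFormula.realize_rel₁]
  beta_reduce
  rw [hi]
  rfl

theorem rel₂ (r : I.L.Relations 2) :
    I.Definable n fun j v => (I.str j).RelMap r ![e j v, e' j v] := by
  obtain ⟨i, hi⟩ := he.exists_eq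
  obtain ⟨i', hi'⟩ := he'.exists_eq
  refine ⟨r.boundedFormula₂ (Language.Term.var (Sum.inr i)) (Language.Term.var (Sum.inr i')),
    fun j v => ?_⟩
  let _ := I.str j
  rw [Language.BoundedFormula.realize_rel₂]
  beta_reduce
  rw [hi, hi']
  rfl

theorem mem : I.Definable n fun j v => (e j v).1 ∈ (e' j v).1 :=
  (rel₂ I.memRel).congr fun j _ => (I.memRel_iff j _ _).symm

theorem eq : I.Definable n fun j v => e j v = e' j v := by
  obtain ⟨i, hi⟩ := he.exists_eq
  obtain ⟨i', hi'⟩ := he'.exists_eq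
  refine ⟨Language.Term.bdEqual (Language.Term.var (Sum.inr i)) (Language.Term.var (Sum.inr i')),
    fun j v => ?_⟩
  let _ := I.str j
  rw [Language.BoundedFormula.realize_bdEqual]
  beta_reduce
  rw [hi, hi']
  rfl

end Atomic

end Definable

/-- A subset of each structure of the family, all defined by one formula. -/
def DefinableSet (I : SetModels.{u}) (U : ∀ j, Set (I.Dom j)) : Prop :=
  ∀ (n : ℕ) (e : ∀ j, (Fin n → I.Dom j) → I.Dom j) [IsVar e],
    I.Definable n fun j v => e j v ∈ U j

theorem DefinableSet.mem {U : ∀ j, Set (I.Dom j)} (hU : I.DefinableSet U)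
    {e : ∀ j, (Fin n → I.Dom j) → I.Dom j} [IsVar e] :
    I.Definable n fun j v => e j v ∈ U j :=
  hU n e

end SetModels

end Definability

section Absoluteness

variable {α : Ordinal.{u}}

theorem VDom.mem_trans (x : VDom α) {y : ZFSet.{u}} (hy : y ∈ x.1) : y ∈ ZFSet.vonNeumann α :=
  (ZFSet.isTransitive_vonNeumann α).mem_trans hy x.2

theorem VDom.ext_iff (x y : VDom α) : x = y ↔ ∀ z : VDom α, z.1 ∈ x.1 ↔ z.1 ∈ y.1 := by
  refine ⟨fun h z => by rw [h], fun h => Subtype.ext (ZFSet.ext fun z => ?_)⟩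
  refine ⟨fun hz => ?_, fun hz => ?_⟩
  · exact (h ⟨z, x.mem_trans hz⟩).1 hz
  · exact (h ⟨z, y.mem_trans hz⟩).2 hz

theorem rank_pair_lt (hα : Order.IsSuccLimit α) {x y : ZFSet.{u}} (hx : x.rank < α)
    (hy : y.rank < α) : (ZFSet.pair x y).rank < α := by
  have hrank : (ZFSet.pair x y).rank = Order.succ (Order.succ (max x.rank y.rank)) := by
    simp only [ZFSet.pair, ZFSet.rank_pair, ZFSet.rank_singleton, ← Order.succ_max]
    simp
  rw [hrank]
  exact hα.succ_lt (hα.succ_lt (max_lt hx hy))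

/-- The ordered pair as an element of `V_α`. -/
def VDom.pair (hα : Order.IsSuccLimit α) (x y : VDom α) : VDom α :=
  ⟨ZFSet.pair x.1 y.1, ZFSet.mem_vonNeumann.2
    (rank_pair_lt hα (ZFSet.mem_vonNeumann.1 x.2) (ZFSet.mem_vonNeumann.1 y.2))⟩

theorem VDom.singleton_mem (hα : Order.IsSuccLimit α) (x : VDom α) :
    ({x.1} : ZFSet.{u}) ∈ ZFSet.vonNeumann α := by
  rw [ZFSet.mem_vonNeumann, ZFSet.rank_singleton]
  exact hα.succ_lt (ZFSet.mem_vonNeumann.1 x.2)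

theorem VDom.insert_mem (hα : Order.IsSuccLimit α) (x y : VDom α) :
    ({x.1, y.1} : ZFSet.{u}) ∈ ZFSet.vonNeumann α := by
  rw [ZFSet.mem_vonNeumann, ZFSet.rank_pair]
  exact max_lt (hα.succ_lt (ZFSet.mem_vonNeumann.1 x.2)) (hα.succ_lt (ZFSet.mem_vonNeumann.1 y.2))

theorem VDom.eq_singleton_iff (hα : Order.IsSuccLimit α) (z x : VDom α) :
    z.1 = {x.1} ↔ ∀ w : VDom α, w.1 ∈ z.1 ↔ w = x := by
  have h := VDom.ext_iff z ⟨_, x.singleton_mem hα⟩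
  simpa only [Subtype.ext_iff, ZFSet.mem_singleton] using h

theorem VDom.eq_insert_iff (hα : Order.IsSuccLimit α) (z x y : VDom α) :
    z.1 = {x.1, y.1} ↔ ∀ w : VDom α, w.1 ∈ z.1 ↔ w = x ∨ w = y := by
  have h := VDom.ext_iff z ⟨_, x.insert_mem hα y⟩
  simpa only [Subtype.ext_iff, ZFSet.mem_insert_iff, ZFSet.mem_singleton] using h

theorem VDom.eq_pair_iff (hα : Order.IsSuccLimit α) (p x y : VDom α) :
    p.1 = ZFSet.pair x.1 y.1 ↔ ∀ z : VDom α, z.1 ∈ p.1 ↔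
      (∀ w : VDom α, w.1 ∈ z.1 ↔ w = x) ∨ (∀ w : VDom α, w.1 ∈ z.1 ↔ w = x ∨ w = y) := by
  have h := VDom.ext_iff p (VDom.pair hα x y)
  simpa only [Subtype.ext_iff, VDom.pair, ZFSet.pair, ZFSet.mem_insert_iff, ZFSet.mem_singleton,
    VDom.eq_singleton_iff hα, VDom.eq_insert_iff hα] using h

theorem VDom.isOrdinal_iff (x : VDom α) : x.1.IsOrdinal ↔
    (∀ y z : VDom α, z.1 ∈ y.1 → y.1 ∈ x.1 → z.1 ∈ x.1) ∧
    ∀ w y z : VDom α, w.1 ∈ x.1 → z.1 ∈ y.1 → y.1 ∈ w.1 → z.1 ∈ w.1 := by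
  rw [ZFSet.isOrdinal_iff_forall_mem_isTransitive]
  simp only [ZFSet.isTransitive_iff_mem_trans]
  constructor
  · rintro ⟨hx, hmem⟩
    exact ⟨fun y z hz hy => hx hz hy, fun w y z hw hz hy => hmem w.1 hw hz hy⟩
  · rintro ⟨hx, hmem⟩
    refine ⟨fun {z y} hz hy => ?_, fun w hw {z y} hz hy => ?_⟩
    · have hyV := x.mem_trans hy
      exact hx ⟨y, hyV⟩ ⟨z, VDom.mem_trans ⟨y, hyV⟩ hz⟩ hz hy
    · have hwV := x.mem_trans hw
      have hyV := VDom.mem_trans ⟨w, hwV⟩ hy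
      exact hmem ⟨w, hwV⟩ ⟨y, hyV⟩ ⟨z, VDom.mem_trans ⟨y, hyV⟩ hz⟩ hw hz hy

/-- `⟨x, y⟩ ∈ U`: the set `U` as a binary relation on `V_α`. -/
def PairMem (U : Set (VDom α)) (x y : VDom α) : Prop :=
  ∃ p ∈ U, p.1 = ZFSet.pair x.1 y.1

/-- `⟨x, ⟨y, z⟩⟩ ∈ U`: the set `U` as a ternary relation on `V_α`. -/
def TripleMem (U : Set (VDom α)) (x y z : VDom α) : Prop :=
  ∃ q : VDom α, q.1 = ZFSet.pair y.1 z.1 ∧ PairMem U x q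

end Absoluteness

namespace SetModels.Definable

variable {I : SetModels.{u}} {n : ℕ} {e e' e'' : ∀ j, (Fin n → I.Dom j) → I.Dom j}
  [IsVar e] [IsVar e'] [IsVar e''] {U : ∀ j, Set (I.Dom j)}

theorem eq_pair : I.Definable n fun j v => (e j v).1 = ZFSet.pair (e' j v).1 (e'' j v).1 := by
  refine congr ?_ fun j v => VDom.eq_pair_iff (I.isSuccLimit j) _ _ _
  exact all (mem.iff ((all (mem.iff eq)).or (all (mem.iff (eq.or eq)))))

theorem isOrdinal : I.Definable n fun j v => (e j v).1.IsOrdinal := by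
  refine congr ?_ fun j v => VDom.isOrdinal_iff (e j v)
  exact (all (all (mem.imp (mem.imp mem)))).and
    (all (all (all (mem.imp (mem.imp (mem.imp mem))))))

theorem pairMem (hU : I.DefinableSet U) : I.Definable n fun j v => PairMem (U j) (e j v) (e' j v) :=
  ex (hU.mem.and eq_pair)

theorem tripleMem (hU : I.DefinableSet U) :
    I.Definable n fun j v => TripleMem (U j) (e j v) (e' j v) (e'' j v) :=
  ex (eq_pair.and (pairMem hU))

end SetModels.Definable

/-! ### Games with definable moves -/

section Games

open FirstOrder

/-- Two players alternately move between subsets of `V_α`, starting from `R ∩ V_α`; the first player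
who is unable to move loses. The moves and a side condition are uniformly first order definable over
all `V_α`, the rank of a position is at most `γ` and decreases with every move, and `good` is the
set of positions in which the player to move loses. -/
structure SetGame (κ γ : Ordinal.{u}) where
  R : Set ZFSet.{u}
  R_mem : ∀ x ∈ R, x ∈ ZFSet.vonNeumann κ
  side : ∀ α : Ordinal.{u}, Set (VDom α) → Prop
  move : ∀ α : Ordinal.{u}, Set (VDom α) → Set (VDom α) → Set (VDom α) → Prop
  side_def : ∀ (I : SetModels.{u}) (A : ∀ j, Set (I.Dom j)), I.DefinableSet A →
    I.Definable 0 fun j _ => side (I.ord j) (A j)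
  move_def : ∀ (I : SetModels.{u}) (A U W : ∀ j, Set (I.Dom j)), I.DefinableSet A →
    I.DefinableSet U → I.DefinableSet W → I.Definable 0 fun j _ => move (I.ord j) (A j) (U j) (W j)
  good : ∀ α : Ordinal.{u}, Set (VDom α) → Prop
  rank : ∀ α : Ordinal.{u}, Set (VDom α) → Ordinal.{u}
  not_move_empty : ∀ α W, ¬ move α (restrict R α) ∅ W
  rank_empty : ∀ α, rank α ∅ = 0
  rank_lt : ∀ α U W, move α (restrict R α) U W → rank α W < rank α U
  rank_le : ∀ α ≤ κ, Order.IsSuccLimit α → side α (restrict R α) → rank α (restrict R α) ≤ γ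
  good_iff : ∀ α ≤ κ, Order.IsSuccLimit α → side α (restrict R α) → ∀ U, rank α U ≤ γ →
    (good α U ↔ ∀ W, move α (restrict R α) U W → ¬ good α W)

namespace SetGame

variable {κ γ α : Ordinal.{u}} (g : SetGame κ γ)

/-- The initial position of the game over `V_α`. -/
abbrev start (α : Ordinal.{u}) : Set (VDom α) := restrict g.R α

/-- The legal moves of the game over `V_α`. -/
abbrev Step (U W : Set (VDom α)) : Prop := g.move α (g.start α) U W

/-- `Π` wins the game over `V_α`, and the side condition holds. -/
def Holds (α : Ordinal.{u}) : Prop :=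
  Order.IsSuccLimit α ∧ g.side α (g.start α) ∧ g.good α (g.start α)

/-- The structures `V_α` over which `good` is the set of positions in which the player to move
loses. -/
structure IsBoard (α : Ordinal.{u}) : Prop where
  le : α ≤ κ
  isSuccLimit : Order.IsSuccLimit α
  side : g.side α (g.start α)

variable {g} {U W : Set (VDom α)}

theorem IsBoard.rank_start_le (hb : g.IsBoard α) : g.rank α (g.start α) ≤ γ :=
  g.rank_le α hb.le hb.isSuccLimit hb.side

theorem IsBoard.good_iff (hb : g.IsBoard α) (hU : g.rank α U ≤ γ) :
    g.good α U ↔ ∀ W, g.Step U W → ¬ g.good α W :=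
  g.good_iff α hb.le hb.isSuccLimit hb.side U hU

theorem IsBoard.good_empty (hb : g.IsBoard α) : g.good α ∅ :=
  (hb.good_iff (by simp [g.rank_empty])).2 fun W hW => absurd hW (g.not_move_empty α W)

theorem IsBoard.exists_step_good (hb : g.IsBoard α) (hU : g.rank α U ≤ γ) (hbad : ¬ g.good α U) :
    ∃ W, g.Step U W ∧ g.good α W := by
  rw [hb.good_iff hU] at hbad
  push Not at hbad
  exact hbad

theorem IsBoard.not_good_of_step (hb : g.IsBoard α) (hU : g.rank α U ≤ γ) (hgood : g.good α U)
    (hW : g.Step U W) : ¬ g.good α W :=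
  (hb.good_iff hU).1 hgood W hW

end SetGame

/-- Every set game of rank `γ` that `Π` wins over `V_κ` is won by `Π` over some `V_α`, `α < κ`. This
is what indescribability is used for. -/
def ReflectsGames (γ κ : Ordinal.{u}) : Prop :=
  ∀ g : SetGame κ γ, g.Holds κ → ∃ α < κ, g.Holds α

section LimitSentence

variable {L : FirstOrder.Language.{0, 0}} (r : L.Relations 2) {α : Ordinal.{u}}

/-- The sentence stating that `α` is a limit ordinal, in the form: `V_α` is nonempty and every
element of `V_α` belongs to some element of `V_α`. -/
def limSentence : L.Sentence :=
  FirstOrder.Language.BoundedFormula.ex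
    (Language.Term.bdEqual (Language.Term.var (Sum.inr 0)) (Language.Term.var (Sum.inr 0))) ⊓
    (r.boundedFormula₂ (Language.Term.var (Sum.inr 0)) (Language.Term.var (Sum.inr 1))).ex.all

theorem isSuccLimit_iff_vDom :
    Order.IsSuccLimit α ↔ Nonempty (VDom α) ∧ ∀ x : VDom α, ∃ y : VDom α, x.1 ∈ y.1 := by
  constructor
  · intro hα
    exact ⟨⟨⟨∅, by rw [ZFSet.mem_vonNeumann, ZFSet.rank_empty]; exact hα.bot_lt⟩⟩,
      fun x => ⟨⟨_, x.singleton_mem hα⟩, by simp⟩⟩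
  · rintro ⟨⟨x⟩, hex⟩
    refine ⟨fun hmin => hmin.not_lt (ZFSet.mem_vonNeumann.1 x.2),
      Order.isSuccPrelimit_of_succ_lt fun β hβ => ?_⟩
    obtain ⟨y, hy⟩ := hex ⟨β.toZFSet, by simpa [ZFSet.mem_vonNeumann] using hβ⟩
    have hβy := ZFSet.rank_lt_of_mem hy
    rw [Ordinal.rank_toZFSet] at hβy
    exact (Order.succ_le_of_lt hβy).trans_lt (ZFSet.mem_vonNeumann.1 y.2)

theorem realize_limSentence (str : L.Structure (VDom α))
    (hr : ∀ x y : VDom α, str.RelMap r ![x, y] ↔ x.1 ∈ y.1) :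
    @Language.Sentence.Realize L (VDom α) str (limSentence r) ↔ Order.IsSuccLimit α := by
  rw [isSuccLimit_iff_vDom, limSentence, Language.Sentence.Realize, Language.Formula.Realize,
    Language.BoundedFormula.realize_inf, Language.BoundedFormula.realize_ex,
    Language.BoundedFormula.realize_all]
  refine and_congr ⟨fun ⟨x, _⟩ => ⟨x⟩, fun ⟨x⟩ => ⟨x, ?_⟩⟩ (forall_congr' fun x => ?_)
  · rw [Language.BoundedFormula.realize_bdEqual]
  · rw [Language.BoundedFormula.realize_ex]
    refine exists_congr fun y => ?_
    rw [Language.BoundedFormula.realize_rel₂]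
    exact hr _ _

theorem realize_limSentence_inf (str : L.Structure (VDom α))
    (hr : ∀ x y : VDom α, str.RelMap r ![x, y] ↔ x.1 ∈ y.1) (φ : L.Sentence) :
    @Language.Sentence.Realize L (VDom α) str (limSentence r ⊓ φ) ↔
      Order.IsSuccLimit α ∧ @Language.Sentence.Realize L (VDom α) str φ := by
  rw [← realize_limSentence r str hr]
  exact Language.Formula.realize_inf

end LimitSentence

theorem SetModels.Definable.exists_sentence {I : SetModels.{u}} {P : I.J → Prop}
    (hP : I.Definable 0 fun j _ => P j) : ∃ φ : I.L.Sentence, ∀ j,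
      @Language.Sentence.Realize I.L (I.Dom j) (I.str j) φ ↔ P j := by
  obtain ⟨φ, hφ⟩ := hP
  exact ⟨φ, fun j => hφ j default⟩

end Games

section OddOrdinals

variable {η : Ordinal.{u}}

theorem isOddOrdinal_one : IsOddOrdinal (1 : Ordinal.{u}) :=
  ⟨0, 1, Order.isSuccPrelimit_bot, odd_one, by simp⟩

theorem isOddOrdinal_or_add_one (η : Ordinal.{u}) : IsOddOrdinal η ∨ IsOddOrdinal (η + 1) := by
  induction η using Ordinal.limitRecOn with
  | zero => exact Or.inr (by simpa using isOddOrdinal_one)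
  | add_one η ih =>
    rcases ih with ⟨l, n, hl, hn, rfl⟩ | hodd
    · refine Or.inr ⟨l, n + 2, hl, by simpa [parity_simps] using hn, ?_⟩
      push_cast
      rw [add_assoc, add_assoc, one_add_one_eq_two]
    · exact Or.inl hodd
  | limit η hη _ => exact Or.inr ⟨η, 1, hη.isSuccPrelimit, odd_one, by simp⟩

theorem exists_isOddOrdinal (η : Ordinal.{u}) : ∃ ε, IsOddOrdinal ε ∧ η ≤ ε ∧ ε ≤ η + 1 := by
  rcases isOddOrdinal_or_add_one η with hodd | hodd
  · exact ⟨η, hodd, le_rfl, le_self_add⟩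
  · exact ⟨η + 1, hodd, le_self_add, le_rfl⟩

end OddOrdinals

/-! ### Definability of sequences of sets -/

section Sequences

variable {α : Ordinal.{u}}

/-- The natural number `k` as an element of `V_α`. -/
noncomputable def VDom.nat (hα : Order.IsSuccLimit α) (k : ℕ) : VDom α :=
  ⟨Ordinal.toZFSet (k : Ordinal.{u}), by
    rw [ZFSet.mem_vonNeumann, Ordinal.rank_toZFSet]
    exact (Ordinal.natCast_lt_omega0 k).trans_le (Ordinal.omega0_le_of_isSuccLimit hα)⟩

variable (hα : Order.IsSuccLimit α) {k l : ℕ} {x y z : VDom α}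

theorem VDom.nat_mem_nat : (VDom.nat hα k).1 ∈ (VDom.nat hα l).1 ↔ k < l := by
  rw [VDom.nat, VDom.nat, Ordinal.toZFSet_mem_toZFSet_iff, Nat.cast_lt]

theorem VDom.nat_inj : VDom.nat hα k = VDom.nat hα l ↔ k = l := by
  rw [VDom.nat, VDom.nat, Subtype.mk.injEq, Ordinal.toZFSet_injective.eq_iff, Nat.cast_inj]

theorem VDom.eq_nat_iff_of_mem_nat_add_one :
    (z.1 ∈ (VDom.nat hα (k + 1)).1 ∧ ∀ w : VDom α, w.1 ∈ (VDom.nat hα (k + 1)).1 → ¬ z.1 ∈ w.1) ↔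
      z = VDom.nat hα k := by
  have hlt {a : Ordinal.{u}} : a < (k + 1 : ℕ) ↔ a ≤ k := by
    rw [Nat.cast_add, Nat.cast_one, Order.lt_add_one_iff]
  constructor
  · rintro ⟨hz, hmax⟩
    obtain ⟨a, ha, haz⟩ := Ordinal.mem_toZFSet_iff.1 hz
    have hka := hmax _ ((VDom.nat_mem_nat hα).2 k.lt_add_one)
    rw [← haz, VDom.nat, Ordinal.toZFSet_mem_toZFSet_iff, not_lt] at hka
    exact Subtype.ext (by rw [← haz, le_antisymm (hlt.1 ha) hka]; rfl)
  · rintro rfl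
    refine ⟨(VDom.nat_mem_nat hα).2 k.lt_add_one, fun w hw hkw => ?_⟩
    obtain ⟨a, ha, haw⟩ := Ordinal.mem_toZFSet_iff.1 hw
    rw [← haw, VDom.nat, Ordinal.toZFSet_mem_toZFSet_iff] at hkw
    exact (hlt.1 ha).not_gt hkw

/-- `x` is the numeral of an index of an entry of the sequence `X`. -/
def SeqDom (X : List (Set (VDom α))) (x : VDom α) : Prop :=
  ∃ k < X.length, x.1 = Ordinal.toZFSet (k : Ordinal.{u})

/-- `x` is the numeral of an index of an entry of the sequence `X` that contains `y`. -/
def SeqEntry (X : List (Set (VDom α))) (x y : VDom α) : Prop :=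
  ∃ k < X.length, x.1 = Ordinal.toZFSet (k : Ordinal.{u}) ∧ y ∈ X.getD k ∅

/-- `x` is the numeral of the last index of `X`. -/
def SeqLast (X : List (Set (VDom α))) (x : VDom α) : Prop :=
  SeqDom X x ∧ ∀ z, SeqDom X z → ¬ x.1 ∈ z.1

variable (X : List (Set (VDom α))) (Z A : Set (VDom α))

theorem seqDom_iff : SeqDom X x ↔ ∃ k < X.length, x = VDom.nat hα k := by
  simp only [SeqDom, Subtype.ext_iff, VDom.nat]

theorem seqEntry_nat_iff : SeqEntry X (VDom.nat hα k) y ↔ y ∈ X.getD k ∅ := by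
  constructor
  · rintro ⟨l, -, hkl, hy⟩
    rwa [(VDom.nat_inj hα).1 (Subtype.ext hkl : VDom.nat hα k = VDom.nat hα l)]
  · intro hy
    have hk : k < X.length := by
      by_contra hk
      rw [List.getD_eq_default X ∅ (not_lt.1 hk)] at hy
      exact hy
    exact ⟨k, hk, rfl, hy⟩

theorem not_seqDom_nil : ¬ SeqDom [] x := fun ⟨_, hk, _⟩ => Nat.not_lt_zero _ hk

include hα in
theorem forall_not_seqDom_iff : (∀ x, ¬ SeqDom X x) ↔ X = [] := by
  refine ⟨fun hX => ?_, fun hX x => hX ▸ not_seqDom_nil⟩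
  by_contra hne
  exact hX (VDom.nat hα 0) ⟨0, List.length_pos_iff.2 hne, rfl⟩

theorem seqLast_concat_iff : SeqLast (X ++ [Z]) x ↔ x = VDom.nat hα X.length := by
  simp only [SeqLast, seqDom_iff hα, List.length_append, List.length_singleton]
  constructor
  · rintro ⟨⟨k, hk, rfl⟩, hmax⟩
    have hle := hmax _ ⟨X.length, X.length.lt_add_one, rfl⟩
    rw [VDom.nat_mem_nat] at hle
    rw [VDom.nat_inj]
    omega
  · rintro rfl
    refine ⟨⟨_, X.length.lt_add_one, rfl⟩, ?_⟩
    rintro z ⟨k, hk, rfl⟩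
    rw [VDom.nat_mem_nat]
    omega

include hα in
theorem mem_getLastD_iff : y ∈ X.getLastD A ↔
    (∃ x, SeqLast X x ∧ SeqEntry X x y) ∨ ((∀ x, ¬ SeqDom X x) ∧ y ∈ A) := by
  rw [forall_not_seqDom_iff hα]
  rcases List.eq_nil_or_concat' X with rfl | ⟨X, Z, rfl⟩
  · simp [SeqLast, not_seqDom_nil]
  · simp [seqLast_concat_iff hα, seqEntry_nat_iff hα, List.getLastD_concat,
      -List.getLastD_eq_getLast?]

include hα in
theorem mem_getLastD_dropLast_iff : y ∈ X.dropLast.getLastD A ↔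
    (∃ x, SeqLast X x ∧ ((∃ z, (z.1 ∈ x.1 ∧ ∀ w : VDom α, w.1 ∈ x.1 → ¬ z.1 ∈ w.1) ∧
      SeqEntry X z y) ∨ ((∀ z : VDom α, ¬ z.1 ∈ x.1) ∧ y ∈ A))) ∨
    ((∀ x, ¬ SeqDom X x) ∧ y ∈ A) := by
  rw [forall_not_seqDom_iff hα]
  rcases List.eq_nil_or_concat' X with rfl | ⟨X, Z, rfl⟩
  · simp [SeqLast, not_seqDom_nil]
  simp only [seqLast_concat_iff hα, exists_eq_left, List.dropLast_concat]
  rcases List.eq_nil_or_concat' X with rfl | ⟨X, W, rfl⟩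
  · simp [VDom.nat]
  · have hne : ¬ ∀ z : VDom α, z.1 ∉ (VDom.nat hα (X.length + 1)).1 := fun hempty =>
      hempty (VDom.nat hα 0) ((VDom.nat_mem_nat hα).2 X.length.succ_pos)
    simp only [List.length_append, List.length_singleton, VDom.eq_nat_iff_of_mem_nat_add_one,
      exists_eq_left, seqEntry_nat_iff hα, hne]
    simp [List.getLastD_concat, -List.getLastD_eq_getLast?]

end Sequences

namespace SetModels

variable {I : SetModels.{u}} {n : ℕ} {X : ∀ j, List (Set (I.Dom j))} {A : ∀ j, Set (I.Dom j)}

/-- A sequence of subsets of each structure of the family that is defined by one formula, as a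
function of the numerals of the indices. -/
def DefinableSeq (I : SetModels.{u}) (X : ∀ j, List (Set (I.Dom j))) : Prop :=
  (∀ (n : ℕ) (e : ∀ j, (Fin n → I.Dom j) → I.Dom j) [IsVar e],
    I.Definable n fun j v => SeqDom (X j) (e j v)) ∧
  ∀ (n : ℕ) (e e' : ∀ j, (Fin n → I.Dom j) → I.Dom j) [IsVar e] [IsVar e'],
    I.Definable n fun j v => SeqEntry (X j) (e j v) (e' j v)

namespace DefinableSeq

section

variable {e e' : ∀ j, (Fin n → I.Dom j) → I.Dom j} [IsVar e] [IsVar e']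

theorem seqDom (hX : I.DefinableSeq X) : I.Definable n fun j v => SeqDom (X j) (e j v) :=
  hX.1 n e

theorem seqEntry (hX : I.DefinableSeq X) :
    I.Definable n fun j v => SeqEntry (X j) (e j v) (e' j v) :=
  hX.2 n e e'

theorem seqLast (hX : I.DefinableSeq X) : I.Definable n fun j v => SeqLast (X j) (e j v) :=
  hX.seqDom.and (.all (hX.seqDom.imp (.not .mem)))

end

theorem eq_nil (hX : I.DefinableSeq X) : I.Definable n fun j _ => X j = [] :=
  (Definable.all (.not hX.seqDom)).congr fun j _ =>
    (forall_not_seqDom_iff (I.isSuccLimit j) (X j)).symm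

theorem getLastD (hX : I.DefinableSeq X) (hA : I.DefinableSet A) :
    I.DefinableSet fun j => (X j).getLastD (A j) := fun _ _ _ =>
  .congr (.or (.ex (hX.seqLast.and hX.seqEntry)) (.and (.all (.not hX.seqDom)) hA.mem))
    fun j _ => mem_getLastD_iff (I.isSuccLimit j) (X j) (A j)

theorem dropLast_getLastD (hX : I.DefinableSeq X) (hA : I.DefinableSet A) :
    I.DefinableSet fun j => (X j).dropLast.getLastD (A j) := fun _ _ _ =>
  .congr (.or
      (.ex (hX.seqLast.and (.or
        (.ex (.and (.and .mem (.all (.imp .mem (.not .mem)))) hX.seqEntry))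
        (.and (.all (.not .mem)) hA.mem))))
      (.and (.all (.not hX.seqDom)) hA.mem))
    fun j _ => mem_getLastD_dropLast_iff (I.isSuccLimit j) (X j) (A j)

end DefinableSeq

end SetModels

/-! ### Reflection of games from `Π¹_γ`-indescribability -/

section Indescribability

open FirstOrder SetModels

/-- An index of a structure for the matrices of games. -/
structure GameIndex : Type (u + 1) where
  ord : Ordinal.{u}
  isSuccLimit : Order.IsSuccLimit ord
  X : List (Set (VDom ord))
  Y : List (Set (VDom ord))
  A : Set (VDom ord)

/-- The structures in which the matrices of games are evaluated. -/
def gameModels : SetModels.{u} where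
  L := gameLang
  J := GameIndex.{u}
  ord := GameIndex.ord
  isSuccLimit := GameIndex.isSuccLimit
  str j := gameStructure j.ord j.X j.Y j.A
  memRel := GameRel.mem
  memRel_iff _ _ _ := Iff.rfl

theorem definableSet_gameIndex_A : gameModels.{u}.DefinableSet GameIndex.A := fun _ _ _ =>
  Definable.rel₁ (I := gameModels.{u}) GameRel.par

theorem definableSeq_gameIndex_X : gameModels.{u}.DefinableSeq GameIndex.X :=
  ⟨fun _ _ _ => Definable.rel₁ (I := gameModels.{u}) GameRel.domX,
    fun _ _ _ _ _ => Definable.rel₂ (I := gameModels.{u}) GameRel.entryX⟩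

theorem definableSeq_gameIndex_Y : gameModels.{u}.DefinableSeq GameIndex.Y :=
  ⟨fun _ _ _ => Definable.rel₁ (I := gameModels.{u}) GameRel.domY,
    fun _ _ _ _ _ => Definable.rel₂ (I := gameModels.{u}) GameRel.entryY⟩

theorem exists_matrixHolds_iff_exists {P : GameIndex.{u} → Prop}
    (hP : gameModels.{u}.Definable 0 fun j _ => P j) :
    ∃ φ : gameLang.Sentence, ∀ α A X Y, MatrixHolds α φ A X Y ↔
      ∃ hα : Order.IsSuccLimit α, P ⟨α, hα, X, Y, A⟩ := by
  obtain ⟨φ, hφ⟩ := hP.exists_sentence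
  refine ⟨limSentence (L := gameLang) GameRel.mem ⊓ φ, fun α A X Y => ?_⟩
  refine (realize_limSentence_inf (L := gameLang) GameRel.mem (gameStructure α X Y A)
    (fun _ _ => Iff.rfl) φ).trans ?_
  rw [← exists_prop]
  exact exists_congr fun hα => hφ ⟨α, hα, X, Y, A⟩

theorem exists_matrixHolds_iff_forall {P : GameIndex.{u} → Prop}
    (hP : gameModels.{u}.Definable 0 fun j _ => P j) :
    ∃ φ : gameLang.Sentence, ∀ α A X Y, MatrixHolds α φ A X Y ↔
      ∀ hα : Order.IsSuccLimit α, P ⟨α, hα, X, Y, A⟩ := by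
  obtain ⟨φ, hφ⟩ := exists_matrixHolds_iff_exists hP.not
  refine ⟨φ.not, fun α A X Y => ?_⟩
  have hnot : MatrixHolds α φ.not A X Y ↔ ¬ MatrixHolds α φ A X Y :=
    let _ := gameStructure α X Y A
    Language.Formula.realize_not
  rw [hnot, hφ, not_exists]
  exact forall_congr' fun _ => not_not

namespace SetGame

variable {κ γ α : Ordinal.{u}} (g : SetGame κ γ)

/-- The last entry of a sequence of played sets, or the initial position of the game if nothing has
been played. -/
def last (X : List (Set (VDom α))) : Set (VDom α) := X.getLastD (g.start α)

@[simp]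
theorem last_concat (X : List (Set (VDom α))) (Z : Set (VDom α)) : g.last (X ++ [Z]) = Z :=
  List.getLastD_concat

variable {g} {φ : gameLang.Sentence}

theorem IsBoard.piWinsEven_of_good (hb : g.IsBoard α)
    (hφ : ∀ X Y, (g.Step (g.last Y.dropLast) (g.last X) → g.Step (g.last X) (g.last Y)) →
      MatrixHolds α φ (g.start α) X Y) (δ : Ordinal.{u}) :
    ∀ X Y, g.rank α (g.last Y) ≤ γ → g.good α (g.last Y) →
      PiWinsEven α φ (g.start α) δ X Y := by
  induction δ using WellFoundedLT.induction with
  | ind δ ih =>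
  intro X Y hrank hgood
  rw [PiWinsEven]
  intro ε hε _ Z
  by_cases hZ : g.Step (g.last Y) Z
  · have hrankZ := ((g.rank_lt _ _ _ hZ).trans_le hrank).le
    obtain ⟨W, hW, hgoodW⟩ := hb.exists_step_good hrankZ (hb.not_good_of_step hrank hgood hZ)
    refine ⟨W, hφ _ _ ?_, ih ε hε _ _ ?_ ?_⟩
    · simpa only [last_concat] using fun _ => hW
    · simpa only [last_concat] using ((g.rank_lt _ _ _ hW).trans_le hrankZ).le
    · simpa only [last_concat] using hgoodW
  · refine ⟨∅, hφ _ _ ?_, ih ε hε _ _ ?_ ?_⟩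
    · simpa only [last_concat, List.dropLast_concat] using fun hstep => absurd hstep hZ
    · simp only [last_concat, g.rank_empty, zero_le]
    · simpa only [last_concat] using hb.good_empty

theorem IsBoard.not_piWinsEven_of_not_good (hb : g.IsBoard α)
    (hφ : ∀ X Y, MatrixHolds α φ (g.start α) X Y →
      g.Step (g.last Y.dropLast) (g.last X) → g.Step (g.last X) (g.last Y)) (δ : Ordinal.{u}) :
    ∀ X Y, g.rank α (g.last Y) ≤ γ →
      (∀ η < g.rank α (g.last Y), ∃ ε, IsOddOrdinal ε ∧ η ≤ ε ∧ ε < δ) →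
      ¬ g.good α (g.last Y) → ¬ PiWinsEven α φ (g.start α) δ X Y := by
  induction δ using WellFoundedLT.induction with
  | ind δ ih =>
  intro X Y hrank hδ hbad hwin
  obtain ⟨Z, hZ, hgoodZ⟩ := hb.exists_step_good hrank hbad
  have hrankZ := g.rank_lt _ _ _ hZ
  obtain ⟨ε, hodd, hZε, hεδ⟩ := hδ _ hrankZ
  rw [PiWinsEven] at hwin
  obtain ⟨W, hmatrix, hwinW⟩ := hwin ε hεδ hodd Z
  have hW : g.Step Z W := by
    simpa only [last_concat, List.dropLast_concat, hZ, true_imp_iff] using hφ _ _ hmatrix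
  have hrankW := g.rank_lt _ _ _ hW
  refine ih ε hεδ _ _ ?_ ?_ ?_ hwinW <;> simp only [last_concat]
  · exact (hrankW.trans (hrankZ.trans_le hrank)).le
  · intro η hη
    obtain ⟨ε', hodd', hηε', hε'η⟩ := exists_isOddOrdinal η
    exact ⟨ε', hodd', hηε',
      (hε'η.trans (Order.add_one_le_iff.2 hη)).trans_lt (hrankW.trans_le hZε)⟩
  · exact hb.not_good_of_step (hrankZ.le.trans hrank) hgoodZ hW

theorem IsBoard.piWinsOdd_of_good (hb : g.IsBoard α)
    (hφ : ∀ X Y, MatrixHolds α φ (g.start α) X Y →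
      (X = [] ∨ g.Step (g.last Y.dropLast) (g.last X)) → g.Step (g.last X) (g.last Y))
    (δ : Ordinal.{u}) :
    ∀ X Y, g.rank α (g.last X) ≤ γ → g.rank α (g.last X) ≤ δ →
      (X = [] ∨ g.Step (g.last Y) (g.last X)) → g.good α (g.last X) →
      PiWinsOdd α φ (g.start α) δ X Y := by
  induction δ using WellFoundedLT.induction with
  | ind δ ih =>
  intro X Y hrank hδ hlegal hgood
  rw [PiWinsOdd]
  intro W hmatrix
  have hW : g.Step (g.last X) W := by
    simpa only [last_concat, List.dropLast_concat, hlegal, true_imp_iff] using hφ _ _ hmatrix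
  have hrankW := g.rank_lt _ _ _ hW
  obtain ⟨Z, hZ, hgoodZ⟩ := hb.exists_step_good (hrankW.le.trans hrank)
    (hb.not_good_of_step hrank hgood hW)
  have hrankZ := g.rank_lt _ _ _ hZ
  obtain ⟨ε, hodd, hZε, hεZ⟩ := exists_isOddOrdinal (g.rank α Z)
  have hεδ : ε < δ := (hεZ.trans (Order.add_one_le_iff.2 hrankZ)).trans_lt (hrankW.trans_le hδ)
  refine ⟨ε, hεδ, hodd, Z, ih ε hεδ _ _ ?_ ?_ ?_ ?_⟩ <;> simp only [last_concat]
  · exact (hrankZ.trans (hrankW.trans_le hrank)).le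
  · exact hZε
  · exact Or.inr hZ
  · exact hgoodZ

theorem IsBoard.not_piWinsOdd_of_not_good (hb : g.IsBoard α)
    (hφ : ∀ X Y, ((X = [] ∨ g.Step (g.last Y.dropLast) (g.last X)) →
      g.Step (g.last X) (g.last Y)) → MatrixHolds α φ (g.start α) X Y) (δ : Ordinal.{u}) :
    ∀ X Y, ((X ≠ [] ∧ ¬ g.Step (g.last Y) (g.last X)) ∨
      (g.rank α (g.last X) ≤ γ ∧ ¬ g.good α (g.last X))) →
      ¬ PiWinsOdd α φ (g.start α) δ X Y := by
  induction δ using WellFoundedLT.induction with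
  | ind δ ih =>
  intro X Y hlost hwin
  rw [PiWinsOdd] at hwin
  rcases hlost with ⟨hX, hillegal⟩ | ⟨hrank, hbad⟩
  · have hmatrix : MatrixHolds α φ (g.start α) X (Y ++ [∅]) := hφ _ _ (by
      simpa only [List.dropLast_concat] using fun h => (h.elim hX hillegal).elim)
    obtain ⟨ε, hε, -, Z, hwinZ⟩ := hwin ∅ hmatrix
    refine ih ε hε _ _ (Or.inl ⟨by simp, ?_⟩) hwinZ
    simpa only [last_concat] using g.not_move_empty α Z
  · obtain ⟨W, hW, hgoodW⟩ := hb.exists_step_good hrank hbad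
    have hmatrix : MatrixHolds α φ (g.start α) X (Y ++ [W]) := hφ _ _ (by
      simpa only [last_concat] using fun _ => hW)
    obtain ⟨ε, hε, -, Z, hwinZ⟩ := hwin W hmatrix
    have hrankW := (g.rank_lt _ _ _ hW).le.trans hrank
    refine ih ε hε _ _ ?_ hwinZ
    simp only [last_concat]
    by_cases hZ : g.Step W Z
    · exact Or.inr ⟨(g.rank_lt _ _ _ hZ).le.trans hrankW, hb.not_good_of_step hrankW hgoodW hZ⟩
    · exact Or.inl ⟨by simp, hZ⟩

theorem not_piWinsOdd_of_forall_matrixHolds {A : Set (VDom α)}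
    (hφ : ∀ X Y, MatrixHolds α φ A X Y) (δ : Ordinal.{u}) : ∀ X Y, ¬ PiWinsOdd α φ A δ X Y := by
  induction δ using WellFoundedLT.induction with
  | ind δ ih =>
  intro X Y hwin
  rw [PiWinsOdd] at hwin
  obtain ⟨ε, hε, -, Z, hwinZ⟩ := hwin ∅ (hφ _ _)
  exact ih ε hε _ _ hwinZ

variable (g)

/-- In the odd game the matrix restricts the moves of `Σ`. It is vacuously true where `α` is not
a limit ordinal or the side condition fails, so that `Σ` never gets stuck there. -/
theorem exists_piWinsOdd_iff :
    ∃ φ, ∀ α ≤ κ, PiWinsOdd α φ (g.start α) γ [] [] ↔ g.Holds α := by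
  have hA := definableSet_gameIndex_A.{u}
  have hX := definableSeq_gameIndex_X.{u}
  have hY := definableSeq_gameIndex_Y.{u}
  obtain ⟨φ, hφ⟩ := exists_matrixHolds_iff_forall (P := fun j => g.side j.ord j.A →
      (j.X = [] ∨ g.move j.ord j.A (j.Y.dropLast.getLastD j.A) (j.X.getLastD j.A)) →
      g.move j.ord j.A (j.X.getLastD j.A) (j.Y.getLastD j.A))
    ((g.side_def _ _ hA).imp
      ((hX.eq_nil.or (g.move_def _ _ _ _ hA (hY.dropLast_getLastD hA) (hX.getLastD hA))).imp
        (g.move_def _ _ _ _ hA (hX.getLastD hA) (hY.getLastD hA))))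
  refine ⟨φ, fun α hακ => ⟨fun hwin => ?_, fun ⟨hα, hside, hgood⟩ => ?_⟩⟩
  · have hα : Order.IsSuccLimit α := by
      by_contra hα
      exact not_piWinsOdd_of_forall_matrixHolds
        (fun _ _ => (hφ _ _ _ _).2 fun h => absurd h hα) _ _ _ hwin
    have hside : g.side α (g.start α) := by
      by_contra hside
      exact not_piWinsOdd_of_forall_matrixHolds
        (fun _ _ => (hφ _ _ _ _).2 fun _ h => absurd h hside) _ _ _ hwin
    have hb : g.IsBoard α := ⟨hακ, hα, hside⟩
    refine ⟨hα, hside, by_contra fun hbad => ?_⟩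
    exact hb.not_piWinsOdd_of_not_good (fun _ _ h => (hφ _ _ _ _).2 fun _ _ => h) γ [] []
      (Or.inr ⟨hb.rank_start_le, hbad⟩) hwin
  · have hb : g.IsBoard α := ⟨hακ, hα, hside⟩
    exact hb.piWinsOdd_of_good (fun _ _ h => (hφ _ _ _ _).1 h hα hside) γ [] []
      hb.rank_start_le hb.rank_start_le (Or.inl rfl) hgood

theorem exists_piWinsEven_iff (hγ : 1 ≤ γ) (heven : ¬ IsOddOrdinal γ) :
    ∃ φ, ∀ α ≤ κ, PiWinsEven α φ (g.start α) γ [] [] ↔ g.Holds α := by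
  have hA := definableSet_gameIndex_A.{u}
  have hX := definableSeq_gameIndex_X.{u}
  have hY := definableSeq_gameIndex_Y.{u}
  obtain ⟨φ, hφ⟩ := exists_matrixHolds_iff_exists (P := fun j => g.side j.ord j.A ∧
      (g.move j.ord j.A (j.Y.dropLast.getLastD j.A) (j.X.getLastD j.A) →
      g.move j.ord j.A (j.X.getLastD j.A) (j.Y.getLastD j.A)))
    ((g.side_def _ _ hA).and
      ((g.move_def _ _ _ _ hA (hY.dropLast_getLastD hA) (hX.getLastD hA)).imp
        (g.move_def _ _ _ _ hA (hX.getLastD hA) (hY.getLastD hA))))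
  have hlt {ε : Ordinal.{u}} (hodd : IsOddOrdinal ε) (hε : ε ≤ γ) : ε < γ :=
    lt_of_le_of_ne hε fun h => heven (h ▸ hodd)
  refine ⟨φ, fun α hακ => ⟨fun hwin => ?_, fun ⟨hα, hside, hgood⟩ => ?_⟩⟩
  · obtain ⟨hα, hside⟩ : ∃ _ : Order.IsSuccLimit α, g.side α (g.start α) := by
      have hanswer := hwin
      rw [PiWinsEven] at hanswer
      obtain ⟨W, hmatrix, -⟩ := hanswer 1 (hlt isOddOrdinal_one hγ) isOddOrdinal_one ∅
      obtain ⟨hα, hside, -⟩ := (hφ _ _ _ _).1 hmatrix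
      exact ⟨hα, hside⟩
    have hb : g.IsBoard α := ⟨hακ, hα, hside⟩
    refine ⟨hα, hside, by_contra fun hbad => ?_⟩
    refine hb.not_piWinsEven_of_not_good (fun _ _ h => ((hφ _ _ _ _).1 h).elim fun _ h => h.2)
      γ [] [] hb.rank_start_le (fun η hη => ?_) hbad hwin
    obtain ⟨ε, hodd, hηε, hεη⟩ := exists_isOddOrdinal η
    exact ⟨ε, hodd, hηε,
      hlt hodd (hεη.trans (Order.add_one_le_iff.2 (hη.trans_le hb.rank_start_le)))⟩
  · have hb : g.IsBoard α := ⟨hακ, hα, hside⟩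
    exact hb.piWinsEven_of_good (fun _ _ h => (hφ _ _ _ _).2 ⟨hα, hside, h⟩) γ [] []
      hb.rank_start_le hgood

theorem exists_piWins_iff (hγ : 1 ≤ γ) :
    ∃ φ, ∀ α ≤ κ, PiWins γ α φ (g.start α) ↔ g.Holds α := by
  by_cases hodd : IsOddOrdinal γ
  · simpa [PiWins, hodd] using g.exists_piWinsOdd_iff
  · simpa [PiWins, hodd] using g.exists_piWinsEven_iff hγ hodd

end SetGame

theorem IsIndescribable.reflectsGames {γ : Ordinal.{u}} {κ : Cardinal.{u}}
    (hκ : IsIndescribable γ κ) (hγ : 1 ≤ γ) : ReflectsGames γ κ.ord := by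
  intro g hg
  obtain ⟨φ, hφ⟩ := g.exists_piWins_iff hγ
  obtain ⟨α, hα, hwin⟩ := hκ φ g.R g.R_mem ((hφ _ le_rfl).2 hg)
  exact ⟨α, hα, (hφ α hα.le).1 hwin⟩

end Indescribability

/-! ### Reflection of games from second order indescribability -/

section FinIndescribability

open FirstOrder SetModels

/-- An index of a structure for the matrices of second order sentences. -/
structure SecondOrderIndex : Type (u + 1) where
  ord : Ordinal.{u}
  isSuccLimit : Order.IsSuccLimit ord
  R : Set (VDom ord)
  X : List (Set (VDom ord))

/-- The structures in which the matrices of second order sentences are evaluated. -/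
def secondOrderModels : SetModels.{u} where
  L := secondOrderLang
  J := SecondOrderIndex.{u}
  ord := SecondOrderIndex.ord
  isSuccLimit := SecondOrderIndex.isSuccLimit
  str j := secondOrderStructure j.ord j.R j.X
  memRel := SecondOrderRel.mem
  memRel_iff _ _ _ := Iff.rfl

section Plays

variable {α : Ordinal.{u}}

/-- The position after `k` moves of the play `X` that starts from `R`. -/
def position (R : Set (VDom α)) (X : List (Set (VDom α))) : ℕ → Set (VDom α)
  | 0 => R
  | k + 1 => X.getD k ∅

/-- `Π` wins the play `X` at one of the first `k` moves because `Σ` is the first to violate the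
relation `M` of legal moves, or nobody violates it there and `p` holds. The moves with even number
are those of `Σ`. -/
def PlayWon (M : Set (VDom α) → Set (VDom α) → Prop) (R : Set (VDom α))
    (X : List (Set (VDom α))) : ℕ → Prop → Prop
  | 0, p => p
  | k + 1, p => PlayWon M R X k
      ((Even k → M (position R X k) (position R X (k + 1)) → p) ∧
        (¬ Even k → M (position R X k) (position R X (k + 1)) ∧ p))

variable {M : Set (VDom α) → Set (VDom α) → Prop} {R : Set (VDom α)} {X : List (Set (VDom α))}
  {k : ℕ}

theorem position_concat (Z : Set (VDom α)) (hk : k ≤ X.length) :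
    position R (X ++ [Z]) k = position R X k := by
  cases k with
  | zero => rfl
  | succ k => simp [position, List.getElem?_append_left (show k < X.length by omega)]

theorem position_concat_length (Z : Set (VDom α)) :
    position R (X ++ [Z]) (X.length + 1) = Z := by
  simp [position]

theorem playWon_concat (Z : Set (VDom α)) (hk : k ≤ X.length) (p : Prop) :
    PlayWon M R (X ++ [Z]) k p ↔ PlayWon M R X k p := by
  induction k generalizing p with
  | zero => rfl
  | succ k ih =>
    rw [PlayWon, PlayWon, ih (by omega), position_concat Z hk, position_concat Z (by omega)]

theorem playWon_congr {p q : Prop}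
    (hpq : (∀ i < k, M (position R X i) (position R X (i + 1))) → (p ↔ q)) :
    PlayWon M R X k p ↔ PlayWon M R X k q := by
  induction k generalizing p q with
  | zero => exact hpq (by simp)
  | succ k ih =>
    rw [PlayWon, PlayWon]
    refine ih fun hlegal => ?_
    by_cases hM : M (position R X k) (position R X (k + 1))
    · rw [hpq fun i hi => ?_]
      rcases Nat.lt_succ_iff_lt_or_eq.1 hi with hi | rfl
      · exact hlegal i hi
      · exact hM
    · simp [hM]

theorem playWon_forall {ι : Type*} [Nonempty ι] {p : ι → Prop} :
    (∀ z, PlayWon M R X k (p z)) ↔ PlayWon M R X k (∀ z, p z) := by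
  induction k generalizing p with
  | zero => rfl
  | succ k ih =>
    simp only [PlayWon]
    rw [ih]
    refine playWon_congr fun _ => ?_
    by_cases hk : Even k <;> by_cases hM : M (position R X k) (position R X (k + 1)) <;>
      simp [hk, hM]

theorem playWon_exists {ι : Type*} [Nonempty ι] {p : ι → Prop} :
    (∃ z, PlayWon M R X k (p z)) ↔ PlayWon M R X k (∃ z, p z) := by
  induction k generalizing p with
  | zero => rfl
  | succ k ih =>
    simp only [PlayWon]
    rw [ih]
    refine playWon_congr fun _ => ?_
    by_cases hk : Even k <;> by_cases hM : M (position R X k) (position R X (k + 1)) <;>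
      simp [hk, hM]

end Plays

theorem definableSet_secondOrderIndex_R : secondOrderModels.{u}.DefinableSet SecondOrderIndex.R :=
  fun _ _ _ => Definable.rel₁ (I := secondOrderModels.{u}) SecondOrderRel.par

theorem definableSet_position (k : ℕ) :
    secondOrderModels.{u}.DefinableSet fun j : SecondOrderIndex.{u} => position j.R j.X k := by
  cases k with
  | zero => exact definableSet_secondOrderIndex_R
  | succ k => exact fun _ _ _ =>
      Definable.rel₁ (I := secondOrderModels.{u}) (SecondOrderRel.var k)

theorem exists_altHolds_zero_iff {P : SecondOrderIndex.{u} → Prop}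
    (hP : secondOrderModels.{u}.Definable 0 fun j _ => P j) :
    ∃ ψ : secondOrderLang.Sentence, ∀ α R X b, AltHolds α ψ R 0 b X ↔
      ∃ hα : Order.IsSuccLimit α, P ⟨α, hα, R, X⟩ := by
  obtain ⟨φ, hφ⟩ := hP.exists_sentence
  refine ⟨limSentence (L := secondOrderLang) SecondOrderRel.mem ⊓ φ, fun α R X _ => ?_⟩
  refine (realize_limSentence_inf (L := secondOrderLang) SecondOrderRel.mem
    (secondOrderStructure α R X) (fun _ _ => Iff.rfl) φ).trans ?_
  rw [← exists_prop]
  exact exists_congr fun hα => hφ ⟨α, hα, R, X⟩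

theorem AltHolds.exists_zero {α : Ordinal.{u}} {ψ : secondOrderLang.Sentence} {R : Set (VDom α)}
    {n : ℕ} {b : Bool} {X : List (Set (VDom α))} (h : AltHolds α ψ R n b X) :
    ∃ X' b', AltHolds α ψ R 0 b' X' := by
  induction n generalizing b X with
  | zero => exact ⟨X, b, h⟩
  | succ n ih =>
    cases b with
    | true => exact ih (h ∅)
    | false =>
      obtain ⟨Z, hZ⟩ := h
      exact ih hZ

namespace SetGame

theorem definable_playWon {κ γ : Ordinal.{u}} (g : SetGame κ γ) (k : ℕ)
    {p : SecondOrderIndex.{u} → Prop}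
    (hp : secondOrderModels.{u}.Definable 0 fun j _ => p j) :
    secondOrderModels.{u}.Definable 0 fun (j : SecondOrderIndex.{u}) _ =>
      PlayWon (g.move j.ord j.R) j.R j.X k (p j) := by
  induction k generalizing p with
  | zero => exact hp
  | succ k ih =>
    have hmove : secondOrderModels.{u}.Definable 0 fun (j : SecondOrderIndex.{u}) _ =>
        g.move j.ord j.R (position j.R j.X k) (position j.R j.X (k + 1)) :=
      g.move_def _ _ _ _ definableSet_secondOrderIndex_R (definableSet_position k)
        (definableSet_position (k + 1))
    exact ih (((Definable.const _).imp (hmove.imp hp)).and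
      ((Definable.const _).imp (hmove.and hp)))

variable {κ α : Ordinal.{u}} {n m : ℕ} (g : SetGame κ n) {X : List (Set (VDom α))}

/-- `Π` has won the play `X`, or nobody has lost it yet and `Π` wins from the position reached. -/
def WonFrom (X : List (Set (VDom α))) : Prop :=
  PlayWon g.Step (g.start α) X X.length
    (Even X.length ↔ g.good α (position (g.start α) X X.length))

theorem wonFrom_nil : g.WonFrom (α := α) [] ↔ g.good α (g.start α) := by
  simp [WonFrom, PlayWon, position]

variable {g}

theorem wonFrom_concat_of_even (hX : Even X.length) (Z : Set (VDom α)) :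
    g.WonFrom (X ++ [Z]) ↔ PlayWon g.Step (g.start α) X X.length
      (g.Step (position (g.start α) X X.length) Z → ¬ g.good α Z) := by
  rw [WonFrom, List.length_append, List.length_singleton, PlayWon, playWon_concat Z le_rfl,
    position_concat_length, position_concat Z le_rfl]
  exact playWon_congr fun _ => by simp [hX, parity_simps]

theorem wonFrom_concat_of_not_even (hX : ¬ Even X.length) (Z : Set (VDom α)) :
    g.WonFrom (X ++ [Z]) ↔ PlayWon g.Step (g.start α) X X.length
      (g.Step (position (g.start α) X X.length) Z ∧ g.good α Z) := by
  rw [WonFrom, List.length_append, List.length_singleton, PlayWon, playWon_concat Z le_rfl,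
    position_concat_length, position_concat Z le_rfl]
  exact playWon_congr fun _ => by simp [hX, parity_simps]

namespace IsBoard

variable (hb : g.IsBoard α)
include hb

theorem rank_position_le {k : ℕ} (hkm : k + m = n)
    (hlegal : ∀ i < k, g.Step (position (g.start α) X i) (position (g.start α) X (i + 1))) :
    g.rank α (position (g.start α) X k) ≤ m := by
  induction k generalizing m with
  | zero =>
    obtain rfl : m = n := by omega
    exact hb.rank_start_le
  | succ k ih =>
    have hrank := (g.rank_lt _ _ _ (hlegal k (by omega))).trans_le
      (ih (m := m + 1) (by omega) fun i hi => hlegal i (by omega))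
    rwa [Nat.cast_add, Nat.cast_one, Order.lt_add_one_iff] at hrank

theorem good_position_iff (hX : X.length ≤ n)
    (hlegal : ∀ i < X.length,
      g.Step (position (g.start α) X i) (position (g.start α) X (i + 1))) :
    g.good α (position (g.start α) X X.length) ↔
      ∀ W, g.Step (position (g.start α) X X.length) W → ¬ g.good α W :=
  hb.good_iff ((hb.rank_position_le (Nat.add_sub_of_le hX) hlegal).trans
    (Nat.cast_le.2 (Nat.sub_le _ _)))

theorem wonFrom_iff_of_length_eq (hX : X.length = n) :
    g.WonFrom X ↔ PlayWon g.Step (g.start α) X n (Even n) := by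
  rw [WonFrom, hX]
  refine playWon_congr fun hlegal => ?_
  have hrank := hb.rank_position_le (m := 0) (add_zero n) hlegal
  have hgood : g.good α (position (g.start α) X n) :=
    (hb.good_iff (hrank.trans (by simp))).2 fun W hW =>
      absurd ((g.rank_lt _ _ _ hW).trans_le hrank) (by simp)
  simp only [hgood, iff_true]

theorem forall_wonFrom_concat (hX : X.length ≤ n) (heven : Even X.length) :
    (∀ Z, g.WonFrom (X ++ [Z])) ↔ g.WonFrom X := by
  rw [forall_congr' (wonFrom_concat_of_even heven), playWon_forall]
  refine playWon_congr fun hlegal => ?_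
  rw [← hb.good_position_iff hX hlegal]
  simp only [heven, true_iff]

theorem exists_wonFrom_concat (hX : X.length ≤ n) (hodd : ¬ Even X.length) :
    (∃ Z, g.WonFrom (X ++ [Z])) ↔ g.WonFrom X := by
  rw [exists_congr (wonFrom_concat_of_not_even hodd), playWon_exists]
  refine playWon_congr fun hlegal => ?_
  rw [hb.good_position_iff hX hlegal]
  simp [hodd]

theorem altHolds_iff {ψ : secondOrderLang.Sentence}
    (hψ : ∀ X b, AltHolds α ψ (g.start α) 0 b X ↔ PlayWon g.Step (g.start α) X n (Even n))
    {b : Bool} (hX : X.length + m = n) (hbX : b = true ↔ Even X.length) :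
    AltHolds α ψ (g.start α) m b X ↔ g.WonFrom X := by
  induction m generalizing b X with
  | zero => rw [hψ, hb.wonFrom_iff_of_length_eq hX]
  | succ m ih =>
    have hXZ (Z : Set (VDom α)) : (X ++ [Z]).length + m = n := by
      rw [List.length_append, List.length_singleton]
      omega
    cases b with
    | true =>
      have heven := hbX.1 rfl
      rw [← hb.forall_wonFrom_concat (by omega) heven]
      exact forall_congr' fun Z => ih (hXZ Z) (by simp [heven, parity_simps])
    | false =>
      have hodd : ¬ Even X.length := fun heven => Bool.false_ne_true (hbX.2 heven)
      rw [← hb.exists_wonFrom_concat (by omega) hodd]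
      exact exists_congr fun Z => ih (hXZ Z) (by simpa [parity_simps] using hodd)

end IsBoard

variable (g)

theorem exists_altHolds_iff :
    ∃ ψ, ∀ α ≤ κ, AltHolds α ψ (g.start α) n true [] ↔ g.Holds α := by
  obtain ⟨ψ, hψ⟩ := exists_altHolds_zero_iff (P := fun j => g.side j.ord j.R ∧
      PlayWon (g.move j.ord j.R) j.R j.X n (Even n))
    ((g.side_def _ _ definableSet_secondOrderIndex_R).and
      (g.definable_playWon n (Definable.const _)))
  have altHolds_iff_good {α : Ordinal.{u}} (hb : g.IsBoard α) :
      AltHolds α ψ (g.start α) n true [] ↔ g.good α (g.start α) := by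
    rw [hb.altHolds_iff (fun X b => ?_) (by simp) (by simp), g.wonFrom_nil]
    rw [hψ]
    exact ⟨fun ⟨_, _, hwon⟩ => hwon, fun hwon => ⟨hb.isSuccLimit, hb.side, hwon⟩⟩
  refine ⟨ψ, fun α hακ => ⟨fun halt => ?_, fun ⟨hα, hside, hgood⟩ => ?_⟩⟩
  · obtain ⟨X, b, hmatrix⟩ := halt.exists_zero
    obtain ⟨hα, hside, -⟩ := (hψ _ _ _ _).1 hmatrix
    exact ⟨hα, hside, (altHolds_iff_good ⟨hακ, hα, hside⟩).1 halt⟩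
  · exact (altHolds_iff_good ⟨hακ, hα, hside⟩).2 hgood

end SetGame

theorem IsFinIndescribable.reflectsGames {n : ℕ} {κ : Cardinal.{u}}
    (hκ : IsFinIndescribable n κ) : ReflectsGames n κ.ord := by
  intro g hg
  obtain ⟨ψ, hψ⟩ := g.exists_altHolds_iff
  obtain ⟨α, hα, halt⟩ := hκ.2 ψ g.R g.R_mem ((hψ _ le_rfl).2 hg)
  exact ⟨α, hα, (hψ α hα.le).1 halt⟩

end FinIndescribability

/-! ### The branch property from reflection of games -/

section Coding

variable {S : Set Ordinal.{u}} {β ξ : Ordinal.{u}}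

/-- The set of the elements of `S` below `β`, as a set of von Neumann ordinals. -/
noncomputable def segmentCode (S : Set Ordinal.{u}) (β : Ordinal.{u}) : ZFSet.{u} :=
  ZFSet.sep (fun x => ∃ ξ ∈ S, x = ξ.toZFSet) β.toZFSet

theorem toZFSet_mem_segmentCode : ξ.toZFSet ∈ segmentCode S β ↔ ξ < β ∧ ξ ∈ S := by
  rw [segmentCode, ZFSet.mem_sep, Ordinal.toZFSet_mem_toZFSet_iff]
  refine and_congr_right fun _ => ⟨?_, fun hξ => ⟨ξ, hξ, rfl⟩⟩
  rintro ⟨ζ, hζ, heq⟩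
  rwa [Ordinal.toZFSet_injective heq]

theorem segmentCode_subset : segmentCode S β ⊆ β.toZFSet :=
  fun _ hx => (ZFSet.mem_sep.1 hx).1

theorem rank_segmentCode_le : (segmentCode S β).rank ≤ β := by
  simpa using ZFSet.rank_mono (segmentCode_subset (S := S))

theorem not_isOrdinal_pair (x y : ZFSet.{u}) : ¬ (ZFSet.pair x y).IsOrdinal := by
  intro hord
  have hx : x ∈ ZFSet.pair x y :=
    hord.mem_trans (ZFSet.mem_singleton.2 rfl) (by simp [ZFSet.pair])
  have hne (z : ZFSet.{u}) (hz : x ∈ z) : x ≠ z := fun hxz =>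
    ZFSet.mem_irrefl x (by rwa [← hxz] at hz)
  have hcases : x = {x} ∨ x = {x, y} := by simpa [ZFSet.pair] using hx
  exact hcases.elim (hne _ (by simp)) (hne _ (by simp))

theorem pair_ne_empty (x y : ZFSet.{u}) : ZFSet.pair x y ≠ ∅ := fun hxy =>
  not_isOrdinal_pair x y (hxy ▸ ZFSet.isOrdinal_empty)

variable {α : Ordinal.{u}} {x : VDom α} (hβ : β < α) (hξ : ξ < α)

/-- The ordinal `ξ` as an element of `V_α`. -/
noncomputable def VDom.ofOrd : VDom α :=
  ⟨ξ.toZFSet, by rwa [ZFSet.mem_vonNeumann, Ordinal.rank_toZFSet]⟩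

theorem VDom.rank_ofOrd : (VDom.ofOrd hξ).1.rank = ξ := Ordinal.rank_toZFSet ξ

theorem VDom.exists_eq_ofOrd (hx : x.1.IsOrdinal) : ∃ ξ, ∃ hξ : ξ < α, x = VDom.ofOrd hξ :=
  ⟨x.1.rank, ZFSet.mem_vonNeumann.1 x.2, Subtype.ext hx.toZFSet_rank_eq.symm⟩

theorem VDom.isOrdinal_ofOrd : (VDom.ofOrd hξ).1.IsOrdinal := ZFSet.isOrdinal_toZFSet ξ

theorem VDom.forall_isOrdinal {P : VDom α → Prop} :
    (∀ x : VDom α, x.1.IsOrdinal → P x) ↔ ∀ ξ, ∀ hξ : ξ < α, P (VDom.ofOrd hξ) := by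
  constructor
  · exact fun h ξ hξ => h _ (VDom.isOrdinal_ofOrd hξ)
  · intro h x hx
    obtain ⟨ξ, hξ, rfl⟩ := VDom.exists_eq_ofOrd hx
    exact h ξ hξ

theorem VDom.exists_isOrdinal {P : VDom α → Prop} :
    (∃ x : VDom α, x.1.IsOrdinal ∧ P x) ↔ ∃ ξ, ∃ hξ : ξ < α, P (VDom.ofOrd hξ) := by
  constructor
  · rintro ⟨x, hx, hP⟩
    obtain ⟨ξ, hξ, rfl⟩ := VDom.exists_eq_ofOrd hx
    exact ⟨ξ, hξ, hP⟩
  · rintro ⟨ξ, hξ, hP⟩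
    exact ⟨_, VDom.isOrdinal_ofOrd hξ, hP⟩

theorem VDom.ofOrd_mem_ofOrd : (VDom.ofOrd hξ).1 ∈ (VDom.ofOrd hβ).1 ↔ ξ < β :=
  Ordinal.toZFSet_mem_toZFSet_iff

theorem VDom.mem_ofOrd_iff :
    x.1 ∈ (VDom.ofOrd hβ).1 ↔ ∃ ξ, ∃ hξ : ξ < β, x = VDom.ofOrd (hξ.trans hβ) := by
  constructor
  · intro hx
    obtain ⟨ξ, hξ, heq⟩ := Ordinal.mem_toZFSet_iff.1 hx
    exact ⟨ξ, hξ, Subtype.ext heq.symm⟩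
  · rintro ⟨ξ, hξ, rfl⟩
    exact (VDom.ofOrd_mem_ofOrd _ _).2 hξ

/-- The initial segment of `S` below `β < α` as an element of `V_α`. -/
noncomputable def VDom.segment (S : Set Ordinal.{u}) (hβ : β < α) : VDom α :=
  ⟨segmentCode S β, ZFSet.mem_vonNeumann.2 (rank_segmentCode_le.trans_lt hβ)⟩

theorem VDom.mem_segment_iff :
    x.1 ∈ (VDom.segment S hβ).1 ↔ x.1 ∈ (VDom.ofOrd hβ).1 ∧ x.1.rank ∈ S := by
  have hiff (ξ : Ordinal.{u}) (hξ : ξ < β) :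
      (VDom.ofOrd (hξ.trans hβ)).1 ∈ (VDom.segment S hβ).1 ↔ ξ ∈ S :=
    toZFSet_mem_segmentCode.trans (and_iff_right hξ)
  constructor
  · intro hx
    have hxβ : x.1 ∈ (VDom.ofOrd hβ).1 := segmentCode_subset hx
    refine ⟨hxβ, ?_⟩
    obtain ⟨ξ, hξ, rfl⟩ := (VDom.mem_ofOrd_iff hβ).1 hxβ
    rw [VDom.rank_ofOrd]
    exact (hiff ξ hξ).1 hx
  · rintro ⟨hxβ, hxS⟩
    obtain ⟨ξ, hξ, rfl⟩ := (VDom.mem_ofOrd_iff hβ).1 hxβ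
    rw [VDom.rank_ofOrd] at hxS
    exact (hiff ξ hξ).2 hxS

end Coding

section Tree

variable {α : Ordinal.{u}}

/-- The empty set is an element of `U`. In the games below the element `∅` marks the positions in
which the first move is still to be made. -/
def HasEmpty (U : Set (VDom α)) : Prop := ∃ z ∈ U, ∀ y : VDom α, ¬ y.1 ∈ z.1

theorem not_hasEmpty_of_forall_pair {U : Set (VDom α)}
    (hU : ∀ p ∈ U, ∃ x y, p.1 = ZFSet.pair x y) : ¬ HasEmpty U := by
  rintro ⟨p, hp, hempty⟩
  obtain ⟨x, y, hxy⟩ := hU p hp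
  refine pair_ne_empty x y (hxy ▸ (ZFSet.eq_empty _).2 fun z hz => hempty ⟨z, p.mem_trans hz⟩ hz)

theorem SetModels.Definable.hasEmpty {I : SetModels.{u}} {n : ℕ} {U : ∀ j, Set (I.Dom j)}
    (hU : I.DefinableSet U) : I.Definable n fun j _ => HasEmpty (U j) :=
  .ex (hU.mem.and (.all (.not .mem)))

theorem hasEmpty_restrict {A : Set ZFSet.{u}} (hα : Order.IsSuccLimit α) (hA : ∅ ∈ A) :
    HasEmpty (restrict A α) :=
  ⟨⟨∅, by rw [ZFSet.mem_vonNeumann, ZFSet.rank_empty]; exact hα.bot_lt⟩, hA,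
    fun _ => ZFSet.notMem_empty _⟩

/-- The set of ordinals `S`, coded as the set of the pairs `⟨ξ, ξ⟩` with `ξ ∈ S`. -/
def diagonalCode (α : Ordinal.{u}) (S : Set Ordinal.{u}) : Set (VDom α) :=
  {p | ∃ ξ ∈ S, p.1 = ZFSet.pair ξ.toZFSet ξ.toZFSet}

theorem pairMem_diagonalCode (hα : Order.IsSuccLimit α) {S : Set Ordinal.{u}} {ξ : Ordinal.{u}}
    (hξ : ξ < α) : PairMem (diagonalCode α S) (VDom.ofOrd hξ) (VDom.ofOrd hξ) ↔ ξ ∈ S := by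
  constructor
  · rintro ⟨p, ⟨ζ, hζ, hpζ⟩, hpξ⟩
    obtain ⟨heq, -⟩ := ZFSet.pair_inj.1 (hpζ.symm.trans hpξ)
    rwa [← Ordinal.toZFSet_injective heq]
  · exact fun hξS => ⟨VDom.pair hα (VDom.ofOrd hξ) (VDom.ofOrd hξ), ⟨ξ, hξS, rfl⟩, rfl⟩

/-- The set of ordinals with diagonal code `W` is a branch of the tree `A`. -/
def IsBranch (A W : Set (VDom α)) : Prop :=
  ∀ b : VDom α, b.1.IsOrdinal → ∃ s : VDom α,
    (∀ x : VDom α, x.1 ∈ s.1 ↔ x.1 ∈ b.1 ∧ PairMem W x x) ∧ PairMem A b s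

theorem SetModels.Definable.isBranch {I : SetModels.{u}} {n : ℕ} {A W : ∀ j, Set (I.Dom j)}
    (hA : I.DefinableSet A) (hW : I.DefinableSet W) :
    I.Definable n fun j _ => IsBranch (A j) (W j) :=
  .all (.imp .isOrdinal (.ex (.and (.all (.iff .mem (.and .mem (.pairMem hW)))) (.pairMem hA))))

/-- The tree of the initial segments of the terms of `t`, with the mark `∅`. -/
def treeParam (κ : Ordinal.{u}) (t : Ordinal.{u} → Set Ordinal.{u}) : Set ZFSet.{u} :=
  {x | x = ∅ ∨ ∃ a < κ, ∃ β ≤ a, x = ZFSet.pair β.toZFSet (segmentCode (t a) β)}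

variable {κ : Ordinal.{u}} {t : Ordinal.{u} → Set Ordinal.{u}}

theorem IsBranch.exists_inter_Iio_eq {W : Set (VDom κ)}
    (hW : IsBranch (restrict (treeParam κ t) κ) W) :
    ∃ b : Set Ordinal.{u}, ∀ β < κ, ∃ a < κ, β ≤ a ∧ t a ∩ Iio β = b ∩ Iio β := by
  refine ⟨{ξ | ∃ hξ : ξ < κ, PairMem W (VDom.ofOrd hξ) (VDom.ofOrd hξ)}, fun β hβ => ?_⟩
  obtain ⟨s, hs, p, hp, hps⟩ := hW (VDom.ofOrd hβ) (VDom.isOrdinal_ofOrd hβ)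
  rcases hp with hp | ⟨a, ha, β', hβ', hp⟩
  · exact absurd (hps.symm.trans hp) (pair_ne_empty _ _)
  obtain ⟨hββ', hsa⟩ := ZFSet.pair_inj.1 (hps.symm.trans hp)
  obtain rfl : β = β' := Ordinal.toZFSet_injective hββ'
  refine ⟨a, ha, hβ', ?_⟩
  ext ξ
  simp only [mem_inter_iff, mem_Iio, and_congr_left_iff]
  intro hξ
  have hξs := hs (VDom.ofOrd (hξ.trans hβ))
  rw [hsa, VDom.ofOrd_mem_ofOrd, and_iff_right hξ] at hξs
  rw [← and_iff_right (b := ξ ∈ t a) hξ, ← toZFSet_mem_segmentCode]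
  exact hξs.trans ⟨fun hmem => ⟨_, hmem⟩, fun ⟨_, hmem⟩ => hmem⟩

theorem isBranch_diagonalCode (hα : Order.IsSuccLimit α) (hακ : α < κ) :
    IsBranch (restrict (treeParam κ t) α) (diagonalCode α (t α)) := by
  intro b hb
  obtain ⟨β, hβ, rfl⟩ := VDom.exists_eq_ofOrd hb
  refine ⟨VDom.segment (t α) hβ, fun x => ?_,
    VDom.pair hα (VDom.ofOrd hβ) (VDom.segment (t α) hβ), Or.inr ⟨α, hακ, β, hβ.le, rfl⟩, rfl⟩
  rw [VDom.mem_segment_iff]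
  refine and_congr_right fun hx => ?_
  obtain ⟨ξ, hξ, rfl⟩ := (VDom.mem_ofOrd_iff hβ).1 hx
  rw [VDom.rank_ofOrd, pairMem_diagonalCode hα]

open Classical in
/-- The game in which the first player has to play a branch of the tree of the initial segments of
the terms of `t`; the second player is never able to move. -/
noncomputable def treeGame {γ : Ordinal.{u}} (hκ : Order.IsSuccLimit κ) (hγ : 1 ≤ γ)
    (t : Ordinal.{u} → Set Ordinal.{u}) : SetGame κ γ where
  R := treeParam κ t
  R_mem := by
    rintro x (rfl | ⟨a, ha, β, hβ, rfl⟩)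
    · rw [ZFSet.mem_vonNeumann, ZFSet.rank_empty]
      exact hκ.bot_lt
    · rw [ZFSet.mem_vonNeumann]
      exact rank_pair_lt hκ (by simpa using hβ.trans_lt ha)
        (rank_segmentCode_le.trans_lt (hβ.trans_lt ha))
  side _ _ := True
  move _ A U W := HasEmpty U ∧ ¬ HasEmpty W ∧ IsBranch A W
  side_def _ _ _ := .const _
  move_def _ _ _ _ hA hU hW := .and (.hasEmpty hU) (.and (.not (.hasEmpty hW)) (.isBranch hA hW))
  good α U := ∀ W, ¬ (HasEmpty U ∧ ¬ HasEmpty W ∧ IsBranch (restrict (treeParam κ t) α) W)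
  rank _ U := if HasEmpty U then 1 else 0
  not_move_empty := fun _ _ ⟨⟨_, hz, _⟩, _⟩ => hz
  rank_empty _ := if_neg fun ⟨_, hz, _⟩ => hz
  rank_lt := by
    rintro α U W ⟨hU, hW, -⟩
    rw [if_pos hU, if_neg hW]
    exact zero_lt_one
  rank_le := by
    intro α _ _ _
    split_ifs
    exacts [hγ, zero_le]
  good_iff _ _ _ _ _ _ :=
    ⟨fun hgood W hW => absurd hW (hgood W), fun hgood W hW => hgood W hW fun _ hmove =>
      hW.2.1 hmove.1⟩

theorem ReflectsGames.branchProperty {κ : Cardinal.{u}} {γ : Ordinal.{u}}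
    (hκ : Order.IsSuccLimit κ.ord) (hγ : 1 ≤ γ) (hrefl : ReflectsGames γ κ.ord) :
    BranchProperty κ := by
  intro t
  by_contra hbranch
  have hwin : (treeGame hκ hγ t).Holds κ.ord :=
    ⟨hκ, trivial, fun _ hW => hbranch hW.2.2.exists_inter_Iio_eq⟩
  obtain ⟨α, hακ, hα, -, hgood⟩ := hrefl _ hwin
  exact hgood (diagonalCode α (t α)) ⟨hasEmpty_restrict hα (Or.inl rfl),
    not_hasEmpty_of_forall_pair fun p ⟨ξ, _, hp⟩ => ⟨_, _, hp⟩, isBranch_diagonalCode hα hακ⟩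

end Tree

theorem BranchProperty.exists_bound {κ : Cardinal.{u}} (hκ : BranchProperty κ) {l : Ordinal.{u}}
    (hl : l < κ.ord) (f : Ordinal.{u} → Ordinal.{u}) (hf : ∀ i < l, f i < κ.ord) :
    ∃ δ < κ.ord, ∀ i < l, f i ≤ δ := by
  by_contra! hunbounded
  -- A branch `b` of the sequence of the sets `{i | f i ≤ a}` contains every `i < l`, but the set
  -- that agrees with `b` below `l` omits some `i < l`.
  obtain ⟨b, hb⟩ := hκ fun a => {i | f i ≤ a}
  obtain ⟨a, ha, -, heq⟩ := hb l hl
  obtain ⟨i, hi, hai⟩ := hunbounded a ha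
  obtain ⟨a', -, hle, heq'⟩ := hb _ (max_lt hl (hf i hi))
  have hib : i ∈ {i | f i ≤ a'} ∩ Iio (max l (f i)) :=
    ⟨(le_max_right _ _).trans hle, lt_max_of_lt_left hi⟩
  rw [heq'] at hib
  have hia : i ∈ b ∩ Iio l := ⟨hib.1, hi⟩
  rw [← heq] at hia
  exact hai.not_ge hia.1

/-! ### Completeness of the club filter from reflection of games -/

section Formulas

variable {α : Ordinal.{u}}

/-- `x` is the only ordinal that is an element of `U`. It is the rank of `U` as a position of the
stationarity game. -/
def HasRank (U : Set (VDom α)) (x : VDom α) : Prop :=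
  (x ∈ U ∧ x.1.IsOrdinal) ∧ ∀ y ∈ U, y.1.IsOrdinal → y = x

/-- The section of `U` at `i` contains an ordinal. -/
def SectionNonempty (U : Set (VDom α)) (i : VDom α) : Prop :=
  ∃ x : VDom α, x.1.IsOrdinal ∧ PairMem U i x

/-- All nonempty sections of `U` are unbounded. -/
def SectionsUnbounded (U : Set (VDom α)) : Prop :=
  ∀ i : VDom α, SectionNonempty U i → ∀ b : VDom α, b.1.IsOrdinal →
    ∃ x : VDom α, x.1.IsOrdinal ∧ b.1 ∈ x.1 ∧ PairMem U i x

/-- According to the parameter `A`, the section of `U` at `i` is `h`-stationary in `b`. -/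
def SectionStationaryAt (A U : Set (VDom α)) (h i b : VDom α) : Prop :=
  ∃ s : VDom α, (∀ x : VDom α, x.1 ∈ s.1 ↔ x.1 ∈ b.1 ∧ PairMem U i x) ∧ TripleMem A h b s

/-- If all nonempty sections of `W` are `h`-stationary, then some nonempty section of `U` is not
`h'`-stationary for `h' > h`: a section of `W` is an `h`-club disjoint from a section of `U`, or two
sections of `W` do not reflect simultaneously. -/
def SectionsRefute (A U W : Set (VDom α)) (h : VDom α) : Prop :=
  ∃ j k : VDom α, SectionNonempty W j ∧ SectionNonempty W k ∧
    (((∀ b : VDom α, b.1.IsOrdinal → SectionStationaryAt A W h j b → PairMem W j b) ∧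
      ∃ i, SectionNonempty U i ∧ ∀ x : VDom α, x.1.IsOrdinal → ¬ (PairMem U i x ∧ PairMem W j x)) ∨
    ∀ b : VDom α, b.1.IsOrdinal → ¬ (SectionStationaryAt A W h j b ∧ SectionStationaryAt A W h k b))

/-- The moves of the stationarity game. A position claims that its nonempty sections are stationary,
to the degree given by its rank; a move answers with a position of smaller rank whose claim refutes
this one. -/
def StationarityMove (A U W : Set (VDom α)) : Prop :=
  SectionsUnbounded U ∧ SectionsUnbounded W ∧
    ∃ h h' : VDom α, HasRank U h ∧ HasRank W h' ∧ h'.1 ∈ h.1 ∧ SectionsRefute A U W h'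

/-- The side condition of the stationarity game. Its second half forces the ordinal `δ` marked by
the triple `⟨δ, ⟨∅, ∅⟩⟩` to be an element of the board. -/
def StationaritySide (A : Set (VDom α)) : Prop :=
  SectionsUnbounded A ∧ ∃ d e : VDom α, (∀ y : VDom α, ¬ y.1 ∈ e.1) ∧ TripleMem A d e e

end Formulas

namespace SetModels.Definable

variable {I : SetModels.{u}} {n : ℕ} {A U W : ∀ j, Set (I.Dom j)}

theorem sectionsUnbounded (hU : I.DefinableSet U) :
    I.Definable n fun j _ => SectionsUnbounded (U j) :=
  .all (.imp (.ex (.and .isOrdinal (.pairMem hU)))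
    (.all (.imp .isOrdinal (.ex (.and .isOrdinal (.and .mem (.pairMem hU)))))))

theorem stationaritySide (hA : I.DefinableSet A) :
    I.Definable n fun j _ => StationaritySide (A j) :=
  (sectionsUnbounded hA).and (.ex (.ex (.and (.all (.not .mem)) (.tripleMem hA))))

variable {e e' e'' : ∀ j, (Fin n → I.Dom j) → I.Dom j} [IsVar e] [IsVar e'] [IsVar e'']

theorem hasRank (hU : I.DefinableSet U) : I.Definable n fun j v => HasRank (U j) (e j v) :=
  .and (.and hU.mem .isOrdinal) (.all (.imp hU.mem (.imp .isOrdinal .eq)))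

theorem sectionNonempty (hU : I.DefinableSet U) :
    I.Definable n fun j v => SectionNonempty (U j) (e j v) :=
  .ex (.and .isOrdinal (.pairMem hU))

theorem sectionStationaryAt (hA : I.DefinableSet A) (hU : I.DefinableSet U) :
    I.Definable n fun j v => SectionStationaryAt (A j) (U j) (e j v) (e' j v) (e'' j v) :=
  .ex (.and (.all (.iff .mem (.and .mem (.pairMem hU)))) (.tripleMem hA))

theorem sectionsRefute (hA : I.DefinableSet A) (hU : I.DefinableSet U) (hW : I.DefinableSet W) :
    I.Definable n fun j v => SectionsRefute (A j) (U j) (W j) (e j v) :=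
  .ex (.ex (.and (sectionNonempty hW) (.and (sectionNonempty hW) (.or
    (.and (.all (.imp .isOrdinal (.imp (sectionStationaryAt hA hW) (.pairMem hW))))
      (.ex (.and (sectionNonempty hU)
        (.all (.imp .isOrdinal (.not (.and (.pairMem hU) (.pairMem hW))))))))
    (.all (.imp .isOrdinal
      (.not (.and (sectionStationaryAt hA hW) (sectionStationaryAt hA hW)))))))))

theorem stationarityMove (hA : I.DefinableSet A) (hU : I.DefinableSet U) (hW : I.DefinableSet W) :
    I.Definable n fun j _ => StationarityMove (A j) (U j) (W j) :=
  (sectionsUnbounded hU).and ((sectionsUnbounded hW).and (.ex (.ex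
    (.and (hasRank hU) (.and (hasRank hW) (.and .mem (sectionsRefute hA hU hW)))))))

end SetModels.Definable

section Semantics

variable {α γ η : Ordinal.{u}} {A U : Set (VDom α)} {i : VDom α}

/-- The section of `U` at `i`, as a set of ordinals. -/
def ordSection (U : Set (VDom α)) (i : VDom α) : Set Ordinal.{u} :=
  {ξ | ∃ hξ : ξ < α, PairMem U i (VDom.ofOrd hξ)}

theorem ordSection_subset (U : Set (VDom α)) (i : VDom α) : ordSection U i ⊆ Iio α :=
  fun _ hξ => hξ.1

theorem pairMem_ofOrd_iff {ξ : Ordinal.{u}} (hξ : ξ < α) :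
    PairMem U i (VDom.ofOrd hξ) ↔ ξ ∈ ordSection U i :=
  ⟨fun hmem => ⟨hξ, hmem⟩, fun ⟨_, hmem⟩ => hmem⟩

theorem sectionNonempty_iff : SectionNonempty U i ↔ (ordSection U i).Nonempty :=
  VDom.exists_isOrdinal

theorem sectionsUnbounded_iff :
    SectionsUnbounded U ↔ ∀ i, (ordSection U i).Nonempty → UnboundedIn α (ordSection U i) := by
  refine forall_congr' fun i => ?_
  rw [sectionNonempty_iff, VDom.forall_isOrdinal]
  refine imp_congr_right fun _ => forall_congr' fun β => forall_congr' fun hβ => ?_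
  rw [VDom.exists_isOrdinal]
  simp only [VDom.ofOrd_mem_ofOrd, pairMem_ofOrd_iff]
  constructor
  · rintro ⟨ξ, hξ, hβξ, hmem⟩
    exact ⟨ξ, hmem, hβξ, hξ⟩
  · rintro ⟨ξ, hmem, hβξ, hξ⟩
    exact ⟨ξ, hξ, hβξ, hmem⟩

open Classical in
/-- The rank of a position of the stationarity game, with the value `0` if `U` does not contain
exactly one ordinal. -/
noncomputable def stationarityRank (U : Set (VDom α)) : Ordinal.{u} :=
  if hU : ∃ x, HasRank U x then hU.choose.1.rank else 0

theorem HasRank.stationarityRank_eq {hη : η < α} (hU : HasRank U (VDom.ofOrd hη)) :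
    stationarityRank U = η := by
  have hex : ∃ x, HasRank U x := ⟨_, hU⟩
  have hchoose := hU.2 _ hex.choose_spec.1.1 hex.choose_spec.1.2
  rw [stationarityRank, dif_pos hex, hchoose, VDom.rank_ofOrd]

theorem HasRank.exists_eq_ofOrd {x : VDom α} (hU : HasRank U x) :
    ∃ η, ∃ hη : η < α, x = VDom.ofOrd hη :=
  VDom.exists_eq_ofOrd hU.1.2

theorem StationarityMove.rank_lt {W : Set (VDom α)} (hmove : StationarityMove A U W) :
    stationarityRank W < stationarityRank U := by
  obtain ⟨-, -, h, h', hU, hW, hlt, -⟩ := hmove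
  obtain ⟨η, hη, rfl⟩ := hU.exists_eq_ofOrd
  obtain ⟨η', hη', rfl⟩ := hW.exists_eq_ofOrd
  rw [hU.stationarityRank_eq, hW.stationarityRank_eq]
  exact (VDom.ofOrd_mem_ofOrd _ _).1 hlt

/-- The positions of the stationarity game in which the player to move loses. -/
def StationarityGood (α : Ordinal.{u}) (U : Set (VDom α)) : Prop :=
  ∀ η, ∀ hη : η < α, HasRank U (VDom.ofOrd hη) → SectionsUnbounded U →
    (∀ η' < η, IsReflecting η' α) ∧
      ∀ i, (ordSection U i).Nonempty → IsStationary η α (ordSection U i)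

/-- `A` decides correctly which sets are `η`-stationary in `β < α`, for `η < γ`. -/
def DecidesStationary (γ : Ordinal.{u}) (A : Set (VDom α)) : Prop :=
  ∀ η, ∀ hη : η < α, η < γ → ∀ β, ∀ hβ : β < α, ∀ s : VDom α,
    TripleMem A (VDom.ofOrd hη) (VDom.ofOrd hβ) s ↔
      ∃ S, IsStationary η β S ∧ s.1 = segmentCode S β

theorem DecidesStationary.sectionStationaryAt_iff {β : Ordinal.{u}} (hA : DecidesStationary γ A)
    (hη : η < α) (hηγ : η < γ) (hβ : β < α) :
    SectionStationaryAt A U (VDom.ofOrd hη) i (VDom.ofOrd hβ) ↔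
      IsStationary η β (ordSection U i) := by
  constructor
  · rintro ⟨s, hs, hAs⟩
    obtain ⟨S, hS, hsS⟩ := (hA η hη hηγ β hβ s).1 hAs
    refine hS.of_inter_Iio_subset fun ξ hξ => ⟨hξ.2.trans hβ, ((hs _).1 ?_).2⟩
    rw [hsS]
    exact toZFSet_mem_segmentCode.2 ⟨hξ.2, hξ.1⟩
  · intro hst
    refine ⟨VDom.segment (ordSection U i) hβ, fun x => ?_,
      (hA η hη hηγ β hβ _).2 ⟨_, hst, rfl⟩⟩
    rw [VDom.mem_segment_iff]
    refine and_congr_right fun hx => ?_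
    obtain ⟨ξ, hξ, rfl⟩ := (VDom.mem_ofOrd_iff hβ).1 hx
    rw [pairMem_ofOrd_iff, VDom.rank_ofOrd]

theorem DecidesStationary.sectionsRefute_iff {W : Set (VDom α)} (hA : DecidesStationary γ A)
    (hη : η < α) (hηγ : η < γ) :
    SectionsRefute A U W (VDom.ofOrd hη) ↔
      ∃ j k, (ordSection W j).Nonempty ∧ (ordSection W k).Nonempty ∧
        (((∀ β < α, IsStationary η β (ordSection W j) → β ∈ ordSection W j) ∧
          ∃ i, (ordSection U i).Nonempty ∧ ¬ (ordSection U i ∩ ordSection W j).Nonempty) ∨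
        ∀ β < α, ¬ (IsStationary η β (ordSection W j) ∧ IsStationary η β (ordSection W k))) := by
  refine exists_congr fun j => exists_congr fun k => ?_
  simp only [sectionNonempty_iff, VDom.forall_isOrdinal, hA.sectionStationaryAt_iff hη hηγ,
    pairMem_ofOrd_iff]
  refine and_congr_right fun _ => and_congr_right fun _ => or_congr_left (and_congr_right fun _ =>
    exists_congr fun i => and_congr_right fun _ => ?_)
  constructor
  · rintro hdisj ⟨ξ, hU, hW⟩
    exact hdisj ξ hU.1 ⟨hU, hW⟩
  · exact fun hdisj ξ _ hξ => hdisj ⟨ξ, hξ⟩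

theorem StationarityGood.not_of_move {W : Set (VDom α)} (hA : DecidesStationary γ A)
    (hrank : stationarityRank U ≤ γ) (hU : StationarityGood α U) (hmove : StationarityMove A U W) :
    ¬ StationarityGood α W := by
  intro hW
  obtain ⟨hunbU, hunbW, h, h', hrankU, hrankW, hlt, hrefute⟩ := hmove
  obtain ⟨η, hη, rfl⟩ := hrankU.exists_eq_ofOrd
  obtain ⟨η', hη', rfl⟩ := hrankW.exists_eq_ofOrd
  have hηη' : η' < η := (VDom.ofOrd_mem_ofOrd _ _).1 hlt
  rw [hrankU.stationarityRank_eq] at hrank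
  rw [hA.sectionsRefute_iff hη' (hηη'.trans_le hrank)] at hrefute
  obtain ⟨hrefl, hstU⟩ := hU η hη hrankU hunbU
  obtain ⟨-, hstW⟩ := hW η' hη' hrankW hunbW
  obtain ⟨j, k, hj, hk, ⟨hclosed, i, hi, hdisj⟩ | hnorefl⟩ := hrefute
  · exact hdisj ((hstU i hi).inter_nonempty hηη' ⟨ordSection_subset _ _, hstW j hj, hclosed⟩)
  · obtain ⟨β, hβ, hβjk⟩ := (hrefl η' hηη').exists_isStationary (hstW j hj) (hstW k hk)
    exact hnorefl β hβ hβjk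

end Semantics

section Positions

variable {α γ η ξ : Ordinal.{u}} {B D : Set Ordinal.{u}} {i : VDom α}

/-- The position with rank `η` and the two sections `B` and `D`, at the indices `0` and `1`. -/
def twoSections (α η : Ordinal.{u}) (B D : Set Ordinal.{u}) : Set (VDom α) :=
  {x | x.1 = η.toZFSet ∨ (∃ ξ ∈ B, x.1 = ZFSet.pair (Ordinal.toZFSet 0) ξ.toZFSet) ∨
    ∃ ξ ∈ D, x.1 = ZFSet.pair (Ordinal.toZFSet 1) ξ.toZFSet}

theorem hasRank_twoSections (hη : η < α) (B D : Set Ordinal.{u}) :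
    HasRank (twoSections α η B D) (VDom.ofOrd hη) := by
  refine ⟨⟨Or.inl rfl, VDom.isOrdinal_ofOrd hη⟩, ?_⟩
  rintro y (hy | ⟨ξ, -, hy⟩ | ⟨ξ, -, hy⟩) hord
  · exact Subtype.ext hy
  all_goals exact absurd (hy ▸ hord) (not_isOrdinal_pair _ _)

theorem mem_ordSection_twoSections (hα : Order.IsSuccLimit α) :
    ξ ∈ ordSection (twoSections α η B D) i ↔
      ξ < α ∧ ((i.1 = Ordinal.toZFSet 0 ∧ ξ ∈ B) ∨ (i.1 = Ordinal.toZFSet 1 ∧ ξ ∈ D)) := by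
  constructor
  · rintro ⟨hξ, p, hp | ⟨ζ, hζ, hp⟩ | ⟨ζ, hζ, hp⟩, hpi⟩
    · exact absurd (hpi ▸ hp ▸ ZFSet.isOrdinal_toZFSet η) (not_isOrdinal_pair _ _)
    all_goals
      obtain ⟨hi, hζξ⟩ := ZFSet.pair_inj.1 (hpi.symm.trans hp)
      obtain rfl := Ordinal.toZFSet_injective hζξ
    · exact ⟨hξ, Or.inl ⟨hi, hζ⟩⟩
    · exact ⟨hξ, Or.inr ⟨hi, hζ⟩⟩
  · rintro ⟨hξ, hi⟩
    refine ⟨hξ, VDom.pair hα i (VDom.ofOrd hξ), Or.inr ?_, rfl⟩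
    exact hi.imp (fun ⟨hi, hmem⟩ => ⟨ξ, hmem, by rw [← hi]; rfl⟩)
      fun ⟨hi, hmem⟩ => ⟨ξ, hmem, by rw [← hi]; rfl⟩

theorem ordSection_twoSections_zero (hα : Order.IsSuccLimit α) (hB : B ⊆ Iio α)
    (hi : i.1 = Ordinal.toZFSet 0) : ordSection (twoSections α η B D) i = B := by
  ext ξ
  have hne : i.1 ≠ Ordinal.toZFSet 1 := fun hi' =>
    zero_ne_one (Ordinal.toZFSet_injective (hi.symm.trans hi'))
  rw [mem_ordSection_twoSections hα]
  simp only [hne, false_and, or_false, and_iff_right hi]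
  exact and_iff_right_of_imp fun hξ => hB hξ

theorem ordSection_twoSections_one (hα : Order.IsSuccLimit α) (hD : D ⊆ Iio α)
    (hi : i.1 = Ordinal.toZFSet 1) : ordSection (twoSections α η B D) i = D := by
  ext ξ
  have hne : i.1 ≠ Ordinal.toZFSet 0 := fun hi' =>
    zero_ne_one (Ordinal.toZFSet_injective (hi'.symm.trans hi))
  rw [mem_ordSection_twoSections hα]
  simp only [hne, false_and, false_or, and_iff_right hi]
  exact and_iff_right_of_imp fun hξ => hD hξ

theorem isStationary_ordSection_twoSections (hα : Order.IsSuccLimit α) (hB : B ⊆ Iio α)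
    (hD : D ⊆ Iio α) (hstB : IsStationary γ α B) (hstD : IsStationary γ α D)
    (hi : (ordSection (twoSections α η B D) i).Nonempty) :
    IsStationary γ α (ordSection (twoSections α η B D) i) := by
  obtain ⟨ξ, hξ⟩ := hi
  rcases ((mem_ordSection_twoSections hα).1 hξ).2 with ⟨hi, -⟩ | ⟨hi, -⟩
  · rwa [ordSection_twoSections_zero hα hB hi]
  · rwa [ordSection_twoSections_one hα hD hi]

variable {A U : Set (VDom α)}

theorem DecidesStationary.exists_move (hA : DecidesStationary γ A) (hη : η < α)
    (hU : HasRank U (VDom.ofOrd hη)) (hunb : SectionsUnbounded U) (hηγ : η ≤ γ) {η' : Ordinal.{u}}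
    (hη' : η' < η) (hB : B ⊆ Iio α) (hD : D ⊆ Iio α) (hstB : IsStationary η' α B)
    (hstD : IsStationary η' α D)
    (hrefute : ((∀ β < α, IsStationary η' β B → β ∈ B) ∧
        ∃ i, (ordSection U i).Nonempty ∧ ¬ (ordSection U i ∩ B).Nonempty) ∨
      ∀ β < α, ¬ (IsStationary η' β B ∧ IsStationary η' β D)) :
    ∃ W, StationarityMove A U W ∧ StationarityGood α W := by
  have hα := hstB.isSuccLimit
  have hsec (i : VDom α) (hi : (ordSection (twoSections α η' B D) i).Nonempty) :=
    isStationary_ordSection_twoSections hα hB hD hstB hstD hi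
  refine ⟨twoSections α η' B D, ⟨hunb,
    sectionsUnbounded_iff.2 fun i hi => (hsec i hi).unboundedIn, VDom.ofOrd hη,
    VDom.ofOrd (hη'.trans hη), hU, hasRank_twoSections _ _ _,
    (VDom.ofOrd_mem_ofOrd _ _).2 hη', ?_⟩, ?_⟩
  · rw [hA.sectionsRefute_iff _ (hη'.trans_le hηγ)]
    refine ⟨VDom.ofOrd hα.bot_lt, VDom.ofOrd (Ordinal.one_lt_of_isSuccLimit hα), ?_⟩
    rw [ordSection_twoSections_zero hα hB rfl, ordSection_twoSections_one hα hD rfl]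
    obtain ⟨x, hx, -⟩ := hstB.exists_mem_lt
    obtain ⟨y, hy, -⟩ := hstD.exists_mem_lt
    exact ⟨⟨x, hx⟩, ⟨y, hy⟩, hrefute⟩
  · intro ζ hζ hrank _
    obtain rfl : ζ = η' := by
      rw [← hrank.stationarityRank_eq,
        (hasRank_twoSections (hη'.trans hη) B D).stationarityRank_eq]
    exact ⟨fun ζ' hζ' => hstB.isReflecting hζ', hsec⟩

theorem DecidesStationary.stationarityGood_of_forall_move (hA : DecidesStationary γ A)
    (hα : Order.IsSuccLimit α) (hrank : stationarityRank U ≤ γ)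
    (hmoves : ∀ W, StationarityMove A U W → ¬ StationarityGood α W) : StationarityGood α U := by
  intro η hη hU hunb
  rw [hU.stationarityRank_eq] at hrank
  have hrefl : ∀ η' < η, IsReflecting η' α := by
    intro η' hη' B hB D hD hstB hstD
    by_contra! hnorefl
    obtain ⟨W, hmove, hgood⟩ := hA.exists_move hη hU hunb hrank hη' hB hD hstB hstD
      (Or.inr fun β hβ hst => hnorefl β hβ hst.1 hst.2)
    exact hmoves W hmove hgood
  refine ⟨hrefl, fun i hi => isStationary_iff.2 ⟨hα, fun _ => sectionsUnbounded_iff.1 hunb i hi,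
    fun η' hη' => ⟨hrefl η' hη', fun C hC => ?_⟩⟩⟩
  by_contra hdisj
  obtain ⟨W, hmove, hgood⟩ := hA.exists_move hη hU hunb hrank hη' hC.1 hC.1 hC.2.1 hC.2.1
    (Or.inl ⟨hC.2.2, i, hi, hdisj⟩)
  exact hmoves W hmove hgood

theorem DecidesStationary.stationarityGood_iff (hA : DecidesStationary γ A)
    (hα : Order.IsSuccLimit α) (hrank : stationarityRank U ≤ γ) :
    StationarityGood α U ↔ ∀ W, StationarityMove A U W → ¬ StationarityGood α W :=
  ⟨fun hU _ => hU.not_of_move hA hrank, hA.stationarityGood_of_forall_move hα hrank⟩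

end Positions

section Game

variable {κ γ δ l : Ordinal.{u}} {C : Ordinal.{u} → Set Ordinal.{u}} {α : Ordinal.{u}}

/-- The parameter of the stationarity game: it codes the initial position with rank `γ` and sections
`C i` for `i < l`, the `η`-stationary sets in `β` for `η < γ` and `β < κ`, and the ordinal `δ`. -/
def stationarityParam (κ γ δ l : Ordinal.{u}) (C : Ordinal.{u} → Set Ordinal.{u}) :
    Set ZFSet.{u} :=
  {x | x = γ.toZFSet ∨ (∃ i < l, ∃ ξ ∈ C i, x = ZFSet.pair i.toZFSet ξ.toZFSet) ∨
    (∃ η < γ, ∃ β < κ, ∃ S, IsStationary η β S ∧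
      x = ZFSet.pair η.toZFSet (ZFSet.pair β.toZFSet (segmentCode S β))) ∨
    x = ZFSet.pair δ.toZFSet (ZFSet.pair ∅ ∅)}

theorem mem_vonNeumann_of_mem_stationarityParam (hκ : Order.IsSuccLimit κ) (hγ : γ ≤ δ)
    (hδ : δ < κ) (hl : l ≤ δ) (hC : ∀ i < l, C i ⊆ Iio κ) :
    ∀ x ∈ stationarityParam κ γ δ l C, x ∈ ZFSet.vonNeumann κ := by
  intro x hx
  rw [ZFSet.mem_vonNeumann]
  rcases hx with rfl | ⟨i, hi, ξ, hξ, rfl⟩ | ⟨η, hη, β, hβ, S, -, rfl⟩ | rfl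
  · simpa using hγ.trans_lt hδ
  · exact rank_pair_lt hκ (by simpa using (hi.trans_le hl).trans hδ) (by simpa using hC i hi hξ)
  · exact rank_pair_lt hκ (by simpa using (hη.trans_le hγ).trans hδ)
      (rank_pair_lt hκ (by simpa using hβ) (rank_segmentCode_le.trans_lt hβ))
  · have hempty : (∅ : ZFSet.{u}).rank < κ := by simpa using hκ.bot_lt
    exact rank_pair_lt hκ (by simpa using hδ) (rank_pair_lt hκ hempty hempty)

theorem mem_ordSection_stationarityParam (hα : Order.IsSuccLimit α) {i : VDom α}
    {ξ : Ordinal.{u}} : ξ ∈ ordSection (restrict (stationarityParam κ γ δ l C) α) i ↔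
      ξ < α ∧ ∃ i' < l, i.1 = i'.toZFSet ∧ ξ ∈ C i' := by
  constructor
  · rintro ⟨hξ, p, hp, hpi⟩
    refine ⟨hξ, ?_⟩
    have hne (x y : ZFSet.{u}) : ξ.toZFSet ≠ ZFSet.pair x y := fun heq =>
      not_isOrdinal_pair x y (heq ▸ ZFSet.isOrdinal_toZFSet ξ)
    rcases hp with hp | ⟨i', hi', ζ, hζ, hp⟩ | ⟨η, -, β, -, S, -, hp⟩ | hp
    · exact absurd (hpi ▸ hp ▸ ZFSet.isOrdinal_toZFSet γ) (not_isOrdinal_pair _ _)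
    · obtain ⟨hii', hξζ⟩ := ZFSet.pair_inj.1 (hpi.symm.trans hp)
      obtain rfl := Ordinal.toZFSet_injective hξζ
      exact ⟨i', hi', hii', hζ⟩
    all_goals exact absurd (ZFSet.pair_inj.1 (hpi.symm.trans hp)).2 (hne _ _)
  · rintro ⟨hξ, i', hi', hii', hmem⟩
    exact ⟨hξ, VDom.pair hα i (VDom.ofOrd hξ),
      Or.inr (Or.inl ⟨i', hi', ξ, hmem, by rw [← hii']; rfl⟩), rfl⟩

theorem tripleMem_stationarityParam_iff (hα : Order.IsSuccLimit α) {d b s : VDom α} :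
    TripleMem (restrict (stationarityParam κ γ δ l C) α) d b s ↔
      (∃ η < γ, ∃ β < κ, ∃ S, IsStationary η β S ∧ d.1 = η.toZFSet ∧ b.1 = β.toZFSet ∧
        s.1 = segmentCode S β) ∨ (d.1 = δ.toZFSet ∧ b.1 = ∅ ∧ s.1 = ∅) := by
  constructor
  · rintro ⟨q, hq, p, hp, hpd⟩
    rcases hp with hp | ⟨i, -, ζ, -, hp⟩ | ⟨η, hη, β, hβ, S, hS, hp⟩ | hp
    · exact absurd (hpd ▸ hp ▸ ZFSet.isOrdinal_toZFSet γ) (not_isOrdinal_pair _ _)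
    · have hqζ := (ZFSet.pair_inj.1 (hpd.symm.trans hp)).2
      exact absurd (hq ▸ hqζ ▸ ZFSet.isOrdinal_toZFSet ζ) (not_isOrdinal_pair _ _)
    all_goals
      obtain ⟨hd, hqbs⟩ := ZFSet.pair_inj.1 (hpd.symm.trans hp)
      obtain ⟨hb, hs⟩ := ZFSet.pair_inj.1 (hq.symm.trans hqbs)
    · exact Or.inl ⟨η, hη, β, hβ, S, hS, hd, hb, hs⟩
    · exact Or.inr ⟨hd, hb, hs⟩
  · intro hdbs
    refine ⟨VDom.pair hα b s, rfl, VDom.pair hα d (VDom.pair hα b s), ?_, rfl⟩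
    change ZFSet.pair d.1 (ZFSet.pair b.1 s.1) ∈ stationarityParam κ γ δ l C
    rcases hdbs with ⟨η, hη, β, hβ, S, hS, hd, hb, hs⟩ | ⟨hd, hb, hs⟩ <;> rw [hd, hb, hs]
    · exact Or.inr (Or.inr (Or.inl ⟨η, hη, β, hβ, S, hS, rfl⟩))
    · exact Or.inr (Or.inr (Or.inr rfl))

theorem decidesStationary_stationarityParam (hα : Order.IsSuccLimit α) (hακ : α ≤ κ)
    (hγ : γ ≤ δ) : DecidesStationary γ (restrict (stationarityParam κ γ δ l C) α) := by
  intro η hη hηγ β hβ s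
  rw [tripleMem_stationarityParam_iff hα]
  constructor
  · rintro (⟨η', -, β', -, S, hS, hηη', hββ', hs⟩ | ⟨hηδ, -, -⟩)
    · obtain rfl := Ordinal.toZFSet_injective hηη'
      obtain rfl := Ordinal.toZFSet_injective hββ'
      exact ⟨S, hS, hs⟩
    · obtain rfl := Ordinal.toZFSet_injective hηδ
      exact absurd hηγ (not_lt.2 hγ)
  · rintro ⟨S, hS, hs⟩
    exact Or.inl ⟨η, hηγ, β, hβ.trans_le hακ, S, hS, rfl, rfl, hs⟩

theorem StationaritySide.lt (hα : Order.IsSuccLimit α)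
    (hside : StationaritySide (restrict (stationarityParam κ γ δ l C) α)) : δ < α := by
  obtain ⟨-, d, e, hempty, htriple⟩ := hside
  have he : e.1 = ∅ := (ZFSet.eq_empty _).2 fun y hy => hempty ⟨y, e.mem_trans hy⟩ hy
  rcases (tripleMem_stationarityParam_iff hα).1 htriple with
    ⟨η, -, β, -, S, hS, -, hβ, -⟩ | ⟨hd, -⟩
  · rw [he, ← Ordinal.toZFSet_zero] at hβ
    rw [← Ordinal.toZFSet_injective hβ] at hS
    exact absurd hS.isSuccLimit.bot_lt (lt_irrefl _)
  · simpa only [hd, Ordinal.rank_toZFSet] using ZFSet.mem_vonNeumann.1 d.2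

theorem hasRank_stationarityParam (hγ : γ < α) :
    HasRank (restrict (stationarityParam κ γ δ l C) α) (VDom.ofOrd hγ) := by
  refine ⟨⟨Or.inl rfl, VDom.isOrdinal_ofOrd hγ⟩, ?_⟩
  rintro y (hy | ⟨_, -, _, -, hy⟩ | ⟨_, -, _, -, _, -, hy⟩ | hy) hord
  · exact Subtype.ext hy
  all_goals exact absurd (hy ▸ hord) (not_isOrdinal_pair _ _)

/-- The game of refuting that the sets `C i`, `i < l`, are `γ`-stationary. -/
noncomputable def stationarityGame (hκ : Order.IsSuccLimit κ) (hγ : γ ≤ δ) (hδ : δ < κ)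
    (hl : l ≤ δ) (hC : ∀ i < l, C i ⊆ Iio κ) : SetGame κ γ where
  R := stationarityParam κ γ δ l C
  R_mem := mem_vonNeumann_of_mem_stationarityParam hκ hγ hδ hl hC
  side _ A := StationaritySide A
  move _ A U W := StationarityMove A U W
  side_def _ _ hA := .stationaritySide hA
  move_def _ _ _ _ hA hU hW := .stationarityMove hA hU hW
  good := StationarityGood
  rank _ U := stationarityRank U
  not_move_empty := fun _ _ ⟨_, _, _, _, hrank, _⟩ => hrank.1.1
  rank_empty _ := dif_neg fun ⟨_, hrank⟩ => hrank.1.1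
  rank_lt _ _ _ hmove := hmove.rank_lt
  rank_le _ _ hα hside :=
    (hasRank_stationarityParam (hγ.trans_lt (hside.lt hα))).stationarityRank_eq.le
  good_iff _ hακ hα _ _ hrank :=
    (decidesStationary_stationarityParam hα hακ hγ).stationarityGood_iff hα hrank

theorem holds_stationarityGame (hκ : Order.IsSuccLimit κ) (hγ : γ ≤ δ) (hδ : δ < κ) (hl : l ≤ δ)
    (hC : ∀ i < l, C i ⊆ Iio κ) (hr : ∀ η < γ, IsReflecting η κ)
    (hst : ∀ i < l, IsStationary γ κ (C i)) : (stationarityGame hκ hγ hδ hl hC).Holds κ := by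
  have hsec : ∀ i, (ordSection (restrict (stationarityParam κ γ δ l C) κ) i).Nonempty →
      IsStationary γ κ (ordSection (restrict (stationarityParam κ γ δ l C) κ) i) := by
    rintro i ⟨ξ, hξ⟩
    obtain ⟨-, i', hi', hii', -⟩ := (mem_ordSection_stationarityParam hκ).1 hξ
    exact (hst i' hi').superset fun x hx =>
      (mem_ordSection_stationarityParam hκ).2 ⟨hC i' hi' hx, i', hi', hii', hx⟩
  have htriple : TripleMem (restrict (stationarityParam κ γ δ l C) κ) (VDom.ofOrd hδ)
      (VDom.ofOrd hκ.bot_lt) (VDom.ofOrd hκ.bot_lt) :=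
    (tripleMem_stationarityParam_iff hκ).2
      (Or.inr ⟨rfl, Ordinal.toZFSet_zero, Ordinal.toZFSet_zero⟩)
  refine ⟨hκ, ⟨sectionsUnbounded_iff.2 fun i hi => (hsec i hi).unboundedIn, VDom.ofOrd hδ,
    VDom.ofOrd hκ.bot_lt, fun y hy => ?_, htriple⟩, fun η hη hrank _ => ?_⟩
  · obtain ⟨ξ, hξ, -⟩ := (VDom.mem_ofOrd_iff _).1 hy
    exact not_lt_bot hξ
  · obtain rfl : η = γ := by
      rw [← hrank.stationarityRank_eq]
      exact (hasRank_stationarityParam (hγ.trans_lt hδ)).stationarityRank_eq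
    exact ⟨hr, hsec⟩

theorem isStationary_of_holds_stationarityGame {hκ : Order.IsSuccLimit κ} {hγ : γ ≤ δ}
    {hδ : δ < κ} {hl : l ≤ δ} {hC : ∀ i < l, C i ⊆ Iio κ}
    (hwin : (stationarityGame hκ hγ hδ hl hC).Holds α) {i : Ordinal.{u}} (hi : i < l)
    (hCδ : ∃ ξ ∈ C i, ξ ≤ δ) : IsStationary γ α (C i) := by
  obtain ⟨hα, hside, hgood⟩ := hwin
  have hδα : δ < α := StationaritySide.lt hα hside
  have hsec := (hgood γ (hγ.trans_lt hδα) (hasRank_stationarityParam _) hside.1).2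
    (VDom.ofOrd ((hi.trans_le hl).trans hδα))
  obtain ⟨ξ, hξ, hξδ⟩ := hCδ
  refine IsStationary.superset (hsec ⟨ξ, (mem_ordSection_stationarityParam hα).2
    ⟨hξδ.trans_lt hδα, i, hi, rfl, hξ⟩⟩) fun x hx => ?_
  obtain ⟨-, i', -, hii', hx'⟩ := (mem_ordSection_stationarityParam hα).1 hx
  rwa [Ordinal.toZFSet_injective hii']

end Game

section Completeness

variable {κ : Cardinal.{u}} {γ : Ordinal.{u}} {ι : Type u}

theorem ReflectsGames.exists_isStationary (hrefl : ReflectsGames γ κ.ord)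
    (hκ : Order.IsSuccLimit κ.ord) (hbr : BranchProperty κ) (hγ : γ < κ.ord)
    (hr : ∀ η < γ, IsReflecting η κ.ord) {l : Ordinal.{u}} (hl : l < κ.ord)
    {C : Ordinal.{u} → Set Ordinal.{u}} (hC : ∀ i < l, C i ⊆ Iio κ.ord)
    (hst : ∀ i < l, IsStationary γ κ.ord (C i)) :
    ∃ α < κ.ord, ∀ i < l, IsStationary γ α (C i) := by
  choose! f hfC hfκ using fun i hi => (hst i hi).exists_mem_lt
  obtain ⟨ε, hε, hfε⟩ := hbr.exists_bound hl f hfκ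
  have hγδ : γ ≤ max (max γ l) ε := (le_max_left _ _).trans (le_max_left _ _)
  have hlδ : l ≤ max (max γ l) ε := (le_max_right _ _).trans (le_max_left _ _)
  obtain ⟨α, hακ, hwin⟩ := hrefl _
    (holds_stationarityGame hκ hγδ (max_lt (max_lt hγ hl) hε) hlδ hC hr hst)
  exact ⟨α, hακ, fun i hi => isStationary_of_holds_stationarityGame hwin hi
    ⟨f i, hfC i hi, (hfε i hi).trans (le_max_right _ _)⟩⟩

theorem ReflectsGames.exists_isStationary_of_mk_lt [Nonempty ι] (hrefl : ReflectsGames γ κ.ord)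
    (hκ : Order.IsSuccLimit κ.ord) (hbr : BranchProperty κ) (hγ : γ < κ.ord)
    (hr : ∀ η < γ, IsReflecting η κ.ord) (hι : Cardinal.mk ι < κ) {D : ι → Set Ordinal.{u}}
    (hst : ∀ i, IsStationary γ κ.ord (D i)) : ∃ α < κ.ord, ∀ i, IsStationary γ α (D i) := by
  obtain ⟨r, hwo, htype⟩ := Cardinal.exists_ord_eq ι
  let e : ι → Ordinal.{u} := Ordinal.typein r
  have he (i : ι) : e i < (Cardinal.mk ι).ord := htype ▸ Ordinal.typein_lt_type r i
  obtain ⟨α, hα, hstα⟩ := hrefl.exists_isStationary hκ hbr hγ hr (Cardinal.ord_lt_ord.2 hι)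
    (C := fun ξ => D (Function.invFun e ξ) ∩ Iio κ.ord) (fun _ _ => inter_subset_right)
    fun _ _ => (hst _).inter_Iio
  refine ⟨α, hα, fun i => ?_⟩
  have hinv : Function.invFun e (e i) = i :=
    Function.leftInverse_invFun (Ordinal.typein_injective r) i
  exact hinv ▸ (hstα (e i) (he i)).superset inter_subset_left

theorem isGClub_iInter_of_forall_exists_isStationary {κ : Ordinal.{u}} [Nonempty ι]
    (hr : ∀ η < γ, IsReflecting η κ)
    (hsim : ∀ D : ι → Set Ordinal.{u}, (∀ i, IsStationary γ κ (D i)) →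
      ∃ α < κ, ∀ i, IsStationary γ α (D i))
    {C : ι → Set Ordinal.{u}} (hC : ∀ i, IsGClub γ κ (C i)) : IsGClub γ κ (⋂ i, C i) := by
  obtain ⟨i₀⟩ := ‹Nonempty ι›
  have hκ : Order.IsSuccLimit κ := IsStationary.isSuccLimit (hC i₀).2.1
  have hclosed {α : Ordinal.{u}} (hα : α < κ) (hst : ∀ i, IsStationary γ α (C i)) :
      α ∈ ⋂ i, C i :=
    mem_iInter.2 fun i => (hC i).2.2 α hα (hst i)
  refine ⟨(iInter_subset C i₀).trans (hC i₀).1, isStationary_iff.2 ⟨hκ, fun _ β hβ => ?_,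
    fun η hη => ⟨hr η hη, fun E hE => ?_⟩⟩, fun α hα hst => hclosed hα fun i =>
      IsStationary.superset hst (iInter_subset C i)⟩
  · obtain ⟨α, hα, hst⟩ := hsim (fun i => C i ∩ Ioo β κ) fun i =>
      IsStationary.inter_Ioo (hC i).2.1 hβ
    obtain ⟨x, hx, hxα⟩ := (hst i₀).exists_mem_lt
    exact ⟨α, hclosed hα fun i => (hst i).superset inter_subset_left, hx.2.1.trans hxα, hα⟩
  · obtain ⟨α, hα, hst⟩ := hsim (fun i => C i ∩ E) fun i =>
      IsStationary.inter_isGClub (hC i).2.1 hη hE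
    exact ⟨α, hclosed hα fun i => (hst i).superset inter_subset_left,
      hE.mem_of_isStationary_inter hα (hst i₀) hη.le⟩

theorem ReflectsGames.isComplete (hrefl : ReflectsGames γ κ.ord) (hκ : Order.IsSuccLimit κ.ord)
    (hbr : BranchProperty κ) (hγ : γ < κ.ord) (hr : ∀ η < γ, IsReflecting η κ.ord) :
    IsComplete κ (clubFilter γ κ.ord) := by
  intro ι _ X hι hX
  choose hXκ C hC hCX using hX
  obtain ⟨i₀⟩ := ‹Nonempty ι›
  exact ⟨(iInter_subset X i₀).trans (hXκ i₀), _,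
    isGClub_iInter_of_forall_exists_isStationary hr
      (fun _ hD => hrefl.exists_isStationary_of_mk_lt hκ hbr hγ hr hι hD) hC, iInter_mono hCX⟩

theorem ReflectsGames.splits {S : Set Ordinal.{u}} (hrefl : ReflectsGames γ κ.ord) (hγ : 1 ≤ γ)
    (hS : IsStationary (γ + 1) κ.ord S) : Splits (γ + 1) κ S := by
  have hbr := hrefl.branchProperty hS.isSuccLimit hγ
  refine splits_of_branchProperty hbr
    (hrefl.isComplete hS.isSuccLimit hbr hS.lt_ord fun η hη => ?_) hS
  exact hS.isReflecting (hη.trans (Order.lt_add_one_iff.2 le_rfl))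

end Completeness

end HigherStat

theorem mainTheorem6 (κ : Cardinal.{u}) :
    (∀ γ : Ordinal.{u}, HigherStat.IsWeaklyCompact κ →
      HigherStat.IsComplete κ (HigherStat.clubFilter γ κ.ord) →
      ∀ S ⊆ Set.Iio κ.ord, HigherStat.IsStationary (γ + 1) κ.ord S →
        HigherStat.Splits (γ + 1) κ S) ∧
    (∀ γ : Ordinal.{u}, 1 ≤ γ → HigherStat.IsIndescribable γ κ →
      ∀ S ⊆ Set.Iio κ.ord, HigherStat.IsStationary (γ + 1) κ.ord S →
        HigherStat.Splits (γ + 1) κ S) ∧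
    (∀ n : ℕ, 1 ≤ n → HigherStat.IsFinIndescribable n κ →
      ∀ S ⊆ Set.Iio κ.ord, HigherStat.IsStationary ((n : Ordinal.{u}) + 1) κ.ord S →
        HigherStat.Splits ((n : Ordinal.{u}) + 1) κ S) :=
  ⟨fun _ hκ hcomp _ _ hS => HigherStat.splits_of_branchProperty hκ.branchProperty hcomp hS,
   fun _ hγ hκ _ _ hS => (hκ.reflectsGames hγ).splits hγ hS,
   fun _ hn hκ _ _ hS => hκ.reflectsGames.splits (by exact_mod_cast hn) hS⟩
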